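/- **Conventions.** A convex pentagon with all inner angles $<180^\circ$, inner angles $A,B,C,D,E$ at its corners in anticlockwise order and sides $a=EA$, $b=AB$, $c=BC$, $d=CD$, $e=DE$, has *property 1* if $|b|=|c|=|a|+|d|$, $D+E=180^\circ$, and $B$ or $C$ divides $360^\circ$ (i.e. an integer multiple of it is $360^\circ$). Gluing it along $e$ to its image under the half-turn about the midpoint of $e$ gives a *glued hexagon*. A *monohedral tiling* with prototile $H$ is a family of sets congruent to $H$ (by direct or opposite isometries) that covers the Euclidean plane and whose members have pairwise disjoint interiors. A symmetry of a tiling is an isometry of the plane that maps it onto itself. For a point $p$, $C_n$ about $p$ is the group of the $n$ rotations about $p$ through multiples of $360^\circ/n$, and $D_n$ about $p$ consists of these rotations and the reflections in $n$ equally spaced axes through $p$. A tiling is a *spiral tiling with $n$ congruent arms around $p$* if its tiles can be partitioned into $n$ classes (arms) such that any two arms are carried onto each other by a rotation in $C_n$ about $p$, and each arm has a *thread*, the threads of different arms being disjoint. A thread of an arm is a simple curve $\theta(t)=p+r(t)e^{i\varphi(t)}$, $t\ge 0$, with $r>0$ and $\varphi$ continuous, $r(t)\to\infty$, $\varphi$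 monotonic with $\varphi(t)\to+\infty$ or $\varphi(t)\to-\infty$, which stays in the union of the tiles of the arm and meets the interior of each of these tiles in a non-empty connected set. **Statement.** Let $n\ge 1$ be an integer. 1. ($C_n$) There are a hexagon $H$, a monohedral tiling $T$ of the plane with prototile $H$, and a point $p$ such that: $H$ is a glued hexagon made of two property-1 pentagons, and it is a convex equilateral hexagon with all inner angles $<180^\circ$; the symmetries of $T$ fixing $p$ are exactly the elements of $C_n$ about $p$; every symmetry of $T$ is an element of this group followed by a translation (so $T$ has no reflection symmetry, and for $n=1$ also no rotational one); if $n\ge 3$, the full symmetry group of $T$ is $C_n$ about $p$; if $n\ge 2$, $T$ is a spiral tiling with $n$ congruent arms around $p$. 2. ($D_n$) There are $H$, $T$ and $p$, with $H$ and $T$ as before, such that: the symmetries of $T$ fixing $p$ are exactly the elements of a group $D_n$ about $p$; if $n\ne 1,3$, every symmetry of $T$ is an element of this group followed by a translation; if $n\ge 4$, the full symmetry group of $T$ is this $D_n$; if $n\ge 2$, $T$ is a spiral tiling with $n$ congruent arms around $p$. -/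

import Mathlib

open Set Filter
open scoped NNReal

/-! The Euclidean plane is `ℂ`; its isometries are the elements of `ℂ ≃ᵢ ℂ`. -/

/-- The planar cross product, positive when `w` points to the left of `z`. -/
def cross (z w : ℂ) : ℝ := z.re * w.im - z.im * w.re

/-- `v` lists, in anticlockwise order, the corners of a convex polygon all of whose inner angles
are strictly between `0` and `π`: all other corners are strictly to the left of each side. -/
def IsConvexPolygon {m : ℕ} [NeZero m] (v : Fin m → ℂ) : Prop :=
  ∀ i j : Fin m, j ≠ i → j ≠ i + 1 → 0 < cross (v (i + 1) - v i) (v j - v i)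

/-- Property 1 of a pentagon with corners `A, B, C, D, E = v 0, v 1, v 2, v 3, v 4` in
anticlockwise order and sides `a = EA`, `b = AB`, `c = BC`, `d = CD`, `e = DE`. -/
structure HasProperty1 (v : Fin 5 → ℂ) : Prop where
  /-- all inner angles are less than `π` -/
  convex : IsConvexPolygon v
  /-- `|b| = |c|` -/
  side_bc : dist (v 0) (v 1) = dist (v 1) (v 2)
  /-- `|c| = |a| + |d|` -/
  side_ad : dist (v 1) (v 2) = dist (v 4) (v 0) + dist (v 2) (v 3)
  /-- `D + E = π` -/
  angle_DE : EuclideanGeometry.angle (v 2) (v 3) (v 4)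
    + EuclideanGeometry.angle (v 3) (v 4) (v 0) = Real.pi
  /-- the angle `C` or the angle `B` divides the full angle -/
  divides :
    (∃ k : ℕ, (k : ℝ) * EuclideanGeometry.angle (v 1) (v 2) (v 3) = 2 * Real.pi) ∨
    (∃ k : ℕ, (k : ℝ) * EuclideanGeometry.angle (v 0) (v 1) (v 2) = 2 * Real.pi)

/-- The union of the pentagon `v` and the copy of it glued to it along the side `e = DE`
(the image of the pentagon under the half-turn about the midpoint of that side). -/
def gluedAlongE (v : Fin 5 → ℂ) : Set ℂ :=
  convexHull ℝ (range v) ∪ (fun z => v 3 + v 4 - z) '' convexHull ℝ (range v)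

/-- `H` is the union of two (congruent) property-1 pentagons glued along their sides `e`. -/
def IsGluedPair (H : Set ℂ) : Prop := ∃ v : Fin 5 → ℂ, HasProperty1 v ∧ H = gluedAlongE v

/-- `H` is a (closed, filled) convex equilateral hexagon, all inner angles being less than `π`. -/
def IsConvexEquilateralHexagon (H : Set ℂ) : Prop :=
  ∃ v : Fin 6 → ℂ, IsConvexPolygon v ∧
    (∀ i j : Fin 6, dist (v i) (v (i + 1)) = dist (v j) (v (j + 1))) ∧
    H = convexHull ℝ (range v)

/-- `T` is a monohedral tiling of the plane with prototile `H`: the tiles are congruent to `H`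
(by direct or opposite isometries), cover the plane and do not overlap. -/
structure IsMonohedralTiling (H : Set ℂ) (T : Set (Set ℂ)) : Prop where
  congruent : ∀ t ∈ T, ∃ g : ℂ ≃ᵢ ℂ, t = g '' H
  cover : ⋃₀ T = univ
  no_overlap : ∀ s ∈ T, ∀ t ∈ T, s ≠ t → Disjoint (interior s) (interior t)

/-- The image of a family of tiles under an isometry. -/
def mapTiles (g : ℂ ≃ᵢ ℂ) (T : Set (Set ℂ)) : Set (Set ℂ) := (fun t => g '' t) '' T

/-- The symmetries of a tiling: all isometries of the plane that map it onto itself. -/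
def symmetries (T : Set (Set ℂ)) : Set (ℂ ≃ᵢ ℂ) := {g | mapTiles g T = T}

/-- The rotation factor `exp (2 π i k / n)`. -/
noncomputable def rot (n : ℕ) (k : ℤ) : ℂ := Complex.exp (2 * Real.pi * Complex.I * k / n)

/-- The group `C_n` about `p`: the rotations about `p` through the multiples of `2 π / n`. -/
def cyclicAt (n : ℕ) (p : ℂ) : Set (ℂ ≃ᵢ ℂ) :=
  {g | ∃ k : ℤ, ∀ z : ℂ, g z = p + rot n k * (z - p)}

/-- The group `D_n` about `p`: the rotations of `C_n` and the reflections in `n` equally spaced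
axes through `p`, one of which is the line `p + ℝ u` (for `u` of modulus `1`). -/
def dihedralAt (n : ℕ) (p u : ℂ) : Set (ℂ ≃ᵢ ℂ) :=
  cyclicAt n p ∪
    {g | ∃ k : ℤ, ∀ z : ℂ, g z = p + rot n k * u ^ 2 * (starRingEnd ℂ) (z - p)}

/-- The symmetries of `T` that fix `p` are exactly the rotations of `C_n` about `p`. -/
def IsCyclicAbout (T : Set (Set ℂ)) (n : ℕ) (p : ℂ) : Prop :=
  {g ∈ symmetries T | g p = p} = cyclicAt n p

/-- The symmetries of `T` that fix `p` are exactly the elements of the group `D_n` about `p` with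
axis direction `u`. -/
def IsDihedralAbout (T : Set (Set ℂ)) (n : ℕ) (p u : ℂ) : Prop :=
  {g ∈ symmetries T | g p = p} = dihedralAt n p u

/-- Every symmetry of `T` is an element of the group `G` of isometries followed by a
translation. -/
def EssentiallyIn (T : Set (Set ℂ)) (G : Set (ℂ ≃ᵢ ℂ)) : Prop :=
  ∀ g ∈ symmetries T, ∃ h ∈ G, ∃ w : ℂ, ∀ z : ℂ, g z = h z + w

/-- `θ` is a thread around `p` of the family `arm` of tiles: a simple curve
`θ t = p + r t * exp (i φ t)` with `r`, `φ` continuous and unbounded and `φ` monotonic (so that it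
winds infinitely often around `p` while going to infinity) that stays in the tiles of the arm,
meets the interior of each of them, and meets it in a connected set. -/
structure IsThread (p : ℂ) (arm : Set (Set ℂ)) (θ : ℝ≥0 → ℂ) : Prop where
  polar : ∃ r φ : ℝ≥0 → ℝ, Continuous r ∧ Continuous φ ∧ (∀ t, 0 < r t) ∧
    Tendsto r atTop atTop ∧
    ((Monotone φ ∧ Tendsto φ atTop atTop) ∨ (Antitone φ ∧ Tendsto φ atTop atBot)) ∧
    ∀ t, θ t = p + r t * Complex.exp (φ t * Complex.I)
  simple : Function.Injective θ
  stays : ∀ t, ∃ s ∈ arm, θ t ∈ s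
  meets : ∀ s ∈ arm, IsConnected (range θ ∩ interior s)

/-- `T` is a spiral tiling around `p` with `n` congruent arms: the tiles are partitioned into `n`
arms, each with a thread, the threads are pairwise disjoint, and the arms are carried onto each
other by the rotations about `p` through the multiples of `2 π / n`. -/
def IsSpiralTiling (T : Set (Set ℂ)) (n : ℕ) (p : ℂ) : Prop :=
  ∃ (arm : Fin n → Set (Set ℂ)) (θ : Fin n → ℝ≥0 → ℂ),
    (⋃ i, arm i) = T ∧
    (∀ i j, i ≠ j → Disjoint (arm i) (arm j)) ∧
    (∀ i, IsThread p (arm i) (θ i)) ∧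
    (∀ i j, i ≠ j → Disjoint (range (θ i)) (range (θ j))) ∧
    (∀ i j, ∃ g ∈ cyclicAt n p, mapTiles g (arm i) = arm j)

/-! ### The cross product -/

/-! Every tile is a centrally symmetric equilateral hexagon, written as a zonotope `zono x a b c`
with unit generators in anticlockwise order. Joining the midpoints of its two sides in direction `b`
cuts it into two pentagons exchanged by the half-turn about the centre. The two half-sides at the
cut are parallel and of length 1/2, so property 1 holds as soon as the angle between `a` and `c`
divides 360°. The direction of `b` remains free, and it decides whether the hexagon has a mirror.

For `n ≥ 3`, let spokes leave the origin at angles alternately `γ` and `2π/n - γ`. Spokes two apart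
always enclose `2π/n`, so the hexagons on three consecutive spokes are all congruent (those for even
and odd middle spoke are mirror images). The bisectors of consecutive spokes cut the plane into `2n`
cones; each is filled by the lattice translates of its hexagon, shifted by the middle spoke in every
second cone, and the cones interlock along zigzags. Thus `n` hexagons meet at the origin. With `γ` a
quarter of the sector the rotations `C_n` remain; with `γ` half of it the spokes are equally spaced
and reflections appear. For `n = 3` the latter hexagon is regular, which is why nothing is claimed
there about the full symmetry group.

For `n = 2` the lattice tiling by an asymmetric or a mirror-symmetric hexagon is used, seen from the
midpoint of an edge. The same mirror-symmetric tiling seen from a general point of a mirror gives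
`D_1`. For `C_1`, rows of a lattice tiling are replaced by mirrored rows, with exactly three
unmirrored rows in asymmetric position.

A thread is a polygon through the centres of consecutive tiles and points of their common edges
(`exists_thread`). Each segment turns left around the origin, so the polar angle increases;
disjointness of the tile interiors makes the curve simple. The arms run through one ring of tiles
after another and advance by one sector per ring (`isSpiralTiling_of`,
`IsSpokeAngle.isSpiralTiling`, `isSpiralTiling_lat`).

Symmetries are controlled metrically. If the long diagonal is the unique diameter of a tile
(`IsAcute.diameter`), isometries between tiles respect it, and an asymmetric hexagon admits no
opposite self-isometry (`IsAcute.not_opposite`). In the spoke tilings the origin is an end of the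
long diagonal of `n ≥ 3` tiles, any other point of at most two; so every symmetry fixes the origin
once these ends are recognisable (`IsSpokeAngle.fixes_zero`). -/

lemma cross_add_left (a b c : ℂ) : cross (a + b) c = cross a c + cross b c := by
  simp [cross]; ring
lemma cross_add_right (a b c : ℂ) : cross a (b + c) = cross a b + cross a c := by
  simp [cross]; ring
lemma cross_sub_left (a b c : ℂ) : cross (a - b) c = cross a c - cross b c := by
  simp [cross]; ring
lemma cross_sub_right (a b c : ℂ) : cross a (b - c) = cross a b - cross a c := by
  simp [cross]; ring
lemma cross_neg_left (a b : ℂ) : cross (-a) b = -cross a b := by simp [cross]; ring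
lemma cross_neg_right (a b : ℂ) : cross a (-b) = -cross a b := by simp [cross]; ring
lemma cross_ofReal_left (s : ℝ) (a b : ℂ) : cross (s * a) b = s * cross a b := by
  simp [cross]; ring
lemma cross_ofReal_right (s : ℝ) (a b : ℂ) : cross a (s * b) = s * cross a b := by
  simp [cross]; ring
lemma cross_natCast_left (s : ℕ) (a b : ℂ) : cross (s * a) b = s * cross a b := by
  simp [cross]; ring
lemma cross_natCast_right (s : ℕ) (a b : ℂ) : cross a (s * b) = s * cross a b := by
  simp [cross]; ring
lemma cross_intCast_left (s : ℤ) (a b : ℂ) : cross (s * a) b = s * cross a b := by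
  simp [cross]; ring
lemma cross_intCast_right (s : ℤ) (a b : ℂ) : cross a (s * b) = s * cross a b := by
  simp [cross]; ring
lemma cross_div_two_left (a b : ℂ) : cross (a / 2) b = cross a b / 2 := by
  simp [cross]; ring
lemma cross_div_two_right (a b : ℂ) : cross a (b / 2) = cross a b / 2 := by
  simp [cross]; ring
lemma cross_self_eq_zero (a : ℂ) : cross a a = 0 := by simp [cross]; ring
lemma cross_swap (a b : ℂ) : cross a b = -cross b a := by simp [cross]; ring
lemma cross_zero_left (a : ℂ) : cross 0 a = 0 := by simp [cross]
lemma cross_zero_right (a : ℂ) : cross a 0 = 0 := by simp [cross]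

lemma cross_mul_left (k a b : ℂ) : cross (k * a) (k * b) = ‖k‖ ^ 2 * cross a b := by
  rw [← Complex.normSq_eq_norm_sq]
  simp [cross, Complex.normSq_apply]; ring

lemma cross_conj (a b : ℂ) :
    cross (starRingEnd ℂ a) (starRingEnd ℂ b) = -cross a b := by
  simp [cross]; ring

/-- Two vectors with non-zero cross product form a basis of the plane. -/
lemma eq_cross_combination {p q : ℂ} (h : cross p q ≠ 0) (z : ℂ) :
    z = ((cross z q / cross p q : ℝ) : ℂ) * p + ((cross p z / cross p q : ℝ) : ℂ) * q := by
  apply Complex.ext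
  · simp only [Complex.add_re, Complex.re_ofReal_mul]
    field_simp
    simp only [cross]; ring
  · simp only [Complex.add_im, Complex.im_ofReal_mul]
    field_simp
    simp only [cross]; ring

lemma ne_zero_of_cross_ne_zero {p q : ℂ} (h : cross p q ≠ 0) : p ≠ 0 := by
  rintro rfl; simp [cross] at h

/-! ### Interiors -/

lemma mem_interior_of_parallelogram {p q : ℂ} (h : cross p q ≠ 0) {S : Set ℂ} {x : ℂ} {ε : ℝ}
    (hε : 0 < ε)
    (hS : ∀ σ τ : ℝ, |σ| < ε → |τ| < ε → x + σ * p + τ * q ∈ S) : x ∈ interior S := by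
  rw [mem_interior_iff_mem_nhds]
  have h1 : Continuous fun z => cross (z - x) q / cross p q := by unfold cross; fun_prop
  have h2 : Continuous fun z => cross p (z - x) / cross p q := by unfold cross; fun_prop
  have e1 := (h1.abs.tendsto x).eventually_lt_const (u := ε) (by simpa [cross_zero_left] using hε)
  have e2 := (h2.abs.tendsto x).eventually_lt_const (u := ε) (by simpa [cross_zero_right] using hε)
  filter_upwards [e1, e2] with z hz1 hz2
  have := hS _ _ hz1 hz2
  rw [add_assoc, ← eq_cross_combination h (z - x)] at this
  simpa using this

/-- An interior point can be moved slightly in direction `i w` inside `S`, which strictly increases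
`cross w`. Hence weak separation by a line separates interiors; the non-overlap proofs rest on this.
-/
lemma cross_lt_of_mem_interior {S : Set ℂ} {w z : ℂ} {α : ℝ} (hw : w ≠ 0)
    (hS : ∀ y ∈ S, cross w y ≤ α) (hz : z ∈ interior S) : cross w z < α := by
  have hc : Continuous fun ε : ℝ => z + ε * (Complex.I * w) := by fun_prop
  have h1 : ∀ᶠ ε : ℝ in nhdsWithin 0 (Ioi 0), z + ε * (Complex.I * w) ∈ S := by
    apply (hc.tendsto 0).mono_left nhdsWithin_le_nhds
    simpa using mem_interior_iff_mem_nhds.1 hz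
  obtain ⟨ε, hε, hε0⟩ := (h1.and self_mem_nhdsWithin).exists
  have h2 := hS _ hε
  rw [cross_add_right, cross_ofReal_right] at h2
  have h3 : 0 < cross w (Complex.I * w) := by
    have := Complex.normSq_pos.2 hw
    rw [Complex.normSq_apply] at this
    simpa [cross] using this
  have := mul_pos hε0 h3
  linarith

lemma lt_cross_of_mem_interior {S : Set ℂ} {w z : ℂ} {α : ℝ} (hw : w ≠ 0)
    (hS : ∀ y ∈ S, α ≤ cross w y) (hz : z ∈ interior S) : α < cross w z := by
  have := cross_lt_of_mem_interior (neg_ne_zero.2 hw) (α := -α)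
    (fun y hy => by rw [cross_neg_left]; linarith [hS y hy]) hz
  rw [cross_neg_left] at this; linarith

lemma disjoint_interior_of_cross {S S' : Set ℂ} {w : ℂ} (α : ℝ) (hw : w ≠ 0)
    (hS : ∀ y ∈ S, cross w y ≤ α) (hS' : ∀ y ∈ S', α ≤ cross w y) :
    Disjoint (interior S) (interior S') := by
  rw [Set.disjoint_left]
  intro z hz hz'
  linarith [cross_lt_of_mem_interior hw hS hz, lt_cross_of_mem_interior hw hS' hz']

/-! ### Zonotopes with three generators -/

/-- The zonotope with corner `x` and generators `a`, `b`, `c`. -/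
def zono (x a b c : ℂ) : Set ℂ :=
  {z | ∃ s t r : ℝ, (0 ≤ s ∧ s ≤ 1) ∧ (0 ≤ t ∧ t ≤ 1) ∧ (0 ≤ r ∧ r ≤ 1) ∧
    z = x + s * a + t * b + r * c}

lemma mk_mem_zono {x a b c z : ℂ} (s t r : ℝ) (hs : 0 ≤ s ∧ s ≤ 1) (ht : 0 ≤ t ∧ t ≤ 1)
    (hr : 0 ≤ r ∧ r ≤ 1) (h : z = x + s * a + t * b + r * c) : z ∈ zono x a b c :=
  ⟨s, t, r, hs, ht, hr, h⟩

lemma base_mem_zono (x a b c : ℂ) : x ∈ zono x a b c :=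
  mk_mem_zono 0 0 0 (by simp) (by simp) (by simp) (by simp)

lemma top_mem_zono (x a b c : ℂ) : x + (a + b + c) ∈ zono x a b c :=
  mk_mem_zono 1 1 1 (by simp) (by simp) (by simp) (by simp; ring)

lemma zono_image_rot {g : ℂ → ℂ} {k w : ℂ} (hg : ∀ z, g z = k * z + w) (x a b c : ℂ) :
    g '' zono x a b c = zono (g x) (k * a) (k * b) (k * c) := by
  ext z; constructor
  · rintro ⟨_, ⟨s, t, r, hs, ht, hr, rfl⟩, rfl⟩
    exact ⟨s, t, r, hs, ht, hr, by rw [hg, hg]; ring⟩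
  · rintro ⟨s, t, r, hs, ht, hr, rfl⟩
    exact ⟨_, ⟨s, t, r, hs, ht, hr, rfl⟩, by rw [hg, hg]; ring⟩

lemma zono_image_refl {g : ℂ → ℂ} {k w : ℂ} (hg : ∀ z, g z = k * starRingEnd ℂ z + w)
    (x a b c : ℂ) :
    g '' zono x a b c = zono (g x) (k * starRingEnd ℂ a) (k * starRingEnd ℂ b)
      (k * starRingEnd ℂ c) := by
  ext z; constructor
  · rintro ⟨_, ⟨s, t, r, hs, ht, hr, rfl⟩, rfl⟩
    exact ⟨s, t, r, hs, ht, hr, by rw [hg, hg]; simp; ring⟩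
  · rintro ⟨s, t, r, hs, ht, hr, rfl⟩
    exact ⟨_, ⟨s, t, r, hs, ht, hr, rfl⟩, by rw [hg, hg]; simp; ring⟩

lemma zono_rev (x a b c : ℂ) : zono x c b a = zono x a b c := by
  ext z; constructor <;>
  · rintro ⟨s, t, r, hs, ht, hr, rfl⟩
    exact ⟨r, t, s, hr, ht, hs, by ring⟩

lemma zono_rotate (x a b c : ℂ) : zono x b c a = zono x a b c := by
  ext z; constructor
  · rintro ⟨s, t, r, hs, ht, hr, rfl⟩
    exact ⟨r, s, t, hr, hs, ht, by ring⟩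
  · rintro ⟨s, t, r, hs, ht, hr, rfl⟩
    exact ⟨t, r, s, ht, hr, hs, by ring⟩

/-- A hexagon can be described from any corner: moving the base along a generator reverses that
generator. With `zono_rotate` and `zono_rev` this lets each of the three edge directions play the
role of the shared edge. -/
lemma zono_neg (x a b c : ℂ) : zono (x + a) (-a) b c = zono x a b c := by
  ext z; constructor <;>
  · rintro ⟨s, t, r, hs, ht, hr, rfl⟩
    exact ⟨1 - s, t, r, ⟨by linarith, by linarith⟩, ht, hr, by push_cast; ring⟩

lemma zono_neg_all (x a b c : ℂ) : zono (x + (a + b + c)) (-a) (-b) (-c) = zono x a b c := by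
  ext z; constructor <;>
  · rintro ⟨s, t, r, hs, ht, hr, rfl⟩
    exact ⟨1 - s, 1 - t, 1 - r, ⟨by linarith, by linarith⟩, ⟨by linarith, by linarith⟩,
      ⟨by linarith, by linarith⟩, by push_cast; ring⟩

lemma convex_zono (x a b c : ℂ) : Convex ℝ (zono x a b c) := by
  rintro _ ⟨s, t, r, hs, ht, hr, rfl⟩ _ ⟨s', t', r', hs', ht', hr', rfl⟩ k l hk hl hkl
  have key : ∀ u u' : ℝ, (0 ≤ u ∧ u ≤ 1) → (0 ≤ u' ∧ u' ≤ 1) →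
      0 ≤ k * u + l * u' ∧ k * u + l * u' ≤ 1 := fun u u' hu hu' =>
    ⟨by have := mul_nonneg hk hu.1; have := mul_nonneg hl hu'.1; linarith,
     by have := mul_le_mul_of_nonneg_left hu.2 hk
        have := mul_le_mul_of_nonneg_left hu'.2 hl; linarith⟩
  refine ⟨_, _, _, key s s' hs hs', key t t' ht ht', key r r' hr hr', ?_⟩
  have : (k : ℂ) + l = 1 := by exact_mod_cast hkl
  simp only [Complex.real_smul]; push_cast
  linear_combination x * this

lemma mem_interior_zono {x a b c : ℂ} (h : cross a c ≠ 0) {s t r : ℝ} (hs : 0 < s ∧ s < 1)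
    (ht : 0 ≤ t ∧ t ≤ 1) (hr : 0 < r ∧ r < 1) :
    x + s * a + t * b + r * c ∈ interior (zono x a b c) := by
  apply mem_interior_of_parallelogram h (ε := min (min s (1 - s)) (min r (1 - r)))
  · simp only [lt_min_iff]; refine ⟨⟨?_, ?_⟩, ?_, ?_⟩ <;> linarith [hs.1, hs.2, hr.1, hr.2]
  · intro σ τ hσ hτ
    simp only [lt_min_iff, abs_lt] at hσ hτ
    refine ⟨s + σ, t, r + τ, ⟨?_, ?_⟩, ht, ⟨?_, ?_⟩, by push_cast; ring⟩ <;> linarith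

lemma center_mem_interior_zono {a b c : ℂ} (h : cross a c ≠ 0) (x : ℂ) :
    x + (a + b + c) / 2 ∈ interior (zono x a b c) := by
  have := mem_interior_zono (x := x) (b := b) h (s := 1 / 2) (t := 1 / 2) (r := 1 / 2)
    (by norm_num) (by norm_num) (by norm_num)
  convert this using 1; push_cast; ring

/-- The midpoint of an edge shared by two translates of a zonotope. -/
lemma edge_mem_interior_union {p r : ℂ} (h : cross p r ≠ 0) (x q : ℂ) :
    x + p + q + r / 2 ∈ interior (zono x p q r ∪ zono (x + (p + q)) p q r) := by
  apply mem_interior_of_parallelogram h (ε := 1 / 2) (by norm_num)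
  intro σ τ hσ hτ
  rw [abs_lt] at hσ hτ
  rcases le_total σ 0 with h0 | h0
  · left
    exact ⟨1 + σ, 1, 1 / 2 + τ, ⟨by linarith, by linarith⟩, by norm_num,
      ⟨by linarith, by linarith⟩, by push_cast; ring⟩
  · right
    exact ⟨σ, 0, 1 / 2 + τ, ⟨by linarith, by linarith⟩, by norm_num,
      ⟨by linarith, by linarith⟩, by push_cast; ring⟩

/-- The middle generator is a positive combination of the outer ones. -/
lemma exists_middle {a b c : ℂ} (hab : 0 < cross a b) (hbc : 0 < cross b c)
    (hac : 0 < cross a c) : ∃ l m : ℝ, 0 < l ∧ 0 < m ∧ b = l * a + m * c :=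
  ⟨cross b c / cross a c, cross a b / cross a c, div_pos hbc hac, div_pos hab hac,
    eq_cross_combination hac.ne' b⟩

/-- Covering of a fundamental parallelogram: `zono 0 a b c` and two triangles. -/
lemma parallelogram_cover {a b c : ℂ} (hab : 0 < cross a b) (hbc : 0 < cross b c)
    (hac : 0 < cross a c) {s t : ℝ} (hs : 0 ≤ s ∧ s ≤ 1) (ht : 0 ≤ t ∧ t ≤ 1) :
    s * (a + b) + t * (c + b) ∈ zono 0 a b c ∨
    (∃ σ τ : ℝ, 0 ≤ τ ∧ τ ≤ σ ∧ σ ≤ 1 ∧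
      s * (a + b) + t * (c + b) = (c + b) + (σ * a + τ * b)) ∨
    (∃ σ τ : ℝ, 0 ≤ τ ∧ τ ≤ σ ∧ σ ≤ 1 ∧
      s * (a + b) + t * (c + b) = (a + b) + (σ * c + τ * b)) := by
  obtain ⟨l, m, hl, hm, hb⟩ := exists_middle hab hbc hac
  rcases le_total (s + t) 1 with h1 | h1
  · left
    exact ⟨s, s + t, t, hs, ⟨by linarith [hs.1, ht.1], h1⟩, ht, by push_cast; ring⟩
  have hlC : (l : ℂ) ≠ 0 := by exact_mod_cast hl.ne'
  have hmC : (m : ℂ) ≠ 0 := by exact_mod_cast hm.ne'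
  -- The coefficient `s + t` of `b` exceeds 1 by `x`, and the excess is distributed through `b = l a
  -- + m c`. If the coefficient of `a` or `c` then exceeds 1, the point has left the hexagon through
  -- a side and lies in a triangle belonging to the neighbour there.
  set x := s + t - 1 with hx
  have hx0 : 0 ≤ x := by linarith
  by_cases h2 : s + x * l ≤ 1 ∧ t + x * m ≤ 1
  · left
    refine ⟨s + x * l, 1, t + x * m, ⟨by nlinarith [hs.1], h2.1⟩, by norm_num,
      ⟨by nlinarith [ht.1], h2.2⟩, ?_⟩
    have hxC : (x : ℂ) = s + t - 1 := by rw [hx]; push_cast; ring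
    push_cast
    linear_combination (-b) * hxC + (x : ℂ) * hb
  have hxC : (x : ℂ) = s + t - 1 := by rw [hx]; push_cast; ring
  have right : 1 - s ≤ x * l → (1 - s) * m ≤ (1 - t) * l →
      ∃ σ τ : ℝ, 0 ≤ τ ∧ τ ≤ σ ∧ σ ≤ 1 ∧
        s * (a + b) + t * (c + b) = (a + b) + (σ * c + τ * b) := by
    intro h3 h4
    refine ⟨t + (1 - s) * m / l, x - (1 - s) / l, ?_, ?_, ?_, ?_⟩
    · rw [sub_nonneg, div_le_iff₀ hl]; exact h3
    · have : 0 ≤ (1 - s) / l := div_nonneg (by linarith [hs.2]) hl.le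
      have : 0 ≤ (1 - s) * m / l := div_nonneg (mul_nonneg (by linarith [hs.2]) hm.le) hl.le
      linarith [hs.2]
    · have : (1 - s) * m / l ≤ 1 - t := by rw [div_le_iff₀ hl]; exact h4
      linarith
    · push_cast; field_simp
      linear_combination (-(l : ℂ) * b) * hxC + (1 - (s : ℂ)) * hb
  have left : 1 - t ≤ x * m → (1 - t) * l ≤ (1 - s) * m →
      ∃ σ τ : ℝ, 0 ≤ τ ∧ τ ≤ σ ∧ σ ≤ 1 ∧
        s * (a + b) + t * (c + b) = (c + b) + (σ * a + τ * b) := by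
    intro h3 h4
    refine ⟨s + (1 - t) * l / m, x - (1 - t) / m, ?_, ?_, ?_, ?_⟩
    · rw [sub_nonneg, div_le_iff₀ hm]; exact h3
    · have : 0 ≤ (1 - t) / m := div_nonneg (by linarith [ht.2]) hm.le
      have : 0 ≤ (1 - t) * l / m := div_nonneg (mul_nonneg (by linarith [ht.2]) hl.le) hm.le
      linarith [ht.2]
    · have : (1 - t) * l / m ≤ 1 - s := by rw [div_le_iff₀ hm]; exact h4
      linarith
    · push_cast; field_simp
      linear_combination (-(m : ℂ) * b) * hxC + (1 - (t : ℂ)) * hb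
  right
  rcases le_total ((1 - s) * m) ((1 - t) * l) with h4 | h4
  · right; apply right _ h4
    by_contra h5
    push Not at h5
    apply h2
    refine ⟨by linarith, ?_⟩
    by_contra h6
    push Not at h6
    have h7 : (1 - t) * l < x * m * l := by apply mul_lt_mul_of_pos_right _ hl; linarith
    have h8 : x * l * m < (1 - s) * m := mul_lt_mul_of_pos_right h5 hm
    nlinarith
  · left; apply left _ h4
    by_contra h5
    push Not at h5
    apply h2
    refine ⟨?_, by linarith⟩
    by_contra h6
    push Not at h6
    have h7 : (1 - s) * m < x * l * m := by apply mul_lt_mul_of_pos_right _ hm; linarith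
    have h8 : x * m * l < (1 - t) * l := mul_lt_mul_of_pos_right h5 hl
    nlinarith

/-- Covering of a fundamental parallelogram: `zono b a b c` and two triangles. -/
lemma parallelogram_cover' {a b c : ℂ} (hab : 0 < cross a b) (hbc : 0 < cross b c)
    (hac : 0 < cross a c) {s t : ℝ} (hs : 0 ≤ s ∧ s ≤ 1) (ht : 0 ≤ t ∧ t ≤ 1) :
    s * (a + b) + t * (c + b) ∈ zono b a b c ∨
    (∃ σ τ : ℝ, 0 ≤ σ ∧ σ ≤ τ ∧ τ ≤ 1 ∧
      s * (a + b) + t * (c + b) = σ * a + τ * b) ∨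
    (∃ σ τ : ℝ, 0 ≤ σ ∧ σ ≤ τ ∧ τ ≤ 1 ∧
      s * (a + b) + t * (c + b) = σ * c + τ * b) := by
  have h := parallelogram_cover hab hbc hac (s := 1 - s) (t := 1 - t)
    ⟨by linarith [hs.2], by linarith [hs.1]⟩ ⟨by linarith [ht.2], by linarith [ht.1]⟩
  rcases h with ⟨x, y, z, hx, hy, hz, h⟩ | ⟨σ, τ, h1, h2, h3, h⟩ | ⟨σ, τ, h1, h2, h3, h⟩
  · left
    refine ⟨1 - x, 1 - y, 1 - z, ⟨by linarith, by linarith⟩, ⟨by linarith, by linarith⟩,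
      ⟨by linarith, by linarith⟩, ?_⟩
    push_cast at h ⊢
    linear_combination -h
  · right; left
    refine ⟨1 - σ, 1 - τ, by linarith, by linarith, by linarith, ?_⟩
    push_cast at h ⊢
    linear_combination -h
  · right; right
    refine ⟨1 - σ, 1 - τ, by linarith, by linarith, by linarith, ?_⟩
    push_cast at h ⊢
    linear_combination -h

/-! ### Isometries of the plane -/

lemma isometry_form (g : ℂ ≃ᵢ ℂ) : ∃ k : ℂ, ‖k‖ = 1 ∧
    ((∀ z, g z = k * z + g 0) ∨ (∀ z, g z = k * starRingEnd ℂ z + g 0)) := by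
  have h1 : ∀ z, g z = g.toRealLinearIsometryEquiv z + g 0 := by
    intro z; simp [IsometryEquiv.toRealLinearIsometryEquiv_apply]
  obtain ⟨k, hk | hk⟩ := linear_isometry_complex g.toRealLinearIsometryEquiv
  · exact ⟨k, Circle.norm_coe k, Or.inl fun z => by rw [h1, hk, rotation_apply]⟩
  · exact ⟨k, Circle.norm_coe k, Or.inr fun z => by
      rw [h1, hk, LinearIsometryEquiv.trans_apply, rotation_apply, Complex.conjLIE_apply]⟩

/-- The direct isometry `z ↦ k * z + w`. -/
noncomputable def rotIso (k : ℂ) (hk : ‖k‖ = 1) (w : ℂ) : ℂ ≃ᵢ ℂ :=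
  (rotation ⟨k, by simpa [Submonoid.unitSphere] using hk⟩).toIsometryEquiv.trans
    (IsometryEquiv.addRight w)

/-- The opposite isometry `z ↦ k * conj z + w`. -/
noncomputable def reflIso (k : ℂ) (hk : ‖k‖ = 1) (w : ℂ) : ℂ ≃ᵢ ℂ :=
  Complex.conjLIE.toIsometryEquiv.trans (rotIso k hk w)

@[simp] lemma rotIso_apply (k : ℂ) (hk : ‖k‖ = 1) (w z : ℂ) : rotIso k hk w z = k * z + w := by
  simp only [rotIso, IsometryEquiv.trans_apply, IsometryEquiv.addRight_apply]
  rfl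

@[simp] lemma reflIso_apply (k : ℂ) (hk : ‖k‖ = 1) (w z : ℂ) :
    reflIso k hk w z = k * starRingEnd ℂ z + w := by
  simp [reflIso]

/-! ### The hexagon -/

lemma convexHull_hexagon {a b c : ℂ} (hab : 0 < cross a b) (hbc : 0 < cross b c)
    (hac : 0 < cross a c) :
    convexHull ℝ (range ![0, a, a + b, a + b + c, b + c, c]) = zono 0 a b c := by
  apply Subset.antisymm
  · apply convexHull_min _ (convex_zono _ _ _ _)
    rintro _ ⟨i, rfl⟩
    fin_cases i
    · exact mk_mem_zono 0 0 0 (by simp) (by simp) (by simp) (by simp)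
    · exact mk_mem_zono 1 0 0 (by simp) (by simp) (by simp) (by simp)
    · exact mk_mem_zono 1 1 0 (by simp) (by simp) (by simp) (by simp)
    · exact mk_mem_zono 1 1 1 (by simp) (by simp) (by simp) (by simp)
    · exact mk_mem_zono 0 1 1 (by simp) (by simp) (by simp) (by simp)
    · exact mk_mem_zono 0 0 1 (by simp) (by simp) (by simp) (by simp)
  · set C := convexHull ℝ (range ![0, a, a + b, a + b + c, b + c, c]) with hC
    have hconv : Convex ℝ C := convex_convexHull ℝ _
    have hv : ∀ i, ![0, a, a + b, a + b + c, b + c, c] i ∈ C := fun i =>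
      subset_convexHull ℝ _ (mem_range_self i)
    have h0 : (0 : ℂ) ∈ C := hv 0
    have h1 : a ∈ C := hv 1
    have h2 : a + b ∈ C := hv 2
    have h3 : a + b + c ∈ C := hv 3
    have h4 : b + c ∈ C := hv 4
    have h5 : c ∈ C := hv 5
    obtain ⟨l, m, hl, hm, hb⟩ := exists_middle hab hbc hac
    have hpos : 0 < 1 + l + m := by linarith
    have hposC : (1 + l + m : ℂ) ≠ 0 := by exact_mod_cast hpos.ne'
    have comb3 : ∀ x y z : ℂ, x ∈ C → y ∈ C → z ∈ C →
        ((1 / (1 + l + m) : ℝ) : ℂ) * x + ((l / (1 + l + m) : ℝ) : ℂ) * y +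
          ((m / (1 + l + m) : ℝ) : ℂ) * z ∈ C := by
      intro x y z hx hy hz
      have := hconv.sum_mem (t := Finset.univ) (w := ![1 / (1 + l + m), l / (1 + l + m),
        m / (1 + l + m)]) (z := ![x, y, z]) (by
          intro i _; fin_cases i <;> simp <;> positivity) (by
          simp [Fin.sum_univ_three]; field_simp) (by
          intro i _; fin_cases i <;> simpa)
      simpa [Fin.sum_univ_three] using this
    -- Of the eight sums of generators only `b` and `a + c` are not corners; `b = l a + m c` makes
    -- them convex combinations of three corners with weights proportional to `1, l, m`.
    have h6 : b ∈ C := by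
      convert comb3 0 (a + b) (b + c) h0 h2 h4 using 1
      push_cast; field_simp
      linear_combination hb
    have h7 : a + c ∈ C := by
      convert comb3 (a + b + c) c a h3 h5 h1 using 1
      push_cast; field_simp
      linear_combination (-1 : ℂ) * hb
    have comb : ∀ (x y : ℂ) (s : ℝ), 0 ≤ s ∧ s ≤ 1 → x ∈ C → x + y ∈ C → x + s * y ∈ C := by
      intro x y s hs hx hy
      have := hconv hx hy (sub_nonneg.2 hs.2) hs.1 (by ring)
      convert this using 1
      simp only [Complex.real_smul]; push_cast; ring
    rintro _ ⟨s, t, r, hs, ht, hr, rfl⟩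
    apply comb _ _ _ hr
    · apply comb _ _ _ ht
      · exact comb _ _ _ hs h0 (by simpa using h1)
      · rw [add_right_comm]
        exact comb _ _ _ hs (by simpa using h6) (by convert h2 using 1; ring)
    · rw [add_right_comm]
      apply comb _ _ _ ht
      · rw [add_right_comm]
        exact comb _ _ _ hs (by simpa using h5) (by convert h7 using 1; ring)
      · have : (0 : ℂ) + s * a + c + b = (b + c) + s * a := by ring
        rw [this]
        exact comb _ _ _ hs h4 (by convert h3 using 1; ring)

lemma isConvexPolygon_hexagon {a b c : ℂ} (hab : 0 < cross a b) (hbc : 0 < cross b c)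
    (hac : 0 < cross a c) : IsConvexPolygon ![0, a, a + b, a + b + c, b + c, c] := by
  unfold cross at hab hbc hac
  intro i j h1 h2
  fin_cases i <;> fin_cases j <;> simp at h1 h2 <;> simp [cross] <;> linarith

lemma isConvexEquilateralHexagon_zono {a b c : ℂ} (hab : 0 < cross a b) (hbc : 0 < cross b c)
    (hac : 0 < cross a c) (ha : ‖a‖ = 1) (hb : ‖b‖ = 1) (hc : ‖c‖ = 1) :
    IsConvexEquilateralHexagon (zono 0 a b c) := by
  refine ⟨_, isConvexPolygon_hexagon hab hbc hac, ?_, (convexHull_hexagon hab hbc hac).symm⟩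
  have : ∀ i : Fin 6, dist (![0, a, a + b, a + b + c, b + c, c] i)
      (![0, a, a + b, a + b + c, b + c, c] (i + 1)) = 1 := by
    intro i
    fin_cases i <;> simp [dist_eq_norm, ha, hb, hc]
  intro i j; rw [this, this]

/-- A corner, half of each of the adjacent sides and the midpoints of the next two sides. -/
lemma isConvexPolygon_pentagon {a b c : ℂ} (hab : 0 < cross a b) (hbc : 0 < cross b c)
    (hac : 0 < cross a c) : IsConvexPolygon ![c, 0, a, a + b / 2, c + b / 2] := by
  have e1 : (b / 2).re = b.re / 2 := by simp
  have e2 : (b / 2).im = b.im / 2 := by simp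
  unfold cross at hab hbc hac
  intro i j h1 h2
  fin_cases i <;> fin_cases j <;> simp at h1 h2 <;>
    simp [cross] <;> linarith

/-- The sides at `D` and `E` other than `e` are halves of the two parallel sides in direction `b`,
so `D` and `E` are supplementary and `|a| = |d| = 1/2`. Only the divisibility of the angle `B` has
to be assumed. -/
lemma hasProperty1_pentagon {a b c : ℂ} (hab : 0 < cross a b) (hbc : 0 < cross b c)
    (hac : 0 < cross a c) (ha : ‖a‖ = 1) (hb : ‖b‖ = 1) (hc : ‖c‖ = 1)
    (hk : ∃ k : ℕ, (k : ℝ) * EuclideanGeometry.angle c 0 a = 2 * Real.pi) :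
    HasProperty1 ![c, 0, a, a + b / 2, c + b / 2] where
  convex := isConvexPolygon_pentagon hab hbc hac
  side_bc := by simp [ha, hc]
  side_ad := by simp [ha, hb, dist_eq_norm]; norm_num
  angle_DE := by
    simp only [EuclideanGeometry.angle, vsub_eq_sub]
    have e1 : (![c, 0, a, a + b / 2, c + b / 2] 2 - ![c, 0, a, a + b / 2, c + b / 2] 3 : ℂ)
        = -(b / 2) := by simp
    have e2 : (![c, 0, a, a + b / 2, c + b / 2] 4 - ![c, 0, a, a + b / 2, c + b / 2] 3 : ℂ)
        = -(a - c) := by simp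
    have e3 : (![c, 0, a, a + b / 2, c + b / 2] 3 - ![c, 0, a, a + b / 2, c + b / 2] 4 : ℂ)
        = a - c := by simp
    have e4 : (![c, 0, a, a + b / 2, c + b / 2] 0 - ![c, 0, a, a + b / 2, c + b / 2] 4 : ℂ)
        = -(b / 2) := by simp
    rw [e1, e2, e3, e4, InnerProductGeometry.angle_neg_right,
      InnerProductGeometry.angle_comm (-(b / 2))]
    ring
  divides := Or.inr (by simpa using hk)

/-- The half-turn about the midpoint of `e` is the one about the centre of the zonotope. It
therefore suffices that the part of the zonotope on one side of the cut lies in the pentagon. -/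
lemma gluedAlongE_pentagon {a b c : ℂ} (hab : 0 < cross a b) (hbc : 0 < cross b c)
    (hac : 0 < cross a c) :
    gluedAlongE ![c, 0, a, a + b / 2, c + b / 2] = zono 0 a b c := by
  have e : (![c, 0, a, a + b / 2, c + b / 2] 3 + ![c, 0, a, a + b / 2, c + b / 2] 4 : ℂ)
      = a + b + c := by simp; ring
  unfold gluedAlongE
  rw [e]
  set P := convexHull ℝ (range ![c, 0, a, a + b / 2, c + b / 2]) with hP
  have sub : P ⊆ zono 0 a b c := by
    apply convexHull_min _ (convex_zono _ _ _ _)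
    rintro _ ⟨i, rfl⟩
    fin_cases i
    · exact mk_mem_zono 0 0 1 (by simp) (by simp) (by simp) (by simp)
    · exact mk_mem_zono 0 0 0 (by simp) (by simp) (by simp) (by simp)
    · exact mk_mem_zono 1 0 0 (by simp) (by simp) (by simp) (by simp)
    · exact mk_mem_zono 1 (1 / 2) 0 (by simp) (by norm_num) (by simp) (by simp; ring)
    · exact mk_mem_zono 0 (1 / 2) 1 (by simp) (by norm_num) (by simp) (by simp; ring)
  apply Subset.antisymm
  · apply union_subset sub
    rintro _ ⟨z, hz, rfl⟩
    obtain ⟨s, t, r, hs, ht, hr, rfl⟩ := sub hz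
    exact ⟨1 - s, 1 - t, 1 - r, ⟨by linarith, by linarith⟩, ⟨by linarith, by linarith⟩,
      ⟨by linarith, by linarith⟩, by push_cast; ring⟩
  · obtain ⟨l, m, hl, hm, hb⟩ := exists_middle hab hbc hac
    have comb : ∀ σ ρ κ : ℝ, 0 ≤ σ → 0 ≤ ρ → σ + ρ ≤ 1 → 0 ≤ κ → κ ≤ 1 →
        σ * a + ρ * c + κ / 2 * (σ + ρ) * b ∈ P := by
      intro σ ρ κ hσ hρ h1 hκ hκ1
      have := (convex_convexHull ℝ (range ![c, 0, a, a + b / 2, c + b / 2])).sum_mem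
        (t := Finset.univ) (w := ![ρ * (1 - κ), 1 - σ - ρ, σ * (1 - κ), σ * κ, ρ * κ])
        (z := ![c, 0, a, a + b / 2, c + b / 2]) (by
          have := sub_nonneg.2 hκ1
          intro i _; fin_cases i <;> simp <;> first | positivity | linarith) (by
          simp [Fin.sum_univ_five]; ring) (fun i _ => subset_convexHull ℝ _ (mem_range_self i))
      convert this using 1
      simp [Fin.sum_univ_five]; ring
    have lower : ∀ s t r : ℝ, (0 ≤ s ∧ s ≤ 1) → (0 ≤ t ∧ t ≤ 1) → (0 ≤ r ∧ r ≤ 1) →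
        s + t * l + (r + t * m) ≤ 1 + (l + m) / 2 → s * a + t * b + r * c ∈ P := by
      intro s t r hs ht hr h
      have hlm : 0 < l + m := by linarith
      have hlmC : (l + m : ℂ) ≠ 0 := by exact_mod_cast hlm.ne'
      rcases le_total (s + t * l + (r + t * m)) 1 with h1 | h1
      · convert comb (s + t * l) (r + t * m) 0
          (add_nonneg hs.1 (mul_nonneg ht.1 hl.le)) (add_nonneg hr.1 (mul_nonneg ht.1 hm.le))
          h1 le_rfl zero_le_one using 1
        push_cast
        linear_combination (t : ℂ) * hb
      -- In the basis `a, c` the coordinate sum is 1 on the segment from `a` to `c` and `1 + (l + m)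
      -- / 2` on the cut. Beyond that segment, `τ` is the multiple of `b` to subtract in order to
      -- return to it; `τ ≤ 1/2` says that the cut is not passed.
      · set τ := (s + t * l + (r + t * m) - 1) / (l + m) with hτ
        have hτ' : τ * (l + m) = s + t * l + (r + t * m) - 1 := by rw [hτ]; field_simp
        have hτC : (τ : ℂ) * (l + m) = s + t * l + (r + t * m) - 1 := by exact_mod_cast hτ'
        have t0 : 0 ≤ τ := div_nonneg (by linarith) hlm.le
        have t1 : τ ≤ 1 / 2 := by rw [hτ, div_le_iff₀ hlm]; linarith
        have hsum : s + t * l - τ * l + (r + t * m - τ * m) = 1 := by linarith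
        have hsumC : (s + t * l - τ * l + (r + t * m - τ * m) : ℂ) = 1 := by exact_mod_cast hsum
        have p1 : 0 ≤ s + t * l - τ * l := by
          have : (s + t * l - τ * l) * (l + m) = s * m + (1 - r) * l := by
            linear_combination (-l) * hτ'
          have h3 : 0 ≤ (s + t * l - τ * l) * (l + m) := by
            rw [this]
            exact add_nonneg (mul_nonneg hs.1 hm.le) (mul_nonneg (by linarith [hr.2]) hl.le)
          exact nonneg_of_mul_nonneg_left h3 hlm
        have p2 : 0 ≤ r + t * m - τ * m := by
          have : (r + t * m - τ * m) * (l + m) = r * l + (1 - s) * m := by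
            linear_combination (-m) * hτ'
          have h3 : 0 ≤ (r + t * m - τ * m) * (l + m) := by
            rw [this]
            exact add_nonneg (mul_nonneg hr.1 hl.le) (mul_nonneg (by linarith [hs.2]) hm.le)
          exact nonneg_of_mul_nonneg_left h3 hlm
        convert comb (s + t * l - τ * l) (r + t * m - τ * m) (2 * τ) p1 p2 hsum.le
          (by linarith) (by linarith) using 1
        push_cast
        linear_combination (t - τ : ℂ) * hb - (τ * b) * hsumC
    rintro _ ⟨s, t, r, hs, ht, hr, rfl⟩
    rcases le_total (s + t * l + (r + t * m)) (1 + (l + m) / 2) with h | h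
    · left
      rw [zero_add]
      exact lower s t r hs ht hr h
    · right
      refine ⟨_, lower (1 - s) (1 - t) (1 - r) ⟨by linarith, by linarith⟩
        ⟨by linarith, by linarith⟩ ⟨by linarith, by linarith⟩ (by linarith), ?_⟩
      push_cast; ring

lemma isGluedPair_zono {a b c : ℂ} (hab : 0 < cross a b) (hbc : 0 < cross b c)
    (hac : 0 < cross a c) (ha : ‖a‖ = 1) (hb : ‖b‖ = 1) (hc : ‖c‖ = 1)
    (hk : ∃ k : ℕ, (k : ℝ) * EuclideanGeometry.angle c 0 a = 2 * Real.pi) :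
    IsGluedPair (zono 0 a b c) :=
  ⟨_, hasProperty1_pentagon hab hbc hac ha hb hc hk, (gluedAlongE_pentagon hab hbc hac).symm⟩

/-! ### Polygonal paths winding around the origin -/

/-- The intervals `[i, i + 1]` form a locally finite closed cover, and `hm` makes the pieces agree
at the common ends. -/
lemma continuous_glue {X : Type*} [TopologicalSpace X] (F : ℕ → ℝ → X)
    (hF : ∀ i, ContinuousOn (F i) (Icc 0 1)) (hm : ∀ i, F i 1 = F (i + 1) 0) :
    Continuous fun t : ℝ≥0 => F ⌊(t : ℝ)⌋₊ (t - ⌊(t : ℝ)⌋₊) := by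
  have key : ∀ (i : ℕ) (t : ℝ≥0), (i : ℝ) ≤ t → (t : ℝ) ≤ i + 1 →
      F ⌊(t : ℝ)⌋₊ (t - ⌊(t : ℝ)⌋₊) = F i (t - i) := by
    intro i t h1 h2
    rcases h2.lt_or_eq with h | h
    · rw [(Nat.floor_eq_iff t.coe_nonneg).2 ⟨h1, h⟩]
    · have : ⌊(t : ℝ)⌋₊ = i + 1 := by rw [h]; exact_mod_cast Nat.floor_natCast (i + 1)
      rw [this, h]; push_cast
      rw [sub_self, add_sub_cancel_left, hm]
  have hlf : LocallyFinite fun i : ℕ => {t : ℝ≥0 | (i : ℝ) ≤ t ∧ (t : ℝ) ≤ i + 1} := by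
    intro t
    refine ⟨Iio (t + 1), Iio_mem_nhds (by simp), ?_⟩
    apply (finite_Iic ⌈(t : ℝ) + 1⌉₊).subset
    rintro i ⟨s, ⟨h1, -⟩, h2⟩
    have h3 : (s : ℝ) < t + 1 := by exact_mod_cast h2
    have : (i : ℝ) ≤ ⌈(t : ℝ) + 1⌉₊ := (h1.trans h3.le).trans (Nat.le_ceil _)
    exact_mod_cast this
  refine hlf.continuous ?_ ?_ ?_
  · apply eq_univ_of_forall
    intro t
    exact mem_iUnion.2 ⟨⌊(t : ℝ)⌋₊, Nat.floor_le t.coe_nonneg, (Nat.lt_floor_add_one _).le⟩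
  · intro i
    exact (isClosed_le continuous_const NNReal.continuous_coe).inter
      (isClosed_le NNReal.continuous_coe continuous_const)
  · intro i
    apply ContinuousOn.congr (f := fun t : ℝ≥0 => F i (t - i))
    · apply (hF i).comp (by fun_prop)
      rintro t ⟨h1, h2⟩
      exact ⟨by linarith, by linarith⟩
    · rintro t ⟨h1, h2⟩
      exact key i t h1 h2

lemma strictMono_glue (F : ℕ → ℝ → ℝ)
    (hF : ∀ i, StrictMonoOn (F i) (Icc 0 1)) (hm : ∀ i, F i 1 = F (i + 1) 0) :
    StrictMono fun t : ℝ≥0 => F ⌊(t : ℝ)⌋₊ (t - ⌊(t : ℝ)⌋₊) := by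
  have h01 : (0 : ℝ) ∈ Icc (0 : ℝ) 1 := by simp
  have h11 : (1 : ℝ) ∈ Icc (0 : ℝ) 1 := by simp
  have hmono : StrictMono fun i => F i 0 := strictMono_nat_of_lt_succ fun i => by
    rw [← hm]; exact hF i h01 h11 one_pos
  have hfl : ∀ t : ℝ≥0, (t : ℝ) - ⌊(t : ℝ)⌋₊ ∈ Ico (0 : ℝ) 1 := fun t =>
    ⟨by linarith [Nat.floor_le t.coe_nonneg], by linarith [Nat.lt_floor_add_one (t : ℝ)]⟩
  intro s t hst
  have hst' : (s : ℝ) < t := hst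
  rcases (Nat.floor_mono hst'.le).lt_or_eq with h | h
  · calc F ⌊(s : ℝ)⌋₊ (s - ⌊(s : ℝ)⌋₊) < F ⌊(s : ℝ)⌋₊ 1 :=
          hF _ (Ico_subset_Icc_self (hfl s)) h11 (hfl s).2
      _ = F (⌊(s : ℝ)⌋₊ + 1) 0 := hm _
      _ ≤ F ⌊(t : ℝ)⌋₊ 0 := hmono.monotone h
      _ ≤ F ⌊(t : ℝ)⌋₊ (t - ⌊(t : ℝ)⌋₊) :=
          (hF _).monotoneOn h01 (Ico_subset_Icc_self (hfl t)) (hfl t).1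
  · have h1 := hfl s
    have h2 := hfl t
    simp only [h] at h1 ⊢
    exact hF _ (Ico_subset_Icc_self h1) (Ico_subset_Icc_self h2) (by linarith)

lemma arg_lt_arg_of_cross_pos {z w : ℂ} (hz : 0 ≤ z.im) (hw : 0 ≤ w.im) (h : 0 < cross z w) :
    z.arg < w.arg := by
  have hz0 : z ≠ 0 := by rintro rfl; simp [cross] at h
  have hw0 : w ≠ 0 := by rintro rfl; simp [cross] at h
  have h1 := Complex.arg_nonneg_iff.2 hz
  have h2 := Complex.arg_nonneg_iff.2 hw
  have h3 := Complex.arg_le_pi z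
  have h4 := Complex.arg_le_pi w
  have h5 : 0 < Real.sin (w.arg - z.arg) := by
    rw [Real.sin_sub, Complex.sin_arg, Complex.cos_arg hw0, Complex.sin_arg, Complex.cos_arg hz0]
    have : w.im / ‖w‖ * (z.re / ‖z‖) - w.re / ‖w‖ * (z.im / ‖z‖) =
        cross z w / (‖z‖ * ‖w‖) := by
      have := norm_pos_iff.2 hz0
      have := norm_pos_iff.2 hw0
      unfold cross; field_simp
    rw [this]
    exact div_pos h (mul_pos (norm_pos_iff.2 hz0) (norm_pos_iff.2 hw0))
  by_contra hcon
  push Not at hcon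
  have := Real.sin_nonpos_of_nonpos_of_neg_pi_le (by linarith) (by linarith : -Real.pi ≤ w.arg - z.arg)
  linarith

lemma im_div_pos {z w : ℂ} (h : 0 < cross z w) : 0 < (w / z).im := by
  have hz0 : z ≠ 0 := by rintro rfl; simp [cross] at h
  have : (w / z).im = cross z w / Complex.normSq z := by
    rw [Complex.div_im]; unfold cross; ring
  rw [this]
  exact div_pos h (Complex.normSq_pos.2 hz0)

/-- The polygon with vertices `a 0`, `a 1`, ... -/
noncomputable def polyPath (a : ℕ → ℂ) (t : ℝ≥0) : ℂ :=
  a ⌊(t : ℝ)⌋₊ + ((t - ⌊(t : ℝ)⌋₊ : ℝ) : ℂ) * (a (⌊(t : ℝ)⌋₊ + 1) - a ⌊(t : ℝ)⌋₊)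

/-- The continuous angle of the vertices. -/
noncomputable def vertexAngle (a : ℕ → ℂ) (i : ℕ) : ℝ :=
  (a 0).arg + ∑ l ∈ Finset.range i, (a (l + 1) / a l).arg

/-- The continuous angle along the polygon. -/
noncomputable def polyAngle (a : ℕ → ℂ) (t : ℝ≥0) : ℝ :=
  vertexAngle a ⌊(t : ℝ)⌋₊ +
    (1 + ((t - ⌊(t : ℝ)⌋₊ : ℝ) : ℂ) * (a (⌊(t : ℝ)⌋₊ + 1) / a ⌊(t : ℝ)⌋₊ - 1)).arg

lemma ne_zero_of_cross_pos {z w : ℂ} (h : 0 < cross z w) : z ≠ 0 := by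
  rintro rfl; simp [cross] at h

/-- The segment from 1 to `q` meets the real axis only at 1, so `arg` is continuous along it; the
cross product of two of its points is `(g - f) * q.im`, which gives monotonicity. -/
lemma polyAngle_piece {q : ℂ} (hq : 0 < q.im) :
    ContinuousOn (fun f : ℝ => (1 + (f : ℂ) * (q - 1)).arg) (Icc 0 1) ∧
      StrictMonoOn (fun f : ℝ => (1 + (f : ℂ) * (q - 1)).arg) (Icc 0 1) := by
  constructor
  · intro f hf
    have hc : ContinuousWithinAt (fun f : ℝ => 1 + (f : ℂ) * (q - 1)) (Icc 0 1) f := by fun_prop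
    apply ContinuousAt.comp_continuousWithinAt (g := Complex.arg) _ hc
    apply Complex.continuousAt_arg
    rw [Complex.mem_slitPlane_iff]
    rcases hf.1.eq_or_lt with rfl | h
    · left; simp
    · right; simpa using ⟨h.ne', hq.ne'⟩
  · intro f hf g hg hfg
    apply arg_lt_arg_of_cross_pos
    · simpa using mul_nonneg hf.1 hq.le
    · simpa using mul_nonneg hg.1 hq.le
    · have : cross (1 + (f : ℂ) * (q - 1)) (1 + (g : ℂ) * (q - 1)) = (g - f) * q.im := by
        simp [cross]; ring
      rw [this]
      exact mul_pos (sub_pos.2 hfg) hq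

lemma vertexAngle_succ (a : ℕ → ℂ) (i : ℕ) :
    vertexAngle a (i + 1) = vertexAngle a i + (a (i + 1) / a i).arg := by
  rw [vertexAngle, vertexAngle, Finset.sum_range_succ, add_assoc]

lemma norm_mul_exp_vertexAngle {a : ℕ → ℂ} (ha : ∀ i, 0 < cross (a i) (a (i + 1))) (i : ℕ) :
    (‖a i‖ : ℂ) * Complex.exp (vertexAngle a i * Complex.I) = a i := by
  induction i with
  | zero => simp [vertexAngle, Complex.norm_mul_exp_arg_mul_I]
  | succ i ih =>
    have h0 := ne_zero_of_cross_pos (ha i)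
    have h1 := Complex.norm_mul_exp_arg_mul_I (a (i + 1) / a i)
    rw [vertexAngle_succ]
    push_cast
    rw [add_mul, Complex.exp_add]
    have h2 : (‖a (i + 1)‖ : ℂ) = ‖a (i + 1) / a i‖ * ‖a i‖ := by
      have := norm_pos_iff.2 h0
      rw [norm_div]; push_cast
      have : (‖a i‖ : ℂ) ≠ 0 := by exact_mod_cast this.ne'
      field_simp
    rw [h2]
    calc _ = ((‖a (i + 1) / a i‖ : ℂ) * Complex.exp ((a (i + 1) / a i).arg * Complex.I)) *
          (‖a i‖ * Complex.exp (vertexAngle a i * Complex.I)) := by ring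
      _ = a (i + 1) := by rw [h1, ih]; field_simp

lemma vertexAngle_strictMono {a : ℕ → ℂ} (ha : ∀ i, 0 < cross (a i) (a (i + 1))) :
    StrictMono (vertexAngle a) := by
  apply strictMono_nat_of_lt_succ
  intro i
  rw [vertexAngle_succ]
  have h := im_div_pos (ha i)
  have : 0 < (a (i + 1) / a i).arg := by
    rcases (Complex.arg_nonneg_iff.2 h.le).eq_or_lt with h1 | h1
    · have := Complex.arg_eq_zero_iff.1 h1.symm
      rw [this.2] at h
      exact absurd h (lt_irrefl _)
    · exact h1
  linarith

lemma vertexAngle_succ_lt {a : ℕ → ℂ} (ha : ∀ i, 0 < cross (a i) (a (i + 1))) (i : ℕ) :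
    vertexAngle a (i + 1) < vertexAngle a i + Real.pi := by
  rw [vertexAngle_succ]
  have h := im_div_pos (ha i)
  have : (a (i + 1) / a i).arg < Real.pi := by
    rcases (Complex.arg_le_pi (a (i + 1) / a i)).eq_or_lt with h1 | h1
    · have := Complex.arg_eq_pi_iff.1 h1
      rw [this.2] at h
      exact absurd h (lt_irrefl _)
    · exact h1
  linarith

lemma continuous_polyPath (a : ℕ → ℂ) : Continuous (polyPath a) :=
  continuous_glue (fun i f => a i + (f : ℂ) * (a (i + 1) - a i))
    (fun i => by fun_prop) (fun i => by simp)

lemma continuous_polyAngle {a : ℕ → ℂ} (ha : ∀ i, 0 < cross (a i) (a (i + 1))) :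
    Continuous (polyAngle a) :=
  continuous_glue (fun i f => vertexAngle a i + (1 + (f : ℂ) * (a (i + 1) / a i - 1)).arg)
    (fun i => continuousOn_const.add (polyAngle_piece (im_div_pos (ha i))).1)
    (fun i => by simp [vertexAngle_succ])

lemma strictMono_polyAngle {a : ℕ → ℂ} (ha : ∀ i, 0 < cross (a i) (a (i + 1))) :
    StrictMono (polyAngle a) :=
  strictMono_glue (fun i f => vertexAngle a i + (1 + (f : ℂ) * (a (i + 1) / a i - 1)).arg)
    (fun i => (polyAngle_piece (im_div_pos (ha i))).2.const_add _)
    (fun i => by simp [vertexAngle_succ])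

lemma polyAngle_natCast (a : ℕ → ℂ) (i : ℕ) : polyAngle a i = vertexAngle a i := by
  simp [polyAngle]

lemma polyPath_natCast (a : ℕ → ℂ) (i : ℕ) : polyPath a i = a i := by
  simp [polyPath]

lemma polyPath_eq {a : ℕ → ℂ} (ha : ∀ i, 0 < cross (a i) (a (i + 1))) (t : ℝ≥0) :
    polyPath a t = ‖polyPath a t‖ * Complex.exp (polyAngle a t * Complex.I) := by
  set i := ⌊(t : ℝ)⌋₊ with hi
  set w := 1 + ((t - i : ℝ) : ℂ) * (a (i + 1) / a i - 1) with hw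
  have h0 := ne_zero_of_cross_pos (ha i)
  have h1 : polyPath a t = a i * w := by
    rw [polyPath, ← hi, hw]; field_simp
  have h2 := Complex.norm_mul_exp_arg_mul_I w
  have h3 := norm_mul_exp_vertexAngle ha i
  rw [h1, polyAngle, ← hi, ← hw, norm_mul]
  push_cast
  rw [add_mul, Complex.exp_add]
  calc a i * w = (‖a i‖ * Complex.exp (vertexAngle a i * Complex.I)) *
        (‖w‖ * Complex.exp (w.arg * Complex.I)) := by rw [h2, h3]
    _ = _ := by ring

lemma polyPath_ne_zero {a : ℕ → ℂ} (ha : ∀ i, 0 < cross (a i) (a (i + 1))) (t : ℝ≥0) :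
    polyPath a t ≠ 0 := by
  set i := ⌊(t : ℝ)⌋₊ with hi
  have h0 := ne_zero_of_cross_pos (ha i)
  have hf : 0 ≤ (t : ℝ) - i := by linarith [Nat.floor_le t.coe_nonneg]
  intro h
  rw [polyPath, ← hi] at h
  rcases hf.eq_or_lt with h1 | h1
  · rw [← h1] at h; simp [h0] at h
  · have : cross (a i) (a i + ((t - i : ℝ) : ℂ) * (a (i + 1) - a i)) =
        (t - i) * cross (a i) (a (i + 1)) := by
      rw [cross_add_right, cross_ofReal_right, cross_sub_right, cross_self_eq_zero]; ring
    rw [h, cross_zero_right] at this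
    have h2 := mul_pos h1 (ha i)
    linarith

/-- If the path returns to the same point, the angle has changed by at least a full turn. -/
lemma polyPath_inj_of_angle {a : ℕ → ℂ} (ha : ∀ i, 0 < cross (a i) (a (i + 1))) {s t : ℝ≥0}
    (h : polyPath a s = polyPath a t) (h2 : |polyAngle a s - polyAngle a t| < 2 * Real.pi) :
    s = t := by
  have hs := polyPath_eq ha s
  have ht := polyPath_eq ha t
  rw [h] at hs
  have hn : (‖polyPath a t‖ : ℂ) ≠ 0 := by
    exact_mod_cast (norm_pos_iff.2 (polyPath_ne_zero ha t)).ne'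
  have h3 := mul_left_cancel₀ hn (hs.symm.trans ht)
  rw [Complex.exp_eq_exp_iff_exists_int] at h3
  obtain ⟨k, hk⟩ := h3
  have hk' : polyAngle a s = polyAngle a t + k * (2 * Real.pi) := by
    have := congrArg Complex.im hk
    simpa using this
  have : k = 0 := by
    rw [hk', add_sub_cancel_left, abs_mul, abs_of_pos Real.two_pi_pos] at h2
    have h4 : |(k : ℝ)| < 1 := by
      by_contra h5
      push Not at h5
      nlinarith [Real.two_pi_pos]
    have h5 : |k| < 1 := by exact_mod_cast h4
    exact Int.abs_lt_one_iff.1 h5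
  rw [this] at hk'
  exact (strictMono_polyAngle ha).injective (by simpa using hk')

/-- Monotonicity alone would allow the angle to converge. `hdiv` provides, arbitrarily late, two
vertices whose directions are not within `ε` of each other in the positive sense, so the increasing
angle grows by at least `ε` infinitely often. -/
lemma tendsto_polyAngle {a : ℕ → ℂ} (ha : ∀ i, 0 < cross (a i) (a (i + 1)))
    {ε : ℝ} (hε : 0 < ε)
    (hdiv : ∀ N, ∃ i j, N ≤ i ∧ i ≤ j ∧ ∀ S ρ : ℝ, 0 ≤ S → S < ε → 0 < ρ →
      a j ≠ ρ * Complex.exp (S * Complex.I) * a i) :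
    Tendsto (polyAngle a) atTop atTop := by
  have step : ∀ N, ∃ j, N ≤ j ∧ vertexAngle a N + ε ≤ vertexAngle a j := by
    intro N
    obtain ⟨i, j, hi, hij, h⟩ := hdiv N
    refine ⟨j, hi.trans hij, ?_⟩
    by_contra hcon
    push Not at hcon
    have h1 := (vertexAngle_strictMono ha).monotone hi
    have h2 := (vertexAngle_strictMono ha).monotone hij
    have n1 := norm_pos_iff.2 (ne_zero_of_cross_pos (ha i))
    have n2 := norm_pos_iff.2 (ne_zero_of_cross_pos (ha j))
    apply h (vertexAngle a j - vertexAngle a i) (‖a j‖ / ‖a i‖) (by linarith) (by linarith)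
      (div_pos n2 n1)
    have hn : (‖a i‖ : ℂ) ≠ 0 := by exact_mod_cast n1.ne'
    conv_lhs => rw [← norm_mul_exp_vertexAngle ha j]
    conv_rhs => rw [← norm_mul_exp_vertexAngle ha i]
    have e1 : Complex.exp (vertexAngle a j * Complex.I) =
        Complex.exp (((vertexAngle a j - vertexAngle a i : ℝ) : ℂ) * Complex.I) *
          Complex.exp (vertexAngle a i * Complex.I) := by
      rw [← Complex.exp_add]; congr 1; push_cast; ring
    rw [e1]
    simp only [norm_mul, Complex.norm_exp_ofReal_mul_I, Complex.norm_real, mul_one, norm_norm]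
    push_cast
    field_simp
  have reach : ∀ k : ℕ, ∃ j, vertexAngle a 0 + k * ε ≤ vertexAngle a j := by
    intro k
    induction k with
    | zero => exact ⟨0, by simp⟩
    | succ k ih =>
      obtain ⟨j, hj⟩ := ih
      obtain ⟨j', -, hj'⟩ := step j
      exact ⟨j', by push_cast; linarith⟩
  apply tendsto_atTop_atTop_of_monotone (strictMono_polyAngle ha).monotone
  intro b
  obtain ⟨k, hk⟩ := exists_nat_ge ((b - vertexAngle a 0) / ε)
  obtain ⟨j, hj⟩ := reach k
  refine ⟨j, ?_⟩
  rw [polyAngle_natCast]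
  rw [div_le_iff₀ hε] at hk
  linarith

lemma tendsto_norm_polyPath {a : ℕ → ℂ} {D : ℝ} (hD : ∀ i, ‖a (i + 1) - a i‖ ≤ D)
    (h : Tendsto (fun i => ‖a i‖) atTop atTop) :
    Tendsto (fun t => ‖polyPath a t‖) atTop atTop := by
  have h1 : Tendsto (fun t : ℝ≥0 => ‖a ⌊(t : ℝ)⌋₊‖ - D) atTop atTop := by
    apply tendsto_atTop_add_const_right
    exact h.comp (tendsto_nat_floor_atTop.comp (NNReal.tendsto_coe_atTop.2 tendsto_id))
  apply tendsto_atTop_mono _ h1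
  intro t
  set i := ⌊(t : ℝ)⌋₊ with hi
  have hf0 : 0 ≤ (t : ℝ) - i := by linarith [Nat.floor_le t.coe_nonneg]
  have hf1 : (t : ℝ) - i ≤ 1 := by linarith [Nat.lt_floor_add_one (t : ℝ)]
  have h2 : ‖((t - i : ℝ) : ℂ) * (a (i + 1) - a i)‖ ≤ D := by
    rw [norm_mul, Complex.norm_real, Real.norm_of_nonneg hf0]
    calc _ ≤ 1 * ‖a (i + 1) - a i‖ := mul_le_mul_of_nonneg_right hf1 (norm_nonneg _)
      _ ≤ D := by rw [one_mul]; exact hD i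
  have h3 : ‖a i‖ - ‖((t - i : ℝ) : ℂ) * (a (i + 1) - a i)‖ ≤ ‖polyPath a t‖ := by
    rw [polyPath, ← hi]
    have := norm_sub_norm_le (a i) (-(((t - i : ℝ) : ℂ) * (a (i + 1) - a i)))
    rw [norm_neg, sub_neg_eq_add] at this
    exact this
  linarith

/-! ### Threads through a sequence of convex tiles -/

lemma disjoint_interior_self_of_convex {s t : Set ℂ} (ht : Convex ℝ t)
    (hne : (interior t).Nonempty) (h : Disjoint (interior s) (interior t)) :
    Disjoint (interior s) t := by
  rw [Set.disjoint_left]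
  intro z hz hzt
  have : z ∈ closure (interior t) := by
    rw [ht.closure_interior_eq_closure_of_nonempty_interior hne]; exact subset_closure hzt
  obtain ⟨y, hy1, hy2⟩ := mem_closure_iff.1 this _ isOpen_interior hz
  exact Set.disjoint_left.1 h hy1 hy2

/-- A convex set with interior points lies in the closure of its interior, so a point of `t` in the
open set would bring interior points of `t` into `A` or `B`. In this way an edge point between two
tiles is seen to lie in no third tile. -/
lemma notMem_of_mem_interior_union {A B t : Set ℂ} {z : ℂ} (ht : Convex ℝ t)
    (hne : (interior t).Nonempty) (hA : Disjoint (interior t) A) (hB : Disjoint (interior t) B)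
    (hz : z ∈ interior (A ∪ B)) : z ∉ t := by
  intro hzt
  have : z ∈ closure (interior t) := by
    rw [ht.closure_interior_eq_closure_of_nonempty_interior hne]; exact subset_closure hzt
  obtain ⟨y, hy1, hy2⟩ := mem_closure_iff.1 this _ isOpen_interior hz
  rcases interior_subset hy1 with h | h
  · exact Set.disjoint_left.1 hA hy2 h
  · exact Set.disjoint_left.1 hB hy2 h

/-- The sequence `c 0, m 0, c 1, m 1, ...`. -/
def interlace (c m : ℕ → ℂ) (i : ℕ) : ℂ := if i % 2 = 0 then c (i / 2) else m (i / 2)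

lemma interlace_even (c m : ℕ → ℂ) (N : ℕ) : interlace c m (2 * N) = c N := by
  simp [interlace]

lemma interlace_odd (c m : ℕ → ℂ) (N : ℕ) : interlace c m (2 * N + 1) = m N := by
  have h1 : (2 * N + 1) / 2 = N := by omega
  simp [interlace, Nat.add_mod, h1]

/-- The thread is the polygon `c 0, m 0, c 1, m 1, ...`. By convexity the open pieces around `c N`
stay inside `t N`, so the curve can meet itself only within one tile or at edge points. Within one
tile it turns by less than a full turn, which excludes a return. The last clause of the conclusion
later separates the threads of different arms. -/
lemma exists_thread {t : ℕ → Set ℂ} {c m : ℕ → ℂ} (conv : ∀ N, Convex ℝ (t N))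
    (hc : ∀ N, c N ∈ interior (t N)) (hm : ∀ N, m N ∈ t N ∧ m N ∈ t (N + 1))
    (hmi : ∀ N, m N ∈ interior (t N ∪ t (N + 1)))
    (dis : ∀ N M, N ≠ M → Disjoint (interior (t N)) (interior (t M)))
    (hcm : ∀ N, 0 < cross (c N) (m N)) (hmc : ∀ N, 0 < cross (m N) (c (N + 1)))
    {D : ℝ} (hD1 : ∀ N, ‖m N - c N‖ ≤ D) (hD2 : ∀ N, ‖c (N + 1) - m N‖ ≤ D)
    (hinf : Tendsto (fun N => ‖c N‖) atTop atTop) {ε : ℝ} (hε : 0 < ε)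
    (hdiv : ∀ N, ∃ i j, N ≤ i ∧ i ≤ j ∧ ∀ S ρ : ℝ, 0 ≤ S → S < ε → 0 < ρ →
      c j ≠ ρ * Complex.exp (S * Complex.I) * c i) :
    ∃ θ : ℝ≥0 → ℂ, IsThread 0 (range t) θ ∧ ∀ s, ∃ N, θ s ∈ interior (t N ∪ t (N + 1)) := by
  have dis' : ∀ N M, N ≠ M → Disjoint (interior (t N)) (t M) := fun N M h =>
    disjoint_interior_self_of_convex (conv M) ⟨_, hc M⟩ (dis N M h)
  set a := interlace c m with hadef
  have hae : ∀ N, a (2 * N) = c N := interlace_even c m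
  have hao : ∀ N, a (2 * N + 1) = m N := interlace_odd c m
  have ha : ∀ i, 0 < cross (a i) (a (i + 1)) := by
    intro i
    rcases Nat.even_or_odd' i with ⟨N, rfl | rfl⟩
    · rw [hae, hao]; exact hcm N
    · rw [hao, show 2 * N + 1 + 1 = 2 * (N + 1) by ring, hae]; exact hmc N
  have hD : ∀ i, ‖a (i + 1) - a i‖ ≤ D := by
    intro i
    rcases Nat.even_or_odd' i with ⟨N, rfl | rfl⟩
    · rw [hae, hao]; exact hD1 N
    · rw [hao, show 2 * N + 1 + 1 = 2 * (N + 1) by ring, hae]; exact hD2 N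
  have hD0 : 0 ≤ D := (norm_nonneg _).trans (hD 0)
  have hainf : Tendsto (fun i => ‖a i‖) atTop atTop := by
    have h2 : Tendsto (fun i : ℕ => ‖c (i / 2)‖ - D) atTop atTop := by
      apply tendsto_atTop_add_const_right
      exact hinf.comp (Nat.tendsto_div_const_atTop (by norm_num))
    apply tendsto_atTop_mono _ h2
    intro i
    rcases Nat.even_or_odd' i with ⟨N, rfl | rfl⟩
    · rw [hae, Nat.mul_div_cancel_left _ (by norm_num)]; linarith
    · rw [hao, show (2 * N + 1) / 2 = N by omega]
      have := norm_sub_norm_le (c N) (m N)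
      rw [norm_sub_rev] at this
      linarith [hD1 N]
  have htheta := tendsto_polyAngle ha hε (by
    intro N
    obtain ⟨i, j, h1, h2, h3⟩ := hdiv N
    exact ⟨2 * i, 2 * j, by omega, by omega, by simpa only [hae] using h3⟩)
  -- position of the point with parameter `s`
  have inTile : ∀ (N : ℕ) (s : ℝ≥0), (2 * N - 1 : ℝ) < s → (s : ℝ) < 2 * N + 1 →
      polyPath a s ∈ interior (t N) := by
    intro N s h1 h2
    by_cases h3 : (2 * N : ℝ) ≤ s
    · have hfl : ⌊(s : ℝ)⌋₊ = 2 * N := by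
        rw [Nat.floor_eq_iff s.coe_nonneg]; push_cast; exact ⟨h3, h2⟩
      have := (conv N).combo_interior_self_mem_interior (hc N) (hm N).1
        (a := 1 - (s - 2 * N)) (b := s - 2 * N) (by linarith) (by linarith) (by ring)
      convert this using 1
      rw [polyPath, hfl, hae, hao]
      simp only [Complex.real_smul]; push_cast; ring
    · push Not at h3
      rcases N with _ | N
      · simp at h3
      · push_cast at h1 h2 h3
        have hfl : ⌊(s : ℝ)⌋₊ = 2 * N + 1 := by
          rw [Nat.floor_eq_iff s.coe_nonneg]; push_cast; constructor <;> linarith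
        have := (conv (N + 1)).combo_interior_self_mem_interior (hc (N + 1)) (hm N).2
          (a := s - (2 * N + 1)) (b := 1 - (s - (2 * N + 1))) (by linarith) (by linarith)
          (by ring)
        convert this using 1
        rw [polyPath, hfl, hao, show 2 * N + 1 + 1 = 2 * (N + 1) by ring, hae]
        simp only [Complex.real_smul]; push_cast; ring
  have atEdge : ∀ (N : ℕ) (s : ℝ≥0), (s : ℝ) = 2 * N + 1 → polyPath a s = m N := by
    intro N s h
    have : s = ((2 * N + 1 : ℕ) : ℝ≥0) := by
      apply NNReal.coe_injective; push_cast; exact h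
    rw [this, polyPath_natCast, hao]
  have locate : ∀ s : ℝ≥0, ∃ N : ℕ, ((2 * N - 1 : ℝ) < s ∧ (s : ℝ) < 2 * N + 1) ∨
      (s : ℝ) = 2 * N + 1 := by
    intro s
    -- Tile `N` owns the parameters strictly between `2 N - 1` and `2 N + 1`. At an odd integer the
    -- floor gives the tile being entered; the correction by 1 selects the tile being left, whose
    -- edge point is `m N`.
    refine ⟨⌊((s : ℝ) + 1) / 2⌋₊ - (if (⌊((s : ℝ) + 1) / 2⌋₊ : ℝ) = ((s : ℝ) + 1) / 2
      then 1 else 0), ?_⟩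
    have h0 : 0 ≤ ((s : ℝ) + 1) / 2 := by linarith [s.coe_nonneg]
    have h1 := Nat.floor_le h0
    have h2 := Nat.lt_floor_add_one (((s : ℝ) + 1) / 2)
    split_ifs with h
    · right
      have : 1 ≤ ⌊((s : ℝ) + 1) / 2⌋₊ := by
        rw [Nat.one_le_iff_ne_zero]; intro h3; rw [h3] at h; push_cast at h
        linarith [s.coe_nonneg]
      push_cast [Nat.cast_sub this]; linarith
    · left
      have h3 := lt_of_le_of_ne h1 h
      rw [Nat.sub_zero]
      constructor <;> linarith
  have edge_not : ∀ N M, m N ∉ interior (t M) := by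
    intro N M hM
    by_cases h1 : M = N
    · subst h1
      exact Set.disjoint_left.1 (dis' M (M + 1) (by simp)) hM (hm M).2
    · exact Set.disjoint_left.1 (dis' M N h1) hM (hm N).1
  have inTile' : ∀ (M : ℕ) (s : ℝ≥0), polyPath a s ∈ interior (t M) →
      (2 * M - 1 : ℝ) < s ∧ (s : ℝ) < 2 * M + 1 := by
    intro M s hs
    obtain ⟨N, h | h⟩ := locate s
    · by_cases hNM : N = M
      · subst hNM; exact h
      · exact absurd hs (fun hs => Set.disjoint_left.1 (dis N M hNM) (inTile N s h.1 h.2) hs)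
    · rw [atEdge N s h] at hs
      exact absurd hs (edge_not N M)
  -- The point `m N` lies in the interior of `t N ∪ t (N + 1)`, hence in no other tile, whereas for
  -- `N < M` the point `m M` lies in `t (M + 1)`.
  have edge_inj : ∀ N M, m N = m M → N = M := by
    have key : ∀ N M, N < M → m N ≠ m M := by
      intro N M hNM h
      apply notMem_of_mem_interior_union (conv (M + 1)) ⟨_, hc (M + 1)⟩
        (dis' (M + 1) N (by omega)) (dis' (M + 1) (N + 1) (by omega)) (hmi N)
      rw [h]; exact (hm M).2
    intro N M h
    rcases lt_trichotomy N M with h1 | h1 | h1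
    · exact absurd h (key N M h1)
    · exact h1
    · exact absurd h.symm (key M N h1)
  have window : ∀ (N : ℕ) (s : ℝ≥0), (2 * N - 1 : ℝ) < s → (s : ℝ) < 2 * N + 1 →
      vertexAngle a (2 * N - 1) ≤ polyAngle a s ∧ polyAngle a s < vertexAngle a (2 * N + 1) := by
    intro N s h1 h2
    rw [← polyAngle_natCast, ← polyAngle_natCast]
    refine ⟨(strictMono_polyAngle ha).monotone ?_, strictMono_polyAngle ha ?_⟩
    · rw [← NNReal.coe_le_coe]
      rcases N with _ | N
      · simp
      · rw [show 2 * (N + 1) - 1 = 2 * N + 1 by omega]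
        push_cast at h1 ⊢; linarith
    · rw [← NNReal.coe_lt_coe]; push_cast; exact h2
  -- At most two segments meet a tile and each turns by less than `π`. For `N = 0` the truncated `2
  -- * N - 1` is 0, as it should be: the path starts at the centre `c 0`.
  have wsize : ∀ N, vertexAngle a (2 * N + 1) < vertexAngle a (2 * N - 1) + 2 * Real.pi := by
    intro N
    have h1 := vertexAngle_succ_lt ha (2 * N)
    rcases N with _ | N
    · simp at h1 ⊢; linarith [Real.pi_pos]
    · have h2 := vertexAngle_succ_lt ha (2 * N + 1)
      rw [show 2 * (N + 1) - 1 = 2 * N + 1 by omega]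
      rw [show 2 * (N + 1) = 2 * N + 1 + 1 by ring] at h1 ⊢
      linarith
  refine ⟨polyPath a, ⟨⟨fun s => ‖polyPath a s‖, polyAngle a, (continuous_polyPath a).norm,
    continuous_polyAngle ha, fun s => norm_pos_iff.2 (polyPath_ne_zero ha s),
    tendsto_norm_polyPath hD hainf, Or.inl ⟨(strictMono_polyAngle ha).monotone, htheta⟩, ?_⟩,
    ?_, ?_, ?_⟩, ?_⟩
  · intro s; rw [zero_add]; exact polyPath_eq ha s
  · intro s s' h
    obtain ⟨N, h1 | h1⟩ := locate s
    · have h2 := inTile N s h1.1 h1.2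
      rw [h] at h2
      have h3 := inTile' N s' h2
      have w1 := window N s h1.1 h1.2
      have w2 := window N s' h3.1 h3.2
      have w3 := wsize N
      apply polyPath_inj_of_angle ha h
      rw [abs_lt]; constructor <;> linarith
    · obtain ⟨M, h3 | h3⟩ := locate s'
      · have h2 := inTile M s' h3.1 h3.2
        rw [← h, atEdge N s h1] at h2
        exact absurd h2 (edge_not N M)
      · rw [atEdge N s h1, atEdge M s' h3] at h
        have := edge_inj N M h
        subst this
        apply NNReal.coe_injective; rw [h1, h3]
  · intro s
    obtain ⟨N, h1 | h1⟩ := locate s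
    · exact ⟨t N, mem_range_self N, interior_subset (inTile N s h1.1 h1.2)⟩
    · exact ⟨t N, mem_range_self N, by rw [atEdge N s h1]; exact (hm N).1⟩
  · rintro _ ⟨M, rfl⟩
    have : range (polyPath a) ∩ interior (t M) =
        polyPath a '' {s : ℝ≥0 | (2 * M - 1 : ℝ) < s ∧ (s : ℝ) < 2 * M + 1} := by
      ext z; constructor
      · rintro ⟨⟨s, rfl⟩, hs⟩
        exact ⟨s, inTile' M s hs, rfl⟩
      · rintro ⟨s, hs, rfl⟩
        exact ⟨⟨s, rfl⟩, inTile M s hs.1 hs.2⟩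
    rw [this]
    refine ⟨?_, ?_⟩
    · refine ⟨_, ((2 * M : ℕ) : ℝ≥0), ⟨?_, ?_⟩, rfl⟩ <;> push_cast <;> linarith
    · apply IsPreconnected.image _ _ (continuous_polyPath a).continuousOn
      apply Set.OrdConnected.isPreconnected
      constructor
      rintro x hx y hy z ⟨h1, h2⟩
      have h1' : (x : ℝ) ≤ z := h1
      have h2' : (z : ℝ) ≤ y := h2
      exact ⟨lt_of_lt_of_le hx.1 h1', lt_of_le_of_lt h2' hy.2⟩
  · intro s
    obtain ⟨N, h1 | h1⟩ := locate s
    · exact ⟨N, interior_mono subset_union_left (inTile N s h1.1 h1.2)⟩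
    · exact ⟨N, by rw [atEdge N s h1]; exact hmi N⟩

/-! ### Spirals -/

/-- The pair following `(m, q)` when the pairs with `q ≤ L m` are listed in lexicographic order. -/
def lexNext (L : ℕ → ℕ) (x : ℕ × ℕ) : ℕ × ℕ := if x.2 < L x.1 then (x.1, x.2 + 1) else (x.1 + 1, 0)

/-- The list of the pairs `(m, q)` with `q ≤ L m` in lexicographic order. -/
def lexSeq (L : ℕ → ℕ) : ℕ → ℕ × ℕ
  | 0 => (0, 0)
  | N + 1 => lexNext L (lexSeq L N)

lemma lexSeq_le (L : ℕ → ℕ) (N : ℕ) : (lexSeq L N).2 ≤ L (lexSeq L N).1 := by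
  cases N with
  | zero => simp [lexSeq]
  | succ N =>
    rw [lexSeq, lexNext]
    split_ifs with h
    · exact h
    · simp

lemma lexSeq_fst_mono (L : ℕ → ℕ) : Monotone fun N => (lexSeq L N).1 := by
  apply monotone_nat_of_le_succ
  intro N
  simp only [lexSeq, lexNext]
  split_ifs <;> simp

lemma lexSeq_strictMono (L : ℕ → ℕ) : StrictMono fun N => toLex (lexSeq L N) := by
  apply strictMono_nat_of_lt_succ
  intro N
  simp only [lexSeq, lexNext]
  split_ifs <;> simp [Prod.Lex.toLex_lt_toLex]

lemma exists_lexSeq (L : ℕ → ℕ) (m q : ℕ) (h : q ≤ L m) : ∃ N, lexSeq L N = (m, q) := by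
  have step : ∀ m q, (∃ N, lexSeq L N = (m, 0)) → q ≤ L m → ∃ N, lexSeq L N = (m, q) := by
    intro m q h0
    induction q with
    | zero => exact fun _ => h0
    | succ q ih =>
      intro hq
      obtain ⟨N, hN⟩ := ih (by omega)
      exact ⟨N + 1, by rw [lexSeq, hN, lexNext, if_pos (by simpa using hq)]⟩
  apply step m q _ h
  clear h
  induction m with
  | zero => exact ⟨0, rfl⟩
  | succ m ih =>
    obtain ⟨N, hN⟩ := step m (L m) ih le_rfl
    exact ⟨N + 1, by rw [lexSeq, hN, lexNext, if_neg (by simp)]⟩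

lemma tendsto_lexSeq_fst (L : ℕ → ℕ) : Tendsto (fun N => (lexSeq L N).1) atTop atTop := by
  apply tendsto_atTop_atTop_of_monotone (lexSeq_fst_mono L)
  intro b
  obtain ⟨N, hN⟩ := exists_lexSeq L b 0 (Nat.zero_le _)
  exact ⟨N, by simp [hN]⟩

/-- A thread can pass from the centre `c` of the tile `t` to the centre `c'` of the tile `t'`,
through a point of a common edge at distance at most `D` from both, turning left around `0`. -/
def Passes (D : ℝ) (c : ℂ) (t : Set ℂ) (c' : ℂ) (t' : Set ℂ) : Prop :=
  ∃ M, M ∈ t ∧ M ∈ t' ∧ M ∈ interior (t ∪ t') ∧ 0 < cross c M ∧ 0 < cross M c' ∧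
    ‖M - c‖ ≤ D ∧ ‖c' - M‖ ≤ D

lemma rot_norm (n : ℕ) (k : ℤ) : ‖rot n k‖ = 1 := by
  have : rot n k = Complex.exp ((2 * Real.pi * k / n : ℝ) * Complex.I) := by
    rw [rot]; congr 1; push_cast; ring
  rw [this, Complex.norm_exp_ofReal_mul_I]

lemma rot_add (n : ℕ) (k l : ℤ) : rot n (k + l) = rot n k * rot n l := by
  rw [rot, rot, rot, ← Complex.exp_add]; congr 1; push_cast; ring

lemma rot_zero (n : ℕ) : rot n 0 = 1 := by simp [rot]

lemma rot_mul_neg (n : ℕ) (k : ℤ) : rot n k * rot n (-k) = 1 := by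
  rw [← rot_add, add_neg_cancel, rot_zero]

lemma rot_ne_zero (n : ℕ) (k : ℤ) : rot n k ≠ 0 := by
  rw [← norm_pos_iff, rot_norm]; exact one_pos

lemma interior_image_rot (n : ℕ) (k : ℤ) (t : Set ℂ) :
    interior ((fun z => rot n k * z) '' t) = (fun z => rot n k * z) '' interior t := by
  have h : (fun z => rot n k * z) = (rotIso (rot n k) (rot_norm n k) 0).toHomeomorph := by
    ext z; simp
  rw [h, ← Homeomorph.image_interior]

lemma IsThread.rot {arm : Set (Set ℂ)} {θ : ℝ≥0 → ℂ} (h : IsThread 0 arm θ) (n : ℕ) (k : ℤ) :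
    IsThread 0 ((fun t => (fun z => rot n k * z) '' t) '' arm) (fun s => rot n k * θ s) where
  polar := by
    obtain ⟨r, φ, hr, hφ, h0, h1, h2, h3⟩ := h.polar
    refine ⟨r, fun t => φ t + 2 * Real.pi * k / n, hr, by fun_prop, h0, h1, ?_, ?_⟩
    · rcases h2 with h2 | h2
      · exact Or.inl ⟨h2.1.add_const _, tendsto_atTop_add_const_right _ _ h2.2⟩
      · exact Or.inr ⟨h2.1.add_const _, tendsto_atBot_add_const_right _ _ h2.2⟩
    · intro t
      have e : _root_.rot n k = Complex.exp ((2 * Real.pi * k / n : ℝ) * Complex.I) := by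
        rw [_root_.rot]; congr 1; push_cast; ring
      dsimp only
      rw [h3, e, zero_add, zero_add]
      push_cast
      rw [add_mul, Complex.exp_add]; ring
  simple := fun s t hst => h.simple (mul_left_cancel₀ (rot_ne_zero n k) hst)
  stays := fun t => by
    obtain ⟨s, hs, hts⟩ := h.stays t
    exact ⟨_, mem_image_of_mem _ hs, mem_image_of_mem _ hts⟩
  meets := by
    rintro _ ⟨s, hs, rfl⟩
    have h1 := (h.meets s hs).image (fun z => _root_.rot n k * z) (by fun_prop)
    dsimp only
    rw [interior_image_rot]
    rwa [image_inter (mul_right_injective₀ (rot_ne_zero n k)), ← range_comp] at h1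

lemma mapTiles_rotIso (n : ℕ) (k : ℤ) (A : Set (Set ℂ)) :
    mapTiles (rotIso (rot n k) (rot_norm n k) 0) A =
      (fun t => (fun z => rot n k * z) '' t) '' A := by
  unfold mapTiles
  congr 1; ext t z; simp

/-- The index `m` counts rings and `q ≤ L m` the tiles of the first arm in ring `m`, listed
lexicographically. The other arms and threads are the rotated copies of this one. `turn` compares
the last tiles of consecutive rings, which is enough for infinite winding. -/
lemma isSpiralTiling_of {n : ℕ} {T : Set (Set ℂ)} (L : ℕ → ℕ) (tile : ℕ → ℕ → Set ℂ)
    (cen : ℕ → ℕ → ℂ) (D ε : ℝ) (hε : 0 < ε)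
    (conv : ∀ m q, Convex ℝ (tile m q)) (hc : ∀ m q, cen m q ∈ interior (tile m q))
    (pass1 : ∀ m q, q < L m → Passes D (cen m q) (tile m q) (cen m (q + 1)) (tile m (q + 1)))
    (pass2 : ∀ m, Passes D (cen m (L m)) (tile m (L m)) (cen (m + 1) 0) (tile (m + 1) 0))
    (far : ∀ R : ℝ, ∃ m₀, ∀ m q, m₀ ≤ m → q ≤ L m → R ≤ ‖cen m q‖)
    (turn : ∀ (m : ℕ) (S ρ : ℝ), 0 ≤ S → S < ε → 0 < ρ →
      cen (m + 1) (L (m + 1)) ≠ ρ * Complex.exp (S * Complex.I) * cen m (L m))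
    (mem : ∀ (a : ℤ) (m q : ℕ), q ≤ L m → (fun z => rot n a * z) '' tile m q ∈ T)
    (cover : ∀ t ∈ T, ∃ (a : Fin n) (m q : ℕ), q ≤ L m ∧
      t = (fun z => rot n (a : ℕ) * z) '' tile m q)
    (dis : ∀ (a b : Fin n) (m q m' q' : ℕ), q ≤ L m → q' ≤ L m' →
      ¬Disjoint (interior ((fun z => rot n (a : ℕ) * z) '' tile m q))
        (interior ((fun z => rot n (b : ℕ) * z) '' tile m' q')) →
      a = b ∧ m = m' ∧ q = q') :
    IsSpiralTiling T n 0 := by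
  rcases Nat.eq_zero_or_pos n with rfl | hn
  · refine ⟨fun i => i.elim0, fun i => i.elim0, ?_, fun i => i.elim0, fun i => i.elim0,
      fun i => i.elim0, fun i => i.elim0⟩
    have : T = ∅ := eq_empty_of_forall_notMem fun t ht => by
      obtain ⟨a, -⟩ := cover t ht; exact a.elim0
    rw [this]; exact iUnion_of_empty _
  let t : ℕ → Set ℂ := fun N => tile (lexSeq L N).1 (lexSeq L N).2
  let c : ℕ → ℂ := fun N => cen (lexSeq L N).1 (lexSeq L N).2
  have hpass : ∀ N, Passes D (c N) (t N) (c (N + 1)) (t (N + 1)) := by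
    intro N
    simp only [t, c, lexSeq, lexNext]
    split_ifs with h
    · exact pass1 _ _ h
    · have := pass2 (lexSeq L N).1
      rw [← le_antisymm (lexSeq_le L N) (not_lt.1 h)] at this
      exact this
  choose M hM1 hM2 hM3 hM4 hM5 hM6 hM7 using hpass
  have dis0 : ∀ (a b : Fin n) (N N' : ℕ),
      ¬Disjoint (interior ((fun z => rot n (a : ℕ) * z) '' t N))
        (interior ((fun z => rot n (b : ℕ) * z) '' t N')) → a = b ∧ N = N' := by
    intro a b N N' h
    obtain ⟨h1, h2, h3⟩ := dis a b _ _ _ _ (lexSeq_le L N) (lexSeq_le L N') h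
    exact ⟨h1, (lexSeq_strictMono L).injective (congrArg toLex (Prod.ext h2 h3))⟩
  have ht1 : ∀ N, (fun z => rot n ((⟨0, hn⟩ : Fin n) : ℕ) * z) '' t N = t N := by
    intro N; simp [rot_zero]
  obtain ⟨θ, hθ, hθ2⟩ := exists_thread (t := t) (c := c) (m := M) (fun N => conv _ _)
    (fun N => hc _ _) (fun N => ⟨hM1 N, hM2 N⟩) hM3 (by
      intro N N' hNN
      by_contra hcon
      rw [← ht1 N, ← ht1 N'] at hcon
      exact hNN (dis0 _ _ _ _ hcon).2) hM4 hM5 hM6 hM7 (by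
      rw [tendsto_atTop]
      intro R
      obtain ⟨m₀, hm₀⟩ := far R
      filter_upwards [(tendsto_lexSeq_fst L).eventually_ge_atTop m₀] with N hN
      exact hm₀ _ _ hN (lexSeq_le L N)) hε (by
      intro N
      -- The two late indices required are those of the last tiles of the current ring and of the
      -- next.
      obtain ⟨i, hi⟩ := exists_lexSeq L (lexSeq L N).1 (L (lexSeq L N).1) le_rfl
      obtain ⟨j, hj⟩ := exists_lexSeq L ((lexSeq L N).1 + 1) (L ((lexSeq L N).1 + 1)) le_rfl
      refine ⟨i, j, ?_, ?_, ?_⟩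
      · rw [← (lexSeq_strictMono L).le_iff_le, hi, Prod.Lex.toLex_le_toLex]
        right; exact ⟨rfl, lexSeq_le L N⟩
      · rw [← (lexSeq_strictMono L).le_iff_le, hi, hj, Prod.Lex.toLex_le_toLex]
        left; simp
      · intro S ρ h1 h2 h3
        simp only [c, hi, hj]
        exact turn _ S ρ h1 h2 h3)
  have hrange : ∀ (a : ℤ) (s : Set ℂ), s ∈ (fun t => (fun z => rot n a * z) '' t) '' range t ↔
      ∃ N, s = (fun z => rot n a * z) '' t N := by
    intro a s; constructor
    · rintro ⟨_, ⟨N, rfl⟩, rfl⟩; exact ⟨N, rfl⟩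
    · rintro ⟨N, rfl⟩; exact ⟨_, ⟨N, rfl⟩, rfl⟩
  have hne : ∀ (a : ℤ) (N : ℕ), (interior ((fun z => rot n a * z) '' t N)).Nonempty := by
    intro a N
    rw [interior_image_rot]; exact ⟨_, mem_image_of_mem _ (hc _ _)⟩
  have hconv : ∀ (a : ℤ) (N : ℕ), Convex ℝ ((fun z => rot n a * z) '' t N) := fun a N =>
    (conv _ _).linear_image (LinearMap.mulLeft ℝ (rot n a))
  refine ⟨fun a => (fun t => (fun z => rot n (a : ℕ) * z) '' t) '' range t,
    fun a s => rot n (a : ℕ) * θ s, ?_, ?_, fun a => hθ.rot n _, ?_, ?_⟩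
  · ext s
    rw [mem_iUnion]
    simp only [hrange]
    constructor
    · rintro ⟨a, N, rfl⟩
      exact mem _ _ _ (lexSeq_le L N)
    · intro hs
      obtain ⟨a, m, q, hq, rfl⟩ := cover s hs
      obtain ⟨N, hN⟩ := exists_lexSeq L m q hq
      exact ⟨a, N, by simp only [t, hN]⟩
  · intro a b hab
    rw [Set.disjoint_left]
    intro s hs hs'
    obtain ⟨N, rfl⟩ := (hrange _ _).1 hs
    obtain ⟨N', hN'⟩ := (hrange _ _).1 hs'
    apply hab
    apply (dis0 a b N N' _).1
    rw [← hN', disjoint_self]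
    exact (hne _ N).ne_empty
  · intro a b hab
    rw [Set.disjoint_left]
    rintro _ ⟨s, rfl⟩ ⟨s', hs'⟩
    -- A point of thread `a` is interior to the union of two tiles of arm `a`, so no tile of arm `b`
    -- contains it, while thread `b` stays in tiles of arm `b`.
    obtain ⟨N, hN⟩ := hθ2 s
    obtain ⟨N', hN'⟩ := (hθ.rot n (b : ℕ)).stays s'
    obtain ⟨K, rfl⟩ := (hrange _ _).1 hN'.1
    have h1 : rot n (a : ℕ) * θ s ∈ interior ((fun z => rot n (a : ℕ) * z) '' t N ∪
        (fun z => rot n (a : ℕ) * z) '' t (N + 1)) := by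
      rw [← image_union, interior_image_rot]; exact mem_image_of_mem _ hN
    have hd : ∀ N, Disjoint (interior ((fun z => rot n (b : ℕ) * z) '' t K))
        ((fun z => rot n (a : ℕ) * z) '' t N) := by
      intro N
      apply disjoint_interior_self_of_convex (hconv _ _) (hne _ _)
      by_contra hcon
      exact hab (dis0 _ _ _ _ hcon).1.symm
    refine notMem_of_mem_interior_union (hconv _ K) (hne _ _) (hd N) (hd (N + 1)) h1 ?_
    have := hN'.2
    simp only at hs'
    rwa [hs'] at this
  · intro a b
    refine ⟨rotIso (rot n ((b : ℕ) - (a : ℕ) : ℤ)) (rot_norm _ _) 0,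
      ⟨((b : ℕ) - (a : ℕ) : ℤ), fun z => by simp⟩, ?_⟩
    rw [mapTiles_rotIso, image_image]
    congr 1
    ext s z
    rw [image_image]
    simp only [← mul_assoc, ← rot_add, sub_add_cancel]

/-! ### Tilings by rows -/

lemma abs_cross_le (p z : ℂ) : |cross p z| ≤ ‖p‖ * ‖z‖ := by
  have : cross p z = (starRingEnd ℂ p * z).im := by simp [cross]; ring
  rw [this]
  calc _ ≤ ‖starRingEnd ℂ p * z‖ := Complex.abs_im_le_norm _
    _ = _ := by rw [norm_mul, Complex.norm_conj]

/-- Bounds for a linear function on a zonotope. -/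
lemma cross_zono_bounds {w x a b c z : ℂ} (hz : z ∈ zono x a b c) :
    cross w x + min 0 (cross w a) + min 0 (cross w b) + min 0 (cross w c) ≤ cross w z ∧
    cross w z ≤ cross w x + max 0 (cross w a) + max 0 (cross w b) + max 0 (cross w c) := by
  obtain ⟨s, t, r, hs, ht, hr, rfl⟩ := hz
  simp only [cross_add_right, cross_ofReal_right]
  have key : ∀ u y : ℝ, 0 ≤ u ∧ u ≤ 1 → min 0 y ≤ u * y ∧ u * y ≤ max 0 y := by
    intro u y hu
    rcases le_total 0 y with h | h
    · rw [min_eq_left h, max_eq_right h]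
      exact ⟨mul_nonneg hu.1 h, mul_le_of_le_one_left h hu.2⟩
    · rw [min_eq_right h, max_eq_left h]
      exact ⟨by nlinarith, mul_nonpos_of_nonneg_of_nonpos hu.1 h⟩
  have h1 := key s (cross w a) hs
  have h2 := key t (cross w b) ht
  have h3 := key r (cross w c) hr
  constructor <;> linarith

/-- Two zonotopes separated by a line in direction `w`. -/
lemma disjoint_zono {w x a b c x' a' b' c' : ℂ} (hw : w ≠ 0)
    (h : cross w x + max 0 (cross w a) + max 0 (cross w b) + max 0 (cross w c) ≤
      cross w x' + min 0 (cross w a') + min 0 (cross w b') + min 0 (cross w c')) :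
    Disjoint (interior (zono x a b c)) (interior (zono x' a' b' c')) :=
  disjoint_interior_of_cross _ hw (fun _ hy => (cross_zono_bounds hy).2.trans h)
    (fun _ hy => (cross_zono_bounds hy).1)

/-- The data of a tiling by rows: the `j`-th row consists of translates of the hexagon with
generators `a`, `b`, `w j` by multiples of `a + b`. -/
structure IsRowData (a b : ℂ) (w B : ℤ → ℂ) (h : ℝ) : Prop where
  ab : 0 < cross a b
  bw : ∀ j, 0 < cross b (w j)
  aw : ∀ j, 0 < cross a (w j)
  step : ∀ j, B (j + 1) = B j + (w j - a)
  height : ∀ j, cross (a + b) (w j - a) = h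

def rowTile (a b : ℂ) (w B : ℤ → ℂ) (i j : ℤ) : Set ℂ := zono (B j + i * (a + b)) a b (w j)

namespace IsRowData

variable {a b : ℂ} {w B : ℤ → ℂ} {h : ℝ}

lemma h_pos (H : IsRowData a b w B h) : 0 < h := by
  rw [← H.height 0, cross_add_left, cross_sub_right, cross_sub_right, cross_self_eq_zero,
    cross_swap b a]
  linarith [H.ab, H.bw 0, H.aw 0]

/-- Each step `w j - a` points to the left of both `a` and `b`, the two edge directions of the
zigzag between rows. A row thus stays on the correct side of lines in both directions, however many
rows lie between. -/
lemma base_mono (H : IsRowData a b w B h) {j j' : ℤ} (hj : j ≤ j') :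
    0 ≤ cross a (B j' - B j) ∧ 0 ≤ cross b (B j' - B j) := by
  induction j', hj using Int.leInduction with
  | base => simp [cross]
  | succ j' _ ih =>
    rw [H.step, show B j' + (w j' - a) - B j = (B j' - B j) + (w j' - a) by ring,
      cross_add_right, cross_add_right, cross_sub_right a (w j'), cross_sub_right b (w j'),
      cross_self_eq_zero, cross_swap b a]
    constructor <;> linarith [H.ab, H.bw j', H.aw j']

lemma base_height (H : IsRowData a b w B h) (j : ℤ) :
    cross (a + b) (B j) = cross (a + b) (B 0) + j * h := by
  induction j using Int.induction_on with
  | zero => simp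
  | succ i ih =>
    rw [H.step, cross_add_right, ih, H.height]; push_cast; ring
  | pred i ih =>
    have := H.step (-i - 1)
    rw [sub_add_cancel] at this
    have h2 := H.height (-i - 1)
    rw [this, cross_add_right, h2] at ih
    push_cast at ih ⊢; linarith

/-- No single line separates rows bordering along a zigzag, but two given tiles are separated by a
line in direction `b` if the upper one has no larger index, and by one in direction `a` otherwise.
-/
lemma disjoint_of_lt (H : IsRowData a b w B h) {i j i' j' : ℤ} (hj : j < j') :
    Disjoint (interior (rowTile a b w B i j)) (interior (rowTile a b w B i' j')) := by
  obtain ⟨h1, h2⟩ := H.base_mono (Int.add_one_le_iff.2 hj)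
  have hab := H.ab
  have hbw := H.bw j
  have haw := H.aw j
  have hbw' := H.bw j'
  have haw' := H.aw j'
  rw [H.step] at h1 h2
  simp only [cross_sub_right, cross_add_right, cross_self_eq_zero] at h1 h2
  rw [cross_swap b a] at h2
  rcases le_or_gt i' i with hi | hi
  · have hi2 : (i' : ℝ) ≤ i := by exact_mod_cast hi
    apply disjoint_zono (w := b) (ne_zero_of_cross_ne_zero hbw.ne')
    simp only [cross_add_right, cross_intCast_right, cross_self_eq_zero, cross_swap b a]
    rw [max_eq_left (by linarith), max_eq_left le_rfl, max_eq_right hbw.le,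
      min_eq_right (by linarith), min_eq_left le_rfl, min_eq_left hbw'.le]
    nlinarith
  · have hi2 : (i : ℝ) + 1 ≤ i' := by exact_mod_cast hi
    apply disjoint_zono (w := a) (ne_zero_of_cross_ne_zero hab.ne')
    simp only [cross_add_right, cross_intCast_right, cross_self_eq_zero]
    rw [max_eq_left le_rfl, max_eq_right hab.le, max_eq_right haw.le,
      min_eq_left le_rfl, min_eq_left hab.le, min_eq_left haw'.le]
    nlinarith

lemma disjoint_same_row (H : IsRowData a b w B h) {i i' : ℤ} (j : ℤ) (hi : i < i') :
    Disjoint (interior (rowTile a b w B i j)) (interior (rowTile a b w B i' j)) := by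
  have hab := H.ab
  have hbw := H.bw j
  have haw := H.aw j
  have hi2 : (i : ℝ) + 1 ≤ i' := by exact_mod_cast hi
  refine (disjoint_zono (w := w j) ?_ ?_).symm
  · exact ne_zero_of_cross_ne_zero (q := a) (by rw [cross_swap]; linarith)
  · simp only [cross_add_right, cross_intCast_right, cross_self_eq_zero, cross_swap (w j) a,
      cross_swap (w j) b]
    rw [max_eq_left (by linarith), max_eq_left (by linarith), max_eq_left le_rfl,
      min_eq_right (by linarith), min_eq_right (by linarith), min_eq_left le_rfl]
    nlinarith

lemma eq_of_not_disjoint (H : IsRowData a b w B h) {i j i' j' : ℤ}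
    (hd : ¬Disjoint (interior (rowTile a b w B i j)) (interior (rowTile a b w B i' j'))) :
    i = i' ∧ j = j' := by
  rcases lt_trichotomy j j' with h1 | rfl | h1
  · exact absurd (H.disjoint_of_lt h1) hd
  · rcases lt_trichotomy i i' with h2 | rfl | h2
    · exact absurd (H.disjoint_same_row j h2) hd
    · exact ⟨rfl, rfl⟩
    · exact absurd (H.disjoint_same_row j h2).symm hd
  · exact absurd (H.disjoint_of_lt h1).symm hd

/-- The height of the point gives the row, its position along the row a parallelogram spanned by `a
+ b` and `w j + b`. By `parallelogram_cover` the parts not in the tile itself belong to the next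
tile of the row and to a tile of the row above. In the latter only the generators `a` and `b` are
used, so the kind of the next row is irrelevant. -/
lemma covers (H : IsRowData a b w B h) (z : ℂ) : ∃ i j, z ∈ rowTile a b w B i j := by
  have hh := H.h_pos
  set j := ⌊(cross (a + b) z - cross (a + b) (B 0)) / h⌋ with hj
  have hab := H.ab
  have hbw := H.bw j
  have haw := H.aw j
  have hbasis : cross (a + b) (w j + b) = h := by
    rw [← H.height j]
    simp only [cross_add_left, cross_add_right, cross_sub_right, cross_self_eq_zero]
    rw [cross_swap b a]; ring
  have hz := eq_cross_combination (p := a + b) (q := w j + b) (by rw [hbasis]; exact hh.ne')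
    (z - B j)
  rw [hbasis] at hz
  set s := cross (z - B j) (w j + b) / h
  set t := cross (a + b) (z - B j) / h with ht
  have ht1 : t = (cross (a + b) z - cross (a + b) (B 0)) / h - j := by
    rw [ht, cross_sub_right, H.base_height j]; field_simp; ring
  have ht2 : 0 ≤ t ∧ t ≤ 1 := by
    rw [ht1]
    exact ⟨sub_nonneg.2 (Int.floor_le _), by
      linarith [Int.lt_floor_add_one ((cross (a + b) z - cross (a + b) (B 0)) / h)]⟩
  have hs2 : 0 ≤ s - ⌊s⌋ ∧ s - ⌊s⌋ ≤ 1 :=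
    ⟨sub_nonneg.2 (Int.floor_le _), by linarith [Int.lt_floor_add_one s]⟩
  rcases parallelogram_cover hab hbw haw hs2 ht2 with
    ⟨σ, τ, ρ, h1, h2, h3, he⟩ | ⟨σ, τ, h1, h2, h3, he⟩ | ⟨σ, τ, h1, h2, h3, he⟩
  · refine ⟨⌊s⌋, j, mk_mem_zono σ τ ρ h1 h2 h3 ?_⟩
    push_cast at he
    linear_combination hz + he
  · refine ⟨⌊s⌋ + 1, j + 1, mk_mem_zono σ τ 0 ⟨by linarith, h3⟩ ⟨h1, by linarith⟩ (by simp) ?_⟩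
    rw [H.step]
    push_cast at he ⊢
    linear_combination hz + he
  · refine ⟨⌊s⌋ + 1, j, mk_mem_zono 0 τ σ (by simp) ⟨h1, by linarith⟩ ⟨by linarith, h3⟩ ?_⟩
    push_cast at he ⊢
    linear_combination hz + he

end IsRowData

/-! ### The lattice tiling and its two-armed spiral -/

/-- The centres of the tiles; the origin is the midpoint of an edge in direction `b`. -/
noncomputable def latCenter (a b c : ℂ) (x y : ℤ) : ℂ := (x + 1 / 2) * (a - c) + y * (a + b)

noncomputable def latTile (a b c : ℂ) (x y : ℤ) : Set ℂ :=
  zono (latCenter a b c x y - (a + b + c) / 2) a b c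

def latTiles (a b c : ℂ) : Set (Set ℂ) := {t | ∃ x y : ℤ, t = latTile a b c x y}

/-- Tiles with equal `x` form a row, which makes the results on rows available. Rows advance by `c -
a` whereas `x` counts multiples of `a - c`; hence the reversal `-x - 1`. -/
lemma latTile_eq_rowTile (a b c : ℂ) (x y : ℤ) :
    latTile a b c x y =
      rowTile a b (fun _ => c) (fun j => -(a + b / 2) + j * (c - a)) y (-x - 1) := by
  unfold latTile rowTile latCenter
  congr 1; push_cast; ring

lemma isRowData_lat {a b c : ℂ} (hab : 0 < cross a b) (hbc : 0 < cross b c)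
    (hac : 0 < cross a c) :
    IsRowData a b (fun _ => c) (fun j => -(a + b / 2) + j * (c - a)) (cross (a + b) (c - a)) where
  ab := hab
  bw _ := hbc
  aw _ := hac
  step j := by push_cast; ring
  height _ := rfl

lemma latCenter_neg (a b c : ℂ) (x y : ℤ) :
    latCenter a b c (-x - 1) (-y) = -latCenter a b c x y := by
  unfold latCenter; push_cast; ring

lemma latTile_neg (a b c : ℂ) (x y : ℤ) :
    (fun z => -1 * z) '' latTile a b c x y = latTile a b c (-x - 1) (-y) := by
  rw [latTile, zono_image_rot (k := -1) (w := 0) (by simp), latTile, latCenter_neg,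
    ← zono_neg_all _ a b c]
  congr 1 <;> ring

lemma rot_two_one : rot 2 1 = -1 := by
  rw [rot]
  have : (2 * Real.pi * Complex.I * (1 : ℤ) / (2 : ℕ) : ℂ) = Real.pi * Complex.I := by
    push_cast; ring
  rw [this, Complex.exp_pi_mul_I]

lemma rot_two_even {k : ℤ} (hk : Even k) : rot 2 k = 1 := by
  obtain ⟨l, rfl⟩ := hk
  rw [rot]
  have : (2 * Real.pi * Complex.I * ((l + l : ℤ) : ℂ) / (2 : ℕ) : ℂ) =
    l * (2 * Real.pi * Complex.I) := by push_cast; ring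
  rw [this, Complex.exp_int_mul_two_pi_mul_I]

lemma rot_two_odd {k : ℤ} (hk : ¬Even k) : rot 2 k = -1 := by
  obtain ⟨l, rfl⟩ := Int.not_even_iff_odd.1 hk
  rw [rot_add, rot_two_one, rot_two_even (by simp), one_mul]

lemma latTile_rot (a b c : ℂ) (k x y : ℤ) :
    (fun z => rot 2 k * z) '' latTile a b c x y =
      if Even k then latTile a b c x y else latTile a b c (-x - 1) (-y) := by
  split_ifs with h
  · rw [rot_two_even h]; simp
  · rw [rot_two_odd h, latTile_neg]

lemma Passes.rot {D : ℝ} {c c' : ℂ} {t t' : Set ℂ} (h : Passes D c t c' t') (n : ℕ) (k : ℤ) :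
    Passes D (rot n k * c) ((fun z => rot n k * z) '' t) (rot n k * c')
      ((fun z => rot n k * z) '' t') := by
  obtain ⟨M, h1, h2, h3, h4, h5, h6, h7⟩ := h
  refine ⟨_root_.rot n k * M, mem_image_of_mem _ h1, mem_image_of_mem _ h2, ?_, ?_, ?_, ?_, ?_⟩
  · rw [← image_union, interior_image_rot]; exact mem_image_of_mem _ h3
  · rwa [cross_mul_left, rot_norm, one_pow, one_mul]
  · rwa [cross_mul_left, rot_norm, one_pow, one_mul]
  · rwa [← mul_sub, norm_mul, rot_norm, one_mul]
  · rwa [← mul_sub, norm_mul, rot_norm, one_mul]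

/-- Passing to a translate that shares an edge in direction `r`. -/
lemma passes_translate {x p q r : ℂ} (hpr : cross p r ≠ 0)
    (h : 0 < cross (x + (p + q + r) / 2) (p + q)) {D : ℝ} (hD : ‖p‖ + ‖q‖ ≤ D) :
    Passes D (x + (p + q + r) / 2) (zono x p q r) (x + (p + q) + (p + q + r) / 2)
      (zono (x + (p + q)) p q r) := by
  have hD2 : ‖(p + q) / 2‖ ≤ D := by
    rw [norm_div]; simp only [Complex.norm_ofNat]
    have := norm_add_le p q
    linarith [norm_nonneg p, norm_nonneg q]
  refine ⟨x + p + q + r / 2, ?_, ?_, edge_mem_interior_union hpr x q, ?_, ?_, ?_, ?_⟩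
  · exact mk_mem_zono 1 1 (1 / 2) (by simp) (by simp) (by norm_num) (by push_cast; ring)
  · exact mk_mem_zono 0 0 (1 / 2) (by simp) (by simp) (by norm_num) (by push_cast; ring)
  · rw [show x + p + q + r / 2 = (x + (p + q + r) / 2) + (p + q) / 2 by ring, cross_add_right,
      cross_self_eq_zero, cross_div_two_right]
    linarith
  · rw [show x + p + q + r / 2 = (x + (p + q + r) / 2) + (p + q) / 2 by ring,
      show x + (p + q) + (p + q + r) / 2 = (x + (p + q + r) / 2) + (p + q) by ring,
      cross_add_right, cross_add_left, cross_self_eq_zero, cross_add_left _ _ (p + q),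
      cross_div_two_left, cross_div_two_left, cross_self_eq_zero, cross_swap (p + q)]
    linarith
  · convert hD2 using 2; ring
  · convert hD2 using 2; ring

lemma cross_latCenter (a b c : ℂ) (x y : ℤ) (w : ℂ) :
    cross (latCenter a b c x y) w = (x + 1 / 2) * cross (a - c) w + y * cross (a + b) w := by
  have : latCenter a b c x y = ((x + 1 / 2 : ℝ) : ℂ) * (a - c) + y * (a + b) := by
    unfold latCenter; push_cast; ring
  rw [this, cross_add_left, cross_ofReal_left, cross_intCast_left]

section
variable {a b c : ℂ}

/-- The four passages go to neighbours of the tile `(x, y)`. The condition on `x` or `y` in each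
says exactly on which side of the origin the step must be taken in order to turn left. -/
lemma lat_pass_one (hab : 0 < cross a b) (hbc : 0 < cross b c) (hac : 0 < cross a c) {x : ℤ}
    (y : ℤ) (hx : 0 ≤ x) {D : ℝ} (hD : 2 * (‖a‖ + ‖b‖ + ‖c‖) ≤ D) :
    Passes D (latCenter a b c x y) (latTile a b c x y) (latCenter a b c x (y + 1))
      (latTile a b c x (y + 1)) := by
  have h := passes_translate (x := latCenter a b c x y - (a + b + c) / 2) (p := a) (q := b)
    (r := c) hac.ne' (D := D) (by
      rw [sub_add_cancel, cross_latCenter, cross_self_eq_zero]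
      simp only [cross_add_right, cross_sub_left, cross_self_eq_zero, cross_swap c a,
        cross_swap c b]
      have : (0 : ℝ) ≤ x := by exact_mod_cast hx
      have : 0 < ((x : ℝ) + 1 / 2) * (0 - -cross a c + (cross a b - -cross b c)) :=
        mul_pos (by linarith) (by linarith)
      linarith) (by linarith [norm_nonneg a, norm_nonneg b, norm_nonneg c])
  convert h using 1
  · ring
  · rfl
  · unfold latCenter; push_cast; ring
  · unfold latTile latCenter; congr 1; push_cast; ring

lemma lat_pass_two (hab : 0 < cross a b) (hbc : 0 < cross b c) (hac : 0 < cross a c) {x y : ℤ}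
    (hxy : 0 ≤ x + y) {D : ℝ} (hD : 2 * (‖a‖ + ‖b‖ + ‖c‖) ≤ D) :
    Passes D (latCenter a b c x y) (latTile a b c x y) (latCenter a b c (x - 1) (y + 1))
      (latTile a b c (x - 1) (y + 1)) := by
  have h := passes_translate (x := latCenter a b c x y - (a + b + c) / 2) (p := b) (q := c)
    (r := a) (by rw [cross_swap]; linarith) (D := D) (by
      rw [show b + c + a = a + b + c by ring, sub_add_cancel, cross_latCenter]
      simp only [cross_add_right, cross_sub_left, cross_add_left, cross_self_eq_zero,
        cross_swap c b]
      have : (0 : ℝ) ≤ x + y := by exact_mod_cast hxy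
      have : 0 < ((x : ℝ) + y + 1 / 2) * (cross a b + cross a c + cross b c) :=
        mul_pos (by linarith) (by linarith)
      linarith) (by linarith [norm_nonneg a, norm_nonneg b, norm_nonneg c])
  rw [zono_rotate _ a b c, zono_rotate _ a b c] at h
  convert h using 1
  · ring
  · rfl
  · unfold latCenter; push_cast; ring
  · unfold latTile latCenter; congr 1; push_cast; ring

lemma lat_pass_three (hab : 0 < cross a b) (hbc : 0 < cross b c) (hac : 0 < cross a c) {y : ℤ}
    (x : ℤ) (hy : 0 < y) {D : ℝ} (hD : 2 * (‖a‖ + ‖b‖ + ‖c‖) ≤ D) :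
    Passes D (latCenter a b c x y) (latTile a b c x y) (latCenter a b c (x - 1) y)
      (latTile a b c (x - 1) y) := by
  have h := passes_translate (x := latCenter a b c x y - (a + b + c) / 2 + a) (p := -a) (q := c)
    (r := b) (by rw [cross_neg_left]; linarith) (D := D) (by
      rw [show latCenter a b c x y - (a + b + c) / 2 + a + (-a + c + b) / 2 =
        latCenter a b c x y by ring, cross_latCenter]
      simp only [cross_add_right, cross_sub_left, cross_add_left, cross_neg_right,
        cross_self_eq_zero, cross_swap c a, cross_swap b a]
      have : (0 : ℝ) < y := by exact_mod_cast hy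
      have : 0 < (y : ℝ) * (cross a b + cross a c + cross b c) :=
        mul_pos (by linarith) (by linarith)
      linarith) (by rw [norm_neg]; linarith [norm_nonneg a, norm_nonneg b, norm_nonneg c])
  have e : ∀ x, zono (x + a) (-a) c b = zono x a b c := fun x => by
    rw [zono_neg, ← zono_rotate, zono_rev]
  rw [e, show ∀ u : ℂ, u + a + (-a + c) = (u + (c - a)) + a from fun u => by ring, e] at h
  convert h using 1
  · ring
  · rfl
  · unfold latCenter; push_cast; ring
  · unfold latTile latCenter; congr 1; push_cast; ring

lemma lat_pass_four (hab : 0 < cross a b) (hbc : 0 < cross b c) (hac : 0 < cross a c) {x : ℤ}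
    (y : ℤ) (hx : x ≤ -1) {D : ℝ} (hD : 2 * (‖a‖ + ‖b‖ + ‖c‖) ≤ D) :
    Passes D (latCenter a b c x y) (latTile a b c x y) (latCenter a b c x (y - 1))
      (latTile a b c x (y - 1)) := by
  have h := (lat_pass_one hab hbc hac (x := -x - 1) (-y) (by omega) hD).rot 2 1
  rw [latTile_rot, if_neg (by decide), latTile_rot, if_neg (by decide), rot_two_one, neg_one_mul,
    neg_one_mul, ← latCenter_neg, ← latCenter_neg] at h
  convert h using 2 <;> ring

end

/-- For `m ≥ 1`, ring `m` is half of a hexagonal ring: from `(m - 1, 1)` diagonally to `(0, m)`,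
then at constant `y` to `(-1 - m, m)`, then at constant `x` down to `(-1 - m, 0)`. The next step
leads into the opposite half-plane, so successive half-rings are alternately turned by 180°; this is
the factor `rot 2 (m + 1)`. -/
lemma isSpiralTiling_lat {a b c : ℂ} (hab : 0 < cross a b) (hbc : 0 < cross b c)
    (hac : 0 < cross a c) : IsSpiralTiling (latTiles a b c) 2 0 := by
  have HR := isRowData_lat hab hbc hac
  let X : ℕ → ℕ → ℤ := fun m q => max (m - 1 - q) (-1 - m)
  let Y : ℕ → ℕ → ℤ := fun m q => min (q + 1) (min m (3 * m - q))
  have hX : ∀ m q, X m q = max ((m : ℤ) - 1 - q) (-1 - m) := fun _ _ => rfl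
  have hY : ∀ m q, Y m q = min ((q : ℤ) + 1) (min m (3 * m - q)) := fun _ _ => rfl
  have hD0 : 0 < cross (a - c) (a + b) := by
    simp only [cross_add_right, cross_sub_left, cross_self_eq_zero, cross_swap c a,
      cross_swap c b]
    linarith
  have hle : 2 * (‖a‖ + ‖b‖ + ‖c‖) ≤ 2 * (‖a‖ + ‖b‖ + ‖c‖) := le_rfl
  have hmem : ∀ k x y, (fun z => rot 2 k * z) '' latTile a b c x y ∈ latTiles a b c := by
    intro k x y
    rw [latTile_rot]; split_ifs
    · exact ⟨_, _, rfl⟩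
    · exact ⟨_, _, rfl⟩
  have himg : ∀ (k l : ℤ) (s : Set ℂ), (fun z => rot 2 k * z) '' ((fun z => rot 2 l * z) '' s) =
      (fun z => rot 2 (k + l) * z) '' s := by
    intro k l s
    rw [image_image]; simp only [← mul_assoc, ← rot_add]
  refine isSpiralTiling_of (fun m => 3 * m)
    (fun m q => (fun z => rot 2 (m + 1) * z) '' latTile a b c (X m q) (Y m q))
    (fun m q => rot 2 (m + 1) * latCenter a b c (X m q) (Y m q)) (2 * (‖a‖ + ‖b‖ + ‖c‖)) 1
    one_pos ?_ ?_ ?_ ?_ ?_ ?_ ?_ ?_ ?_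
  · intro m q
    exact (convex_zono _ _ _ _).linear_image (LinearMap.mulLeft ℝ (rot 2 _))
  · intro m q
    rw [interior_image_rot]
    apply mem_image_of_mem
    have := center_mem_interior_zono (b := b) hac.ne'
      (latCenter a b c (X m q) (Y m q) - (a + b + c) / 2)
    rwa [sub_add_cancel] at this
  · intro m q hq
    apply Passes.rot
    rcases lt_or_ge (q + 1) m with h1 | h1
    · have e1 : X m (q + 1) = X m q - 1 := by rw [hX, hX]; omega
      have e2 : Y m (q + 1) = Y m q + 1 := by rw [hY, hY]; omega
      rw [e1, e2]
      exact lat_pass_two hab hbc hac (by rw [hX, hY]; omega) hle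
    · rcases lt_or_ge q (2 * m) with h2 | h2
      · have e1 : X m (q + 1) = X m q - 1 := by rw [hX, hX]; omega
        have e2 : Y m (q + 1) = Y m q := by rw [hY, hY]; omega
        rw [e1, e2]
        exact lat_pass_three hab hbc hac _ (by rw [hY]; omega) hle
      · have e1 : X m (q + 1) = X m q := by rw [hX, hX]; omega
        have e2 : Y m (q + 1) = Y m q - 1 := by rw [hY, hY]; omega
        rw [e1, e2]
        exact lat_pass_four hab hbc hac _ (by rw [hX]; omega) hle
  · intro m
    have e1 : X m (3 * m) = -(m : ℤ) - 1 := by rw [hX]; omega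
    have e2 : Y m (3 * m) = -0 := by rw [hY]; omega
    have e3 : X (m + 1) 0 = m := by rw [hX]; omega
    have e4 : Y (m + 1) 0 = 0 + 1 := by rw [hY]; omega
    have h := (lat_pass_one hab hbc hac (x := m) 0 (by omega) hle).rot 2 ((m : ℤ) + 1 + 1)
    have e5 : ((m + 1 : ℕ) : ℤ) = m + 1 := by push_cast; rfl
    rw [e1, e2, latCenter_neg, ← latTile_neg, ← rot_two_one, himg, e3, e4, e5]
    convert h using 1
    rw [rot_add _ ((m : ℤ) + 1) 1, rot_two_one]; ring
  · intro R
    set K := ‖a - c‖ + ‖a + b‖ + 1 with hK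
    have hKpos : 0 < K := by positivity
    obtain ⟨m₀, hm₀⟩ := exists_nat_ge (4 * K * |R| / cross (a - c) (a + b) + 2)
    refine ⟨m₀, fun m q hm hq => ?_⟩
    have hq' : q ≤ 3 * m := hq
    rw [norm_mul, rot_norm, one_mul]
    set z := latCenter a b c (X m q) (Y m q) with hz
    have b1 : |cross z (a - c)| ≤ ‖z‖ * ‖a - c‖ := abs_cross_le _ _
    have b2 : |cross z (a + b)| ≤ ‖z‖ * ‖a + b‖ := abs_cross_le _ _
    rw [hz, cross_latCenter, cross_self_eq_zero, ← hz] at b1 b2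
    rw [cross_swap (a + b)] at b1
    have hm' : 4 * K * |R| / cross (a - c) (a + b) ≤ m - 2 := by
      have : (m₀ : ℝ) ≤ m := by exact_mod_cast hm
      linarith
    rw [div_le_iff₀ hD0] at hm'
    -- Every tile of ring `m` has `|x|` or `|y|` at least `m / 2`. Crossing its centre with `a + b`
    -- isolates the first coordinate, with `a - c` the second.
    have hcase : (m : ℝ) ≤ 2 * |((X m q : ℤ) : ℝ) + 1 / 2| + 2 ∨
        (m : ℝ) ≤ 2 * |((Y m q : ℤ) : ℝ)| := by
      rcases (by rw [hX, hY]; omega : (m : ℤ) ≤ 2 * X m q ∨ (m : ℤ) ≤ 2 * Y m q ∨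
        (m : ℤ) ≤ -2 * X m q) with h | h | h
      · left
        have h' : (m : ℝ) ≤ 2 * (X m q : ℤ) := by exact_mod_cast h
        linarith [le_abs_self (((X m q : ℤ) : ℝ) + 1 / 2)]
      · right
        have h' : (m : ℝ) ≤ 2 * (Y m q : ℤ) := by exact_mod_cast h
        linarith [le_abs_self ((Y m q : ℤ) : ℝ)]
      · left
        have h' : (m : ℝ) ≤ -2 * (X m q : ℤ) := by exact_mod_cast h
        linarith [neg_abs_le (((X m q : ℤ) : ℝ) + 1 / 2)]
    have hz0 := norm_nonneg z
    have hRz : 4 * K * |R| ≤ 2 * (‖z‖ * K) := by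
      rcases hcase with h | h
      · rw [mul_zero, add_zero, abs_mul, abs_of_pos hD0] at b2
        have : ‖z‖ * ‖a + b‖ ≤ ‖z‖ * K :=
          mul_le_mul_of_nonneg_left (by rw [hK]; linarith [norm_nonneg (a - c)]) hz0
        nlinarith
      · rw [mul_zero, zero_add, mul_neg, abs_neg, abs_mul, abs_of_pos hD0] at b1
        have : ‖z‖ * ‖a - c‖ ≤ ‖z‖ * K :=
          mul_le_mul_of_nonneg_left (by rw [hK]; linarith [norm_nonneg (a + b)]) hz0
        nlinarith
    have h1 : 2 * |R| ≤ ‖z‖ := by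
      have : K * (2 * |R|) ≤ K * ‖z‖ := by linarith
      exact le_of_mul_le_mul_left this hKpos
    linarith [le_abs_self R, abs_nonneg R]
  -- The last centres of consecutive rings lie in opposite directions on the line through `a - c`,
  -- so they differ by `π`; any `ε` with positive cosine below it would do in place of 1.
  · intro m S ρ hS hS1 hρ h
    have e1 : ∀ m, X m (3 * m) = -(m : ℤ) - 1 := by intro m; rw [hX]; omega
    have e2 : ∀ m, Y m (3 * m) = -0 := by intro m; rw [hY]; omega
    rw [e1, e2, e1, e2, latCenter_neg, latCenter_neg] at h
    push_cast at h
    rw [rot_add _ _ 1, rot_two_one] at h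
    have h2 := rot_ne_zero 2 ((m : ℤ) + 1)
    have h3 : a - c ≠ 0 := ne_zero_of_cross_ne_zero hD0.ne'
    have h4 : (-(m + 1 + 1 / 2 : ℝ) : ℂ) = ρ * Complex.exp (S * Complex.I) * (m + 1 / 2 : ℝ) := by
      apply mul_left_cancel₀ h2
      apply mul_right_cancel₀ h3
      unfold latCenter at h
      push_cast at h ⊢
      linear_combination -h
    have h5 := congrArg Complex.re h4
    rw [Complex.re_mul_ofReal, Complex.re_ofReal_mul, Complex.exp_ofReal_mul_I_re] at h5
    have h6 : 0 < Real.cos S :=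
      Real.cos_pos_of_mem_Ioo ⟨by linarith [Real.pi_gt_three], by linarith [Real.pi_gt_three]⟩
    have h7 : 0 < ρ * Real.cos S * (m + 1 / 2) := by positivity
    rw [← h5] at h7
    simp at h7
    have : (0 : ℝ) ≤ m := by positivity
    linarith
  · intro k m q _
    rw [himg]; exact hmem _ _ _
  · rintro t ⟨x, y, rfl⟩
    -- This region contains exactly one tile of each pair exchanged by the half-turn. The ring
    -- number is the largest of `y`, `x + y` and `-x - 1`, and the three cases are the three sides
    -- of the half-ring.
    have key : ∀ (x y : ℤ), (1 ≤ y ∨ (y = 0 ∧ x ≤ -1)) → ∃ m q : ℕ, q ≤ 3 * m ∧ X m q = x ∧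
        Y m q = y := by
      intro x y hxy
      by_cases h1 : y ≥ x + y ∧ y ≥ - x - 1
      · exact ⟨y.toNat, (y - 1 - x).toNat, by omega, by rw [hX]; omega, by rw [hY]; omega⟩
      · by_cases h2 : x + y ≥ y
        · exact ⟨(x + y).toNat, (y - 1).toNat, by omega, by rw [hX]; omega, by rw [hY]; omega⟩
        · exact ⟨(-x - 1).toNat, (3 * (-x - 1) - y).toNat, by omega, by rw [hX]; omega,
            by rw [hY]; omega⟩
    -- The parity of ring number and arm number together decides whether a tile or its half-turn
    -- image is meant; the arm is chosen accordingly.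
    have par : ∀ (m : ℕ) (b : Bool), ∃ k : Fin 2, (Even (((k : ℕ) : ℤ) + (m + 1)) ↔ b = true) := by
      intro m b
      rcases Nat.even_or_odd' m with ⟨l, rfl | rfl⟩ <;> cases b
      · exact ⟨0, by simp⟩
      · exact ⟨1, by simp [Int.even_iff]⟩
      · exact ⟨1, by simp [Int.even_iff]; omega⟩
      · exact ⟨0, by simp [Int.even_iff]⟩
    by_cases hxy : 1 ≤ y ∨ (y = 0 ∧ x ≤ -1)
    · obtain ⟨m, q, hq, h1, h2⟩ := key x y hxy
      obtain ⟨k, hk⟩ := par m true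
      refine ⟨k, m, q, hq, ?_⟩
      rw [himg, latTile_rot, if_pos (hk.2 rfl), h1, h2]
    · obtain ⟨m, q, hq, h1, h2⟩ := key (-x - 1) (-y) (by omega)
      obtain ⟨k, hk⟩ := par m false
      refine ⟨k, m, q, hq, ?_⟩
      rw [himg, latTile_rot, if_neg (by rw [hk]; simp), h1, h2]
      congr 1 <;> ring
  · intro k l m q m' q' hq hq' hd
    have hq₁ : q ≤ 3 * m := hq
    have hq₂ : q' ≤ 3 * m' := hq'
    rw [himg, himg, latTile_rot, latTile_rot] at hd
    have hk := k.2
    have hl := l.2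
    split_ifs at hd with p1 p2 p2 <;> rw [latTile_eq_rowTile, latTile_eq_rowTile] at hd <;>
      obtain ⟨h1, h2⟩ := HR.eq_of_not_disjoint hd <;> rw [hY, hY] at h1 <;> rw [hX, hX] at h2 <;>
      rw [Int.even_iff] at p1 p2
    · exact ⟨Fin.ext (by omega), by omega, by omega⟩
    · omega
    · omega
    · exact ⟨Fin.ext (by omega), by omega, by omega⟩

/-! ### Isometries between zonotopes -/

/-- The Euclidean inner product of the plane. -/
def dot (z w : ℂ) : ℝ := z.re * w.re + z.im * w.im

lemma norm_sq_combination (s t r : ℝ) (a b c : ℂ) :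
    ‖s * a + t * b + r * c‖ ^ 2 = s ^ 2 * ‖a‖ ^ 2 + t ^ 2 * ‖b‖ ^ 2 + r ^ 2 * ‖c‖ ^ 2 +
      2 * (s * t * dot a b + t * r * dot b c + s * r * dot a c) := by
  simp only [← Complex.normSq_eq_norm_sq, Complex.normSq_apply, dot]
  simp; ring

/-- Three unit vectors for which the long diagonal of the zonotope is its unique diameter. -/
structure IsAcute (a b c : ℂ) : Prop where
  na : ‖a‖ = 1
  nb : ‖b‖ = 1
  nc : ‖c‖ = 1
  ab : 0 < dot a b
  bc : 0 < dot b c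
  ac : 0 ≤ dot a c

/-- The squared distance is a quadratic form, with non-negative coefficients, in coordinate
differences lying in `[-1, 1]`. At the maximum the products belonging to `ab` and `bc` equal 1,
which forces all three differences to be 1 or all to be -1. So `ac` need only be non-negative, and a
right angle between `a` and `c` is admitted. -/
lemma IsAcute.diameter {a b c x y z : ℂ} (H : IsAcute a b c) (hy : y ∈ zono x a b c)
    (hz : z ∈ zono x a b c) (h : ‖a + b + c‖ ≤ dist y z) :
    (y = x ∧ z = x + (a + b + c)) ∨ (y = x + (a + b + c) ∧ z = x) := by
  obtain ⟨s, t, r, hs, ht, hr, rfl⟩ := hy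
  obtain ⟨s', t', r', hs', ht', hr', rfl⟩ := hz
  have h1 := norm_sq_combination (s - s') (t - t') (r - r') a b c
  have h2 := norm_sq_combination 1 1 1 a b c
  rw [dist_eq_norm, show x + s * a + t * b + r * c - (x + s' * a + t' * b + r' * c) =
    ((s - s' : ℝ) : ℂ) * a + ((t - t' : ℝ) : ℂ) * b + ((r - r' : ℝ) : ℂ) * c by
      push_cast; ring] at h
  simp only [H.na, H.nb, H.nc, Complex.ofReal_one, one_mul] at h1 h2
  have h3 := pow_le_pow_left₀ (norm_nonneg _) h 2
  rw [h1, h2] at h3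
  have key : ∀ u v u' v' : ℝ, 0 ≤ u ∧ u ≤ 1 → 0 ≤ v ∧ v ≤ 1 → 0 ≤ u' ∧ u' ≤ 1 →
      0 ≤ v' ∧ v' ≤ 1 → (u - u') * (v - v') ≤ 1 := by
    intro u v u' v' hu hv hu' hv'
    have : |(u - u') * (v - v')| ≤ 1 := by
      rw [abs_mul]
      apply mul_le_one₀ _ (abs_nonneg _)
      · rw [abs_le]; constructor <;> linarith
      · rw [abs_le]; constructor <;> linarith
    exact (abs_le.1 this).2
  have k1 := key s s s' s' hs hs hs' hs'
  have k2 := key t t t' t' ht ht ht' ht'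
  have k3 := key r r r' r' hr hr hr' hr'
  have k4 := key s t s' t' hs ht hs' ht'
  have k5 := key t r t' r' ht hr ht' hr'
  have k6 := key s r s' r' hs hr hs' hr'
  have m4 : 0 ≤ dot a b * (1 - (s - s') * (t - t')) := mul_nonneg H.ab.le (by linarith)
  have m5 : 0 ≤ dot b c * (1 - (t - t') * (r - r')) := mul_nonneg H.bc.le (by linarith)
  have m6 : 0 ≤ dot a c * (1 - (s - s') * (r - r')) := mul_nonneg H.ac (by linarith)
  have e4 : (s - s') * (t - t') = 1 := by
    have : dot a b * (1 - (s - s') * (t - t')) = 0 := by linarith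
    rcases mul_eq_zero.1 this with h | h
    · exact absurd h H.ab.ne'
    · linarith
  have e5 : (t - t') * (r - r') = 1 := by
    have : dot b c * (1 - (t - t') * (r - r')) = 0 := by linarith
    rcases mul_eq_zero.1 this with h | h
    · exact absurd h H.bc.ne'
    · linarith
  have ht2 : (t - t') ^ 2 = 1 := by nlinarith
  rcases sq_eq_one_iff.1 ht2 with h | h
  · rw [h] at e4 e5
    have q1 : t = 1 := by linarith
    have q2 : t' = 0 := by linarith
    have q3 : s = 1 := by linarith
    have q4 : s' = 0 := by linarith
    have q5 : r = 1 := by linarith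
    have q6 : r' = 0 := by linarith
    right; subst q1 q2 q3 q4 q5 q6; constructor <;> push_cast <;> ring
  · rw [h] at e4 e5
    have q1 : t = 0 := by linarith
    have q2 : t' = 1 := by linarith
    have q3 : s = 0 := by linarith
    have q4 : s' = 1 := by linarith
    have q5 : r = 0 := by linarith
    have q6 : r' = 1 := by linarith
    left; subst q1 q2 q3 q4 q5 q6; constructor <;> push_cast <;> ring

lemma IsAcute.isometry_ends {a b c x x' a' b' c' : ℂ} (H : IsAcute a' b' c') (g : ℂ ≃ᵢ ℂ)
    (hg : ∀ z ∈ zono x a b c, g z ∈ zono x' a' b' c') (hn : ‖a' + b' + c'‖ = ‖a + b + c‖) :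
    (g x = x' ∧ g (x + (a + b + c)) = x' + (a' + b' + c')) ∨
      (g x = x' + (a' + b' + c') ∧ g (x + (a + b + c)) = x') := by
  apply H.diameter (hg _ (base_mem_zono _ _ _ _)) (hg _ (top_mem_zono _ _ _ _))
  rw [g.isometry.dist_eq, hn, dist_eq_norm, ← norm_neg]
  apply le_of_eq; congr 1; ring

/-- The reflection in the long diagonal does not preserve a zonotope that is not symmetric in it. -/
lemma not_reflection {a b c κ : ℂ} (hc : ‖c‖ = 1) (hab : ‖a + b‖ ≠ 1)
    (hA : 0 < cross (a + b + c) a * cross (a + b + c) b) (hκ : ‖κ‖ = 1)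
    (h1 : κ * starRingEnd ℂ (a + b + c) = a + b + c) :
    κ * starRingEnd ℂ (a + b) ∉ zono 0 a b c := by
  rintro ⟨s, t, r, hs, ht, hr, h2⟩
  rw [zero_add] at h2
  have h3 : cross (a + b + c) (s * a + t * b + r * c) = -cross (a + b + c) (a + b) := by
    rw [← h2]
    nth_rewrite 1 [← h1]
    rw [cross_mul_left, cross_conj, hκ]; ring
  have h4 : cross (a + b + c) c = -cross (a + b + c) a - cross (a + b + c) b := by
    have := cross_self_eq_zero (a + b + c)
    rw [cross_add_right, cross_add_right] at this
    linarith
  simp only [cross_add_right, cross_ofReal_right] at h3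
  -- The image has the extreme distance from the diagonal on the side of `c`. As `a` and `b` lie
  -- strictly on the other side, only the corner `c` attains it, and `c` has the wrong distance from
  -- the base corner since `‖a + b‖ ≠ 1`.
  have h5 : s * cross (a + b + c) a + t * cross (a + b + c) b +
    (1 - r) * (cross (a + b + c) a + cross (a + b + c) b) = 0 := by
    rw [h4] at h3; linarith
  set A := cross (a + b + c) a
  set B := cross (a + b + c) b
  have h6 : s * (A * B) = 0 ∧ t * (A * B) = 0 ∧ (1 - r) * (A * B) = 0 := by
    have hr1 : 0 ≤ 1 - r := by linarith
    have p1 : 0 ≤ s * (A * B) := mul_nonneg hs.1 hA.le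
    have p2 : 0 ≤ t * (A * B) := mul_nonneg ht.1 hA.le
    have p3 : 0 ≤ (1 - r) * (A * B) := mul_nonneg hr1 hA.le
    have e1 : s * (A * B) + t * B ^ 2 + (1 - r) * (A * B) + (1 - r) * B ^ 2 = 0 := by
      linear_combination B * h5
    have e2 : s * A ^ 2 + t * (A * B) + (1 - r) * (A * B) + (1 - r) * A ^ 2 = 0 := by
      linear_combination A * h5
    have q1 : 0 ≤ t * B ^ 2 := mul_nonneg ht.1 (sq_nonneg _)
    have q2 : 0 ≤ (1 - r) * B ^ 2 := mul_nonneg hr1 (sq_nonneg _)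
    have q3 : 0 ≤ s * A ^ 2 := mul_nonneg hs.1 (sq_nonneg _)
    have q4 : 0 ≤ (1 - r) * A ^ 2 := mul_nonneg hr1 (sq_nonneg _)
    refine ⟨by linarith, by linarith, by linarith⟩
  have hs0 : s = 0 := (mul_eq_zero.1 h6.1).resolve_right hA.ne'
  have ht0 : t = 0 := (mul_eq_zero.1 h6.2.1).resolve_right hA.ne'
  have hr1 : r = 1 := by
    have := (mul_eq_zero.1 h6.2.2).resolve_right hA.ne'
    linarith
  rw [hs0, ht0, hr1] at h2
  apply hab
  have := congrArg norm h2
  simpa [hκ, hc, ← map_add, Complex.norm_conj] using this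

/-- A zonotope that is not symmetric in its long diagonal has no opposite self-isometry. -/
lemma IsAcute.not_opposite {a b c x x' k w : ℂ} (H : IsAcute a b c) (hk : ‖k‖ = 1)
    (hA : 0 < cross (a + b + c) a * cross (a + b + c) b)
    {g : ℂ ≃ᵢ ℂ} (hg : ∀ z, g z = k * starRingEnd ℂ z + w) :
    ¬∀ z ∈ zono x a b c, g z ∈ zono x' a b c := by
  intro hmap
  have hab : ‖a + b‖ ≠ 1 := by
    intro h
    have := norm_sq_combination 1 1 0 a b c
    simp [H.na, H.nb, h] at this
    linarith [H.ab]
  have hP : x + a + b ∈ zono x a b c :=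
    mk_mem_zono 1 1 0 (by simp) (by simp) (by simp) (by simp)
  obtain ⟨s, t, r, hs, ht, hr, he⟩ := hmap _ hP
  rw [hg] at he
  rcases H.isometry_ends g hmap rfl with ⟨h1, h2⟩ | ⟨h1, h2⟩ <;> rw [hg] at h1 h2 <;>
    simp only [map_add] at he h1 h2
  · refine not_reflection H.nc hab hA hk ?_ ⟨s, t, r, hs, ht, hr, ?_⟩
    · simp only [map_add]; linear_combination h2 - h1
    · simp only [map_add]; linear_combination he - h1
  · refine not_reflection H.nc hab hA (κ := -k) (by simpa using hk) ?_
      ⟨1 - s, 1 - t, 1 - r, ⟨by linarith, by linarith⟩, ⟨by linarith, by linarith⟩,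
        ⟨by linarith, by linarith⟩, ?_⟩
    · simp only [map_add]; linear_combination h1 - h2
    · simp only [map_add]; push_cast; linear_combination h1 - he

/-- An isometry between translates of a zonotope that is not symmetric in its long diagonal. -/
lemma IsAcute.direct {a b c x x' : ℂ} (H : IsAcute a b c)
    (hA : 0 < cross (a + b + c) a * cross (a + b + c) b)
    {g : ℂ ≃ᵢ ℂ} (hmap : ∀ z ∈ zono x a b c, g z ∈ zono x' a b c) :
    (∀ z, g z = z + g 0) ∨ (∀ z, g z = -z + g 0) := by
  have hδ : a + b + c ≠ 0 := by
    intro h; rw [h] at hA; simp [cross] at hA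
  obtain ⟨k, hk, h | h⟩ := isometry_form g
  · rcases H.isometry_ends g hmap rfl with ⟨h1, h2⟩ | ⟨h1, h2⟩ <;> rw [h] at h1 h2
    · left
      have : k = 1 := by
        apply mul_right_cancel₀ hδ; linear_combination h2 - h1
      intro z; rw [h z, this, one_mul]
    · right
      have : k = -1 := by
        apply mul_right_cancel₀ hδ; linear_combination h2 - h1
      intro z; rw [h z, this, neg_one_mul]
  · exact absurd hmap (H.not_opposite hk hA h)

/-- The centre of a zonotope is determined by the zonotope. -/
lemma zono_center_unique {x a b c x' a' b' c' : ℂ} (h : zono x a b c = zono x' a' b' c') :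
    x + (a + b + c) / 2 = x' + (a' + b' + c') / 2 := by
  have sym : ∀ {x a b c z : ℂ}, z ∈ zono x a b c → 2 * (x + (a + b + c) / 2) - z ∈ zono x a b c := by
    rintro x a b c _ ⟨s, t, r, hs, ht, hr, rfl⟩
    exact ⟨1 - s, 1 - t, 1 - r, ⟨by linarith, by linarith⟩, ⟨by linarith, by linarith⟩,
      ⟨by linarith, by linarith⟩, by push_cast; ring⟩
  set d := x' + (a' + b' + c') / 2 - (x + (a + b + c) / 2) with hd
  have step : ∀ z ∈ zono x a b c, z + 2 * d ∈ zono x a b c := by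
    intro z hz
    have h1 := sym hz
    rw [h] at h1
    have h2 := sym h1
    rw [← h] at h2
    convert h2 using 1; rw [hd]; ring
  have iter : ∀ m : ℕ, x + m * (2 * d) ∈ zono x a b c := by
    intro m
    induction m with
    | zero => simpa using base_mem_zono x a b c
    | succ m ih => convert step _ ih using 1; push_cast; ring
  have hd0 : d = 0 := by
    by_contra hne
    have hpos : 0 < cross (-(Complex.I * d)) (2 * d) := by
      have := Complex.normSq_pos.2 hne
      rw [Complex.normSq_apply] at this
      simp [cross]; linarith
    set w := -(Complex.I * d)
    obtain ⟨m, hm⟩ := exists_nat_gt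
      ((max 0 (cross w a) + max 0 (cross w b) + max 0 (cross w c)) / cross w (2 * d))
    rw [div_lt_iff₀ hpos] at hm
    have := (cross_zono_bounds (w := w) (iter m)).2
    rw [cross_add_right, cross_natCast_right] at this
    linarith
  linear_combination -hd0 + hd

lemma isometry_center {g : ℂ ≃ᵢ ℂ} {x a b c x' a' b' c' : ℂ}
    (h : g '' zono x a b c = zono x' a' b' c') :
    g (x + (a + b + c) / 2) = x' + (a' + b' + c') / 2 := by
  obtain ⟨k, -, hg | hg⟩ := isometry_form g
  · rw [zono_image_rot hg] at h
    rw [← zono_center_unique h, hg, hg x]; ring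
  · rw [zono_image_refl hg] at h
    rw [← zono_center_unique h, hg, hg x, map_add, map_div₀, map_add, map_add, map_ofNat]; ring

/-! ### Symmetries -/

lemma mem_symmetries {T : Set (Set ℂ)} {g : ℂ ≃ᵢ ℂ} (h1 : ∀ t ∈ T, g '' t ∈ T)
    (h2 : ∀ t ∈ T, ∃ s ∈ T, g '' s = t) : g ∈ symmetries T := by
  apply Subset.antisymm
  · rintro _ ⟨t, ht, rfl⟩; exact h1 t ht
  · exact h2

lemma image_mem_of_mem_symmetries {T : Set (Set ℂ)} {g : ℂ ≃ᵢ ℂ} (h : g ∈ symmetries T)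
    {t : Set ℂ} (ht : t ∈ T) : g '' t ∈ T := by
  have : g '' t ∈ mapTiles g T := mem_image_of_mem _ ht
  rwa [h] at this

lemma rotIso_mem_symmetries {T : Set (Set ℂ)} {n : ℕ}
    (h : ∀ (k : ℤ), ∀ t ∈ T, (fun z => rot n k * z) '' t ∈ T) {g : ℂ ≃ᵢ ℂ} (k : ℤ)
    (hg : ∀ z, g z = rot n k * z) : g ∈ symmetries T := by
  have hg' : (g : ℂ → ℂ) = fun z => rot n k * z := funext hg
  apply mem_symmetries
  · intro t ht; rw [hg']; exact h k t ht
  · intro t ht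
    refine ⟨_, h (-k) t ht, ?_⟩
    rw [hg', image_image]
    simp only [← mul_assoc, rot_mul_neg, one_mul, image_id']

lemma involution_mem_symmetries {T : Set (Set ℂ)} {g : ℂ ≃ᵢ ℂ} (h : ∀ t ∈ T, g '' t ∈ T)
    (hg : ∀ z, g (g z) = z) : g ∈ symmetries T := by
  apply mem_symmetries h
  intro t ht
  refine ⟨_, h t ht, ?_⟩
  rw [image_image]; simp [hg]

/-! ### The lattice tiling -/

section
variable {a b c : ℂ}

lemma isMonohedralTiling_lat (hab : 0 < cross a b) (hbc : 0 < cross b c) (hac : 0 < cross a c) :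
    IsMonohedralTiling (zono 0 a b c) (latTiles a b c) where
  congruent := by
    rintro t ⟨x, y, rfl⟩
    refine ⟨rotIso 1 (by simp) (latCenter a b c x y - (a + b + c) / 2), ?_⟩
    rw [zono_image_rot (rotIso_apply _ _ _)]
    simp [latTile]
  cover := by
    apply eq_univ_of_forall
    intro z
    obtain ⟨i, j, h⟩ := (isRowData_lat hab hbc hac).covers z
    refine ⟨_, ⟨-j - 1, i, rfl⟩, ?_⟩
    rw [latTile_eq_rowTile]
    convert h using 2; ring
  no_overlap := by
    rintro _ ⟨x, y, rfl⟩ _ ⟨x', y', rfl⟩ hne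
    by_contra hd
    rw [latTile_eq_rowTile, latTile_eq_rowTile] at hd
    obtain ⟨h1, h2⟩ := (isRowData_lat hab hbc hac).eq_of_not_disjoint hd
    apply hne
    rw [h1, show x = x' by omega]

lemma lat_rot_mem (k : ℤ) {t : Set ℂ} (ht : t ∈ latTiles a b c) :
    (fun z => rot 2 k * z) '' t ∈ latTiles a b c := by
  obtain ⟨x, y, rfl⟩ := ht
  rw [latTile_rot]; split_ifs <;> exact ⟨_, _, rfl⟩

lemma cyclicAt_two_iff (g : ℂ ≃ᵢ ℂ) :
    g ∈ cyclicAt 2 0 ↔ (∀ z, g z = z) ∨ (∀ z, g z = -z) := by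
  constructor
  · rintro ⟨k, hk⟩
    simp only [zero_add, sub_zero] at hk
    by_cases h : Even k
    · left; intro z; rw [hk, rot_two_even h, one_mul]
    · right; intro z; rw [hk, rot_two_odd h, neg_one_mul]
  · rintro (h | h)
    · exact ⟨0, fun z => by rw [h, rot_zero]; ring⟩
    · exact ⟨1, fun z => by rw [h, rot_two_one]; ring⟩

lemma cyclicAt_two_subset_lat : cyclicAt 2 0 ⊆ symmetries (latTiles a b c) := by
  rintro g ⟨k, hk⟩
  exact rotIso_mem_symmetries (n := 2) (fun k t ht => lat_rot_mem k ht) k (fun z => by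
    rw [hk]; ring)

lemma cyclicAt_fix {n : ℕ} {p : ℂ} {g : ℂ ≃ᵢ ℂ} (hg : g ∈ cyclicAt n p) : g p = p := by
  obtain ⟨k, hk⟩ := hg
  rw [hk]; ring

end

/-- The vector `4/5 + 3/5 i`. -/
noncomputable def pyth : ℂ := ⟨4 / 5, 3 / 5⟩

lemma norm_pyth : ‖pyth‖ = 1 := by
  have : ‖pyth‖ ^ 2 = 1 := by
    rw [← Complex.normSq_eq_norm_sq, Complex.normSq_apply]; norm_num [pyth]
  nlinarith [norm_nonneg pyth]

/-- The outer generators 1 and `i` are perpendicular, so the angle divides 360°; the middle one is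
off the bisector, which makes the hexagon asymmetric, and it is rational, so that all inequalities
are numerical. -/
lemma isAcute_pyth : IsAcute 1 pyth Complex.I where
  na := by simp
  nb := norm_pyth
  nc := by simp
  ab := by norm_num [dot, pyth]
  bc := by norm_num [dot, pyth]
  ac := by norm_num [dot]

lemma cross_pyth : 0 < cross 1 pyth ∧ 0 < cross pyth Complex.I ∧ 0 < cross 1 Complex.I := by
  norm_num [cross, pyth]

lemma asymmetric_pyth : 0 < cross (1 + pyth + Complex.I) 1 * cross (1 + pyth + Complex.I) pyth := by
  norm_num [cross, pyth]

lemma right_angle {a c : ℂ} (h : dot c a = 0) :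
    ∃ k : ℕ, (k : ℝ) * EuclideanGeometry.angle c 0 a = 2 * Real.pi := by
  refine ⟨4, ?_⟩
  rw [EuclideanGeometry.angle, vsub_eq_sub, vsub_eq_sub, sub_zero, sub_zero,
    (InnerProductGeometry.inner_eq_zero_iff_angle_eq_pi_div_two c a).1]
  · push_cast; ring
  · rw [Complex.inner]; simpa [dot, mul_comm] using h

lemma cyclic_two :
    ∃ (H : Set ℂ) (T : Set (Set ℂ)) (p : ℂ),
      IsGluedPair H ∧ IsConvexEquilateralHexagon H ∧ IsMonohedralTiling H T ∧
      IsCyclicAbout T 2 p ∧ EssentiallyIn T (cyclicAt 2 p) ∧ IsSpiralTiling T 2 p := by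
  obtain ⟨h1, h2, h3⟩ := cross_pyth
  -- All tiles are translates of one, so the image of a single tile already restricts the linear
  -- part to `1` or `-1`.
  have hsym : ∀ g ∈ symmetries (latTiles 1 pyth Complex.I),
      (∀ z, g z = z + g 0) ∨ (∀ z, g z = -z + g 0) := by
    intro g hg
    obtain ⟨x, y, hxy⟩ := image_mem_of_mem_symmetries hg ⟨0, 0, rfl⟩
    exact isAcute_pyth.direct asymmetric_pyth (fun z hz => by
      rw [← latTile, ← hxy]; exact mem_image_of_mem g hz)
  refine ⟨zono 0 1 pyth Complex.I, latTiles 1 pyth Complex.I, 0,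
    isGluedPair_zono h1 h2 h3 (by simp) norm_pyth (by simp) (right_angle (by simp [dot])),
    isConvexEquilateralHexagon_zono h1 h2 h3 (by simp) norm_pyth (by simp),
    isMonohedralTiling_lat h1 h2 h3, ?_, ?_, isSpiralTiling_lat h1 h2 h3⟩
  · ext g; constructor
    · rintro ⟨hg, h0⟩
      rw [cyclicAt_two_iff]
      rcases hsym g hg with h | h
      · left; intro z; rw [h, h0, add_zero]
      · right; intro z; rw [h, h0, add_zero]
    · intro hg
      exact ⟨cyclicAt_two_subset_lat hg, cyclicAt_fix hg⟩
  · intro g hg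
    rcases hsym g hg with h | h
    · exact ⟨IsometryEquiv.refl ℂ, (cyclicAt_two_iff _).2 (Or.inl fun z => rfl), g 0, h⟩
    · exact ⟨IsometryEquiv.neg ℂ, (cyclicAt_two_iff _).2 (Or.inr fun z => rfl), g 0, h⟩

/-! ### The reflection symmetric lattice tiling -/

/-- The unit vector of argument `-π / 4`. -/
noncomputable def diagDown : ℂ := ⟨Real.sqrt 2 / 2, -(Real.sqrt 2 / 2)⟩

/-- The unit vector of argument `π / 4`. -/
noncomputable def diagUp : ℂ := ⟨Real.sqrt 2 / 2, Real.sqrt 2 / 2⟩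

lemma sqrt_two_pos : 0 < Real.sqrt 2 := by positivity

lemma norm_diagUp : ‖diagUp‖ = 1 := by
  have : ‖diagUp‖ ^ 2 = 1 := by
    rw [← Complex.normSq_eq_norm_sq, Complex.normSq_apply]
    simp only [diagUp]
    nlinarith [Real.mul_self_sqrt (zero_le_two (α := ℝ))]
  nlinarith [norm_nonneg diagUp]

lemma conj_diagUp : starRingEnd ℂ diagUp = diagDown := by
  apply Complex.ext <;> simp [diagUp, diagDown]

lemma conj_diagDown : starRingEnd ℂ diagDown = diagUp := by
  rw [← conj_diagUp, Complex.conj_conj]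

lemma norm_diagDown : ‖diagDown‖ = 1 := by
  rw [← conj_diagUp, Complex.norm_conj, norm_diagUp]

lemma isAcute_diag : IsAcute diagDown 1 diagUp where
  na := norm_diagDown
  nb := by simp
  nc := norm_diagUp
  ab := by simp [dot, diagDown]
  bc := by simp [dot, diagUp]
  ac := by simp [dot, diagDown, diagUp]

lemma cross_diag : 0 < cross diagDown 1 ∧ 0 < cross 1 diagUp ∧ 0 < cross diagDown diagUp := by
  have := sqrt_two_pos
  refine ⟨by simp [cross, diagDown], by simp [cross, diagUp], ?_⟩
  simp only [cross, diagDown, diagUp]; nlinarith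

lemma diag_sum : diagDown + 1 + diagUp = ((1 + Real.sqrt 2 : ℝ) : ℂ) := by
  apply Complex.ext <;> simp [diagDown, diagUp]; ring

/-- Conjugation exchanges the outer generators and fixes the middle one, so it maps each hexagon to
a translate and the lattice of centres to itself. -/
lemma lat_diag_conj (x y : ℤ) :
    (fun z => starRingEnd ℂ z) '' latTile diagDown 1 diagUp x y =
      latTile diagDown 1 diagUp (-x - 1 - y) y := by
  rw [latTile, zono_image_refl (k := 1) (w := 0) (by simp), one_mul, one_mul, one_mul, conj_diagUp,
    conj_diagDown, map_one, zono_rev, latTile]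
  congr 1
  simp only [latCenter, map_sub, map_add, map_mul, map_div₀, map_one, map_ofNat, map_intCast,
    conj_diagUp, conj_diagDown]
  push_cast; ring

lemma lat_diag_symmetry {g : ℂ ≃ᵢ ℂ} (hg : g ∈ symmetries (latTiles diagDown 1 diagUp)) :
    ∃ k : ℂ, (k = 1 ∨ k = -1) ∧
      ((∀ z, g z = k * z + g 0) ∨ (∀ z, g z = k * starRingEnd ℂ z + g 0)) := by
  obtain ⟨x, y, hxy⟩ := image_mem_of_mem_symmetries hg ⟨0, 0, rfl⟩
  have hmap : ∀ z ∈ latTile diagDown 1 diagUp 0 0, g z ∈ latTile diagDown 1 diagUp x y := by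
    intro z hz; rw [← hxy]; exact mem_image_of_mem g hz
  have hends := isAcute_diag.isometry_ends g hmap rfl
  rw [diag_sum] at hends
  have hδ : ((1 + Real.sqrt 2 : ℝ) : ℂ) ≠ 0 := by
    have := sqrt_two_pos
    exact_mod_cast (by linarith : (1 + Real.sqrt 2 : ℝ) ≠ 0)
  obtain ⟨k, -, h | h⟩ := isometry_form g
  · refine ⟨k, ?_, Or.inl h⟩
    rcases hends with ⟨h1, h2⟩ | ⟨h1, h2⟩ <;> rw [h] at h1 h2
    · left; apply mul_right_cancel₀ hδ; linear_combination h2 - h1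
    · right; apply mul_right_cancel₀ hδ; linear_combination h2 - h1
  · refine ⟨k, ?_, Or.inr h⟩
    rcases hends with ⟨h1, h2⟩ | ⟨h1, h2⟩ <;> rw [h] at h1 h2 <;>
      rw [map_add, Complex.conj_ofReal] at h2
    · left; apply mul_right_cancel₀ hδ; linear_combination h2 - h1
    · right; apply mul_right_cancel₀ hδ; linear_combination h2 - h1

lemma lat_diag_conj_mem {g : ℂ ≃ᵢ ℂ} (hg : ∀ z, g z = starRingEnd ℂ z) :
    g ∈ symmetries (latTiles diagDown 1 diagUp) := by
  apply involution_mem_symmetries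
  · rintro _ ⟨x, y, rfl⟩
    exact ⟨_, _, by rw [← lat_diag_conj, ← funext hg]⟩
  · intro z; rw [hg, hg, Complex.conj_conj]

lemma lat_diag_neg_conj_mem {g : ℂ ≃ᵢ ℂ} (hg : ∀ z, g z = -starRingEnd ℂ z) :
    g ∈ symmetries (latTiles diagDown 1 diagUp) := by
  apply involution_mem_symmetries
  · rintro _ ⟨x, y, rfl⟩
    refine ⟨-(-x - 1 - y) - 1, -y, ?_⟩
    rw [← latTile_neg, ← lat_diag_conj, image_image]
    congr 1; ext z; rw [hg]; ring
  · intro z; rw [hg, hg]; simp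

lemma dihedralAt_two_iff (g : ℂ ≃ᵢ ℂ) :
    g ∈ dihedralAt 2 0 1 ↔ (∀ z, g z = z) ∨ (∀ z, g z = -z) ∨ (∀ z, g z = starRingEnd ℂ z) ∨
      (∀ z, g z = -starRingEnd ℂ z) := by
  rw [dihedralAt, mem_union, cyclicAt_two_iff, or_assoc]
  apply or_congr Iff.rfl; apply or_congr Iff.rfl
  constructor
  · rintro ⟨k, hk⟩
    simp only [zero_add, sub_zero, one_pow, mul_one] at hk
    by_cases h : Even k
    · left; intro z; rw [hk, rot_two_even h, one_mul]
    · right; intro z; rw [hk, rot_two_odd h, neg_one_mul]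
  · rintro (h | h)
    · exact ⟨0, fun z => by rw [h, rot_zero]; simp⟩
    · exact ⟨1, fun z => by rw [h, rot_two_one]; simp⟩

lemma shape_diag : IsGluedPair (zono 0 diagDown 1 diagUp) ∧
    IsConvexEquilateralHexagon (zono 0 diagDown 1 diagUp) := by
  obtain ⟨h1, h2, h3⟩ := cross_diag
  exact ⟨isGluedPair_zono h1 h2 h3 norm_diagDown (by simp) norm_diagUp
      (right_angle (by simp [dot, diagDown, diagUp])),
    isConvexEquilateralHexagon_zono h1 h2 h3 norm_diagDown (by simp) norm_diagUp⟩

lemma dihedral_two :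
    ∃ (H : Set ℂ) (T : Set (Set ℂ)) (p u : ℂ), ‖u‖ = 1 ∧
      IsGluedPair H ∧ IsConvexEquilateralHexagon H ∧ IsMonohedralTiling H T ∧
      IsDihedralAbout T 2 p u ∧ EssentiallyIn T (dihedralAt 2 p u) ∧ IsSpiralTiling T 2 p := by
  obtain ⟨h1, h2, h3⟩ := cross_diag
  refine ⟨_, latTiles diagDown 1 diagUp, 0, 1, by simp, shape_diag.1, shape_diag.2,
    isMonohedralTiling_lat h1 h2 h3, ?_, ?_, isSpiralTiling_lat h1 h2 h3⟩
  · ext g; constructor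
    · rintro ⟨hg, h0⟩
      rw [dihedralAt_two_iff]
      obtain ⟨k, rfl | rfl, h | h⟩ := lat_diag_symmetry hg <;> simp only [h0, add_zero, one_mul,
        neg_one_mul] at h
      · exact Or.inl h
      · exact Or.inr (Or.inr (Or.inl h))
      · exact Or.inr (Or.inl h)
      · exact Or.inr (Or.inr (Or.inr h))
    · intro hg
      rcases (dihedralAt_two_iff g).1 hg with h | h | h | h
      · exact ⟨cyclicAt_two_subset_lat ((cyclicAt_two_iff g).2 (Or.inl h)), h 0⟩
      · exact ⟨cyclicAt_two_subset_lat ((cyclicAt_two_iff g).2 (Or.inr h)), by rw [h, neg_zero]⟩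
      · exact ⟨lat_diag_conj_mem h, by rw [h, map_zero]⟩
      · exact ⟨lat_diag_neg_conj_mem h, by rw [h, map_zero, neg_zero]⟩
  · intro g hg
    obtain ⟨k, hk, h | h⟩ := lat_diag_symmetry hg
    · refine ⟨rotIso k (by rcases hk with rfl | rfl <;> simp) 0, ?_, g 0, fun z => by
        rw [h, rotIso_apply, add_zero]⟩
      rw [dihedralAt_two_iff]
      rcases hk with rfl | rfl
      · left; simp
      · right; left; simp
    · refine ⟨reflIso k (by rcases hk with rfl | rfl <;> simp) 0, ?_, g 0, fun z => by
        rw [h, reflIso_apply, add_zero]⟩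
      rw [dihedralAt_two_iff]
      rcases hk with rfl | rfl
      · right; right; left; simp
      · right; right; right; simp

/-! ### A single mirror: the same lattice tiling seen from a less symmetric point -/

lemma rot_one (k : ℤ) : rot 1 k = 1 := by
  rw [rot]
  have : (2 * Real.pi * Complex.I * (k : ℂ) / (1 : ℕ) : ℂ) = k * (2 * Real.pi * Complex.I) := by
    push_cast; ring
  rw [this, Complex.exp_int_mul_two_pi_mul_I]

/-- The point `1/4` lies on the mirror `ℝ`. A half-turn or a second mirror there would send the real
part 0 of a tile centre to `1/2`, but the real parts of the centres are the integer multiples of `1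
+ √2/2`. -/
lemma dihedral_one :
    ∃ (H : Set ℂ) (T : Set (Set ℂ)) (p u : ℂ), ‖u‖ = 1 ∧
      IsGluedPair H ∧ IsConvexEquilateralHexagon H ∧ IsMonohedralTiling H T ∧
      IsDihedralAbout T 1 p u := by
  obtain ⟨h1, h2, h3⟩ := cross_diag
  refine ⟨_, latTiles diagDown 1 diagUp, 1 / 4, 1, by simp, shape_diag.1, shape_diag.2,
    isMonohedralTiling_lat h1 h2 h3, ?_⟩
  have hre : ∀ x y : ℤ, (latCenter diagDown 1 diagUp x y).re = y * (1 + Real.sqrt 2 / 2) := by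
    intro x y
    have : latCenter diagDown 1 diagUp x y =
      ((x + 1 / 2 : ℝ) : ℂ) * (diagDown - diagUp) + ((y : ℝ) : ℂ) * (diagDown + 1) := by
      unfold latCenter; push_cast; ring
    rw [this, Complex.add_re, Complex.re_ofReal_mul, Complex.re_ofReal_mul]
    simp only [diagDown, diagUp, Complex.sub_re, Complex.add_re, Complex.one_re]; ring
  have no : ∀ g ∈ symmetries (latTiles diagDown 1 diagUp),
      (∀ z, (g z).re = -z.re + 1 / 2) → False := by
    intro g hg h
    obtain ⟨x, y, hxy⟩ := image_mem_of_mem_symmetries hg ⟨0, 0, rfl⟩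
    have := isometry_center hxy
    rw [sub_add_cancel, sub_add_cancel] at this
    have h4 := h (latCenter diagDown 1 diagUp 0 0)
    rw [this, hre, hre] at h4
    simp at h4
    have hs := sqrt_two_pos
    have h5 : (0 : ℝ) < y := by
      by_contra hcon
      push Not at hcon
      have : (y : ℝ) * (1 + Real.sqrt 2 / 2) ≤ 0 :=
        mul_nonpos_of_nonpos_of_nonneg hcon (by linarith)
      linarith
    have h6 : (1 : ℝ) ≤ y := by exact_mod_cast h5
    have : 1 * (1 + Real.sqrt 2 / 2) ≤ y * (1 + Real.sqrt 2 / 2) :=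
      mul_le_mul_of_nonneg_right h6 (by linarith)
    linarith
  ext g; constructor
  · rintro ⟨hg, h0⟩
    obtain ⟨k, rfl | rfl, h | h⟩ := lat_diag_symmetry hg
    · left
      refine ⟨0, fun z => ?_⟩
      have := h (1 / 4)
      rw [h0] at this
      rw [h, rot_one]; linear_combination -this
    · right
      refine ⟨0, fun z => ?_⟩
      have := h (1 / 4)
      rw [h0] at this
      simp only [map_div₀, map_one, map_ofNat] at this
      rw [h, rot_one]; simp only [map_sub, map_div₀, map_one, map_ofNat]
      linear_combination -this
    · exfalso
      apply no g hg
      intro z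
      have := h (1 / 4)
      rw [h0] at this
      have e : g z = -z + 1 / 2 := by rw [h]; linear_combination -this
      rw [e]; simp
    · exfalso
      apply no g hg
      intro z
      have := h (1 / 4)
      rw [h0] at this
      simp only [map_div₀, map_one, map_ofNat] at this
      have e : g z = -starRingEnd ℂ z + 1 / 2 := by rw [h]; linear_combination -this
      rw [e]; simp
  · rintro (⟨k, hk⟩ | ⟨k, hk⟩) <;> rw [rot_one] at hk
    · have hk' : ∀ z, g z = z := fun z => by rw [hk]; ring
      exact ⟨cyclicAt_two_subset_lat ((cyclicAt_two_iff g).2 (Or.inl hk')), hk' _⟩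
    · have hk' : ∀ z, g z = starRingEnd ℂ z := fun z => by
        rw [hk]; simp only [map_sub, map_div₀, map_one, map_ofNat]; ring
      exact ⟨lat_diag_conj_mem hk', by rw [hk']; simp only [map_div₀, map_one, map_ofNat]⟩

/-! ### A tiling by rows whose only symmetries are translations -/

/-- The rows that are not reflected. -/
def IsMarked (j : ℤ) : Prop := j = 0 ∨ j = 1 ∨ j = 3

open Classical in
/-- The third generator of the hexagons in the `j`-th row. -/
noncomputable def rowGen (j : ℤ) : ℂ := if IsMarked j then Complex.I else pyth * Complex.I

open Classical in
/-- The base points of the rows. -/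
noncomputable def rowBase (j : ℤ) : ℂ :=
  j * (pyth * Complex.I - 1) + ((if 0 < j then 1 else 0) + (if 1 < j then 1 else 0) +
    (if 3 < j then 1 else 0)) * (Complex.I - pyth * Complex.I)

/-- Both kinds of rows have the same zigzag boundary and the same height `12/5`, so they can be
stacked in any order and stay equally spaced. -/
lemma isRowData_marked : IsRowData 1 pyth rowGen rowBase (12 / 5) where
  ab := cross_pyth.1
  bw j := by unfold rowGen; split_ifs <;> norm_num [cross, pyth]
  aw j := by unfold rowGen; split_ifs <;> norm_num [cross, pyth]
  height j := by unfold rowGen; split_ifs <;> norm_num [cross, pyth]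
  step j := by
    unfold rowBase rowGen IsMarked
    rcases lt_trichotomy j 0 with h | h | h
    · rw [if_neg (by omega), if_neg (by omega), if_neg (by omega), if_neg (by omega),
        if_neg (by omega), if_neg (by omega), if_neg (by omega)]
      push_cast; ring
    · subst h; simp
    by_cases h1 : j = 1
    · subst h1; simp; ring
    by_cases h2 : j = 2
    · subst h2; norm_num; ring
    by_cases h3 : j = 3
    · subst h3; norm_num; ring
    · rw [if_pos (by omega), if_pos (by omega), if_pos (by omega), if_pos (by omega),
        if_pos (by omega), if_pos (by omega), if_neg (by omega)]
      push_cast; ring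

def markedTiles : Set (Set ℂ) := {t | ∃ i j : ℤ, t = rowTile 1 pyth rowGen rowBase i j}

lemma pyth_mul_conj : pyth * starRingEnd ℂ pyth = 1 := by
  rw [Complex.mul_conj, Complex.normSq_eq_norm_sq, norm_pyth]; norm_num

/-- The reflection interchanging the two kinds of rows. -/
noncomputable def rowFlip (w : ℂ) : ℂ ≃ᵢ ℂ := reflIso (-pyth) (by rw [norm_neg, norm_pyth]) w

lemma rowFlip_apply (w z : ℂ) : rowFlip w z = -pyth * starRingEnd ℂ z + w :=
  reflIso_apply _ _ _ _

lemma rowTile_marked {i j : ℤ} (h : IsMarked j) :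
    rowTile 1 pyth rowGen rowBase i j =
      zono (rowBase j + i * (1 + pyth)) 1 pyth Complex.I := by
  rw [rowTile, rowGen, if_pos h]

lemma rowTile_unmarked {i j : ℤ} (h : ¬IsMarked j) :
    rowTile 1 pyth rowGen rowBase i j =
      zono (rowBase j + i * (1 + pyth)) 1 pyth (pyth * Complex.I) := by
  rw [rowTile, rowGen, if_neg h]

lemma zono_swap_neg (x a b c : ℂ) : zono (x + a + b) (-b) (-a) c = zono x a b c := by
  ext z; constructor <;>
  · rintro ⟨s, t, r, hs, ht, hr, rfl⟩
    exact ⟨1 - t, 1 - s, r, ⟨by linarith, by linarith⟩, ⟨by linarith, by linarith⟩, hr, by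
      push_cast; ring⟩

lemma rowFlip_image (x w : ℂ) :
    rowFlip w '' zono x 1 pyth Complex.I =
      zono (rowFlip w x - (1 + pyth)) 1 pyth (pyth * Complex.I) := by
  rw [zono_image_refl (rowFlip_apply w), ← zono_swap_neg]
  congr 1
  · rw [map_one]; linear_combination (-1 : ℂ) * pyth_mul_conj
  · linear_combination pyth_mul_conj
  · simp
  · simp

lemma rowFlip_image' (x w : ℂ) :
    rowFlip w '' zono x 1 pyth (pyth * Complex.I) =
      zono (rowFlip w x - (1 + pyth)) 1 pyth Complex.I := by
  rw [zono_image_refl (rowFlip_apply w), ← zono_swap_neg]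
  congr 1
  · rw [map_one]; linear_combination (-1 : ℂ) * pyth_mul_conj
  · linear_combination pyth_mul_conj
  · simp
  · rw [map_mul, Complex.conj_I]; linear_combination Complex.I * pyth_mul_conj

/-- In the mirrored hexagon 1 and `pyth * I` enclose an obtuse angle, so the diameter is not the sum
of the given generators. Reversing `pyth * I` describes the hexagon from another corner, where the
criterion applies. -/
lemma isAcute_flipped : IsAcute pyth 1 (-(pyth * Complex.I)) where
  na := norm_pyth
  nb := by simp
  nc := by simp [norm_pyth]
  ab := by norm_num [dot, pyth]
  bc := by norm_num [dot, pyth]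
  ac := by norm_num [dot, pyth]

lemma asymmetric_flipped : 0 < cross (pyth + 1 + -(pyth * Complex.I)) pyth *
    cross (pyth + 1 + -(pyth * Complex.I)) 1 := by
  norm_num [cross, pyth]

lemma zono_flipped (x : ℂ) : zono (x + pyth * Complex.I) pyth 1 (-(pyth * Complex.I)) =
    zono x 1 pyth (pyth * Complex.I) := by
  ext z; constructor <;>
  · rintro ⟨s, t, r, hs, ht, hr, rfl⟩
    exact ⟨t, s, 1 - r, ht, hs, ⟨by linarith, by linarith⟩, by push_cast; ring⟩

lemma isMonohedralTiling_marked : IsMonohedralTiling (zono 0 1 pyth Complex.I) markedTiles where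
  congruent := by
    rintro t ⟨i, j, rfl⟩
    by_cases h : IsMarked j
    · refine ⟨rotIso 1 (by simp) (rowBase j + i * (1 + pyth)), ?_⟩
      rw [zono_image_rot (rotIso_apply _ _ _), rowTile_marked h]; simp
    · refine ⟨rowFlip (rowBase j + i * (1 + pyth) + (1 + pyth)), ?_⟩
      rw [rowFlip_image, rowTile_unmarked h, rowFlip_apply]; simp
  cover := by
    apply eq_univ_of_forall
    intro z
    obtain ⟨i, j, h⟩ := isRowData_marked.covers z
    exact ⟨_, ⟨i, j, rfl⟩, h⟩
  no_overlap := by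
    rintro _ ⟨i, j, rfl⟩ _ ⟨i', j', rfl⟩ hne
    by_contra hd
    obtain ⟨rfl, rfl⟩ := isRowData_marked.eq_of_not_disjoint hd
    exact hne rfl

lemma rowFlip_zero_invol (z : ℂ) : rowFlip 0 (rowFlip 0 z) = z := by
  rw [rowFlip_apply, rowFlip_apply]
  simp only [add_zero, map_mul, map_neg, Complex.conj_conj]
  linear_combination z * pyth_mul_conj

/-- An isometry maps a row tile to a row tile of the same kind only if its linear part is `±1`, and
to one of the other kind only if its linear part is `±` the reflection. -/
lemma marked_form {g : ℂ ≃ᵢ ℂ} {i j i' j' : ℤ}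
    (h : g '' rowTile 1 pyth rowGen rowBase i j = rowTile 1 pyth rowGen rowBase i' j') :
    ((IsMarked j ↔ IsMarked j') → (∀ z, g z = z + g 0) ∨ (∀ z, g z = -z + g 0)) ∧
    (¬(IsMarked j ↔ IsMarked j') → ∃ s : ℝ, (s = 1 ∨ s = -1) ∧
      ∀ z, g z = s * (pyth * starRingEnd ℂ z) + g 0) := by
  by_cases hj : IsMarked j <;> by_cases hj' : IsMarked j'
  · refine ⟨fun _ => ?_, fun hn => absurd (iff_of_true hj hj') hn⟩
    rw [rowTile_marked hj, rowTile_marked hj'] at h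
    exact isAcute_pyth.direct asymmetric_pyth fun z hz => h ▸ mem_image_of_mem g hz
  · refine ⟨fun hn => absurd (hn.1 hj) hj', fun _ => ?_⟩
    rw [rowTile_marked hj, rowTile_unmarked hj'] at h
    have h2 := isAcute_pyth.direct (g := g.trans (rowFlip 0)) asymmetric_pyth (fun z hz => by
      have := mem_image_of_mem (rowFlip 0) (mem_image_of_mem g hz)
      rw [h, rowFlip_image'] at this
      exact this)
    have e : ∀ z, g z = rowFlip 0 ((g.trans (rowFlip 0)) z) := fun z => by
      rw [IsometryEquiv.trans_apply, rowFlip_zero_invol]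
    rcases h2 with h2 | h2
    · refine ⟨-1, Or.inr rfl, fun z => ?_⟩
      rw [e z, e 0, h2 z, rowFlip_apply, rowFlip_apply, map_add]; push_cast; ring
    · refine ⟨1, Or.inl rfl, fun z => ?_⟩
      rw [e z, e 0, h2 z, rowFlip_apply, rowFlip_apply, map_add, map_neg]; push_cast; ring
  · refine ⟨fun hn => absurd (hn.2 hj') hj, fun _ => ?_⟩
    rw [rowTile_unmarked hj, rowTile_marked hj'] at h
    have h2 := isAcute_pyth.direct (g := (rowFlip 0).trans g) asymmetric_pyth
      (x := rowFlip 0 (rowBase j + i * (1 + pyth)) - (1 + pyth)) (fun z hz => by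
      rw [← rowFlip_image'] at hz
      obtain ⟨y, hy, rfl⟩ := hz
      rw [IsometryEquiv.trans_apply, rowFlip_zero_invol, ← h]
      exact mem_image_of_mem g hy)
    have e : ∀ z, g z = (rowFlip 0).trans g (rowFlip 0 z) := fun z => by
      rw [IsometryEquiv.trans_apply, rowFlip_zero_invol]
    have e0 : (rowFlip 0).trans g 0 = g 0 := by
      rw [IsometryEquiv.trans_apply, rowFlip_apply]; simp
    rcases h2 with h2 | h2
    · refine ⟨-1, Or.inr rfl, fun z => ?_⟩
      rw [e z, h2, e0, rowFlip_apply]; push_cast; ring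
    · refine ⟨1, Or.inl rfl, fun z => ?_⟩
      rw [e z, h2, e0, rowFlip_apply]; push_cast; ring
  · refine ⟨fun _ => ?_, fun hn => absurd (iff_of_false hj hj') hn⟩
    rw [rowTile_unmarked hj, rowTile_unmarked hj', ← zono_flipped, ← zono_flipped] at h
    exact isAcute_flipped.direct asymmetric_flipped fun z hz => h ▸ mem_image_of_mem g hz

/-- The height of a tile centre depends only on its row and is affine in the row number. Hence a
symmetry acts on row numbers as a translation or a reversal. -/
lemma marked_height (i j : ℤ) :
    cross (1 + pyth) (rowBase j + i * (1 + pyth) + (1 + pyth + rowGen j) / 2) =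
      cross (1 + pyth) (rowBase 0) + cross (1 + pyth) 1 / 2 + 6 / 5 + j * (12 / 5) := by
  have h1 := isRowData_marked.height j
  have h2 := isRowData_marked.base_height j
  rw [cross_sub_right] at h1
  rw [cross_add_right, cross_add_right, cross_intCast_right, cross_self_eq_zero,
    cross_div_two_right, cross_add_right, cross_self_eq_zero, h2]
  linarith

/-- A symmetry that preserves the kinds of rows cannot reverse the order, since `{0, 1, 3}` is not
congruent to its reverse by a shift. One that exchanges the kinds would carry infinitely many
mirrored rows to three rows. -/
lemma markedTiles_symmetry {g : ℂ ≃ᵢ ℂ} (hg : g ∈ symmetries markedTiles) (z : ℂ) :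
    g z = z + g 0 := by
  have him : ∀ j : ℤ, ∃ i' j' : ℤ, g '' rowTile 1 pyth rowGen rowBase 0 j =
      rowTile 1 pyth rowGen rowBase i' j' := fun j =>
    image_mem_of_mem_symmetries hg ⟨0, j, rfl⟩
  choose ι φ hφ using him
  have hcen := fun j => isometry_center (hφ j)
  set C := cross (1 + pyth) (rowBase 0) + cross (1 + pyth) 1 / 2 + 6 / 5 with hC
  have hheight : ∀ j, cross (1 + pyth) (g (rowBase j + (0 : ℤ) * (1 + pyth) +
      (1 + pyth + rowGen j) / 2)) = C + φ j * (12 / 5) := fun j => by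
    rw [hcen j, marked_height]
  have himb : ∀ s : ℝ, (s * (pyth * starRingEnd ℂ 1)).im = s * (3 / 5) := by
    intro s; simp [pyth]
  have hreb : ∀ s : ℝ, (s * (pyth * starRingEnd ℂ 1)).re = s * (4 / 5) := by
    intro s; simp [pyth]
  -- Whether kinds are preserved or exchanged is visible in the linear part: `±1` fixes the real
  -- axis, `±pyth * conj` does not. So one row decides for all rows.
  have notboth : ∀ s : ℝ, (s = 1 ∨ s = -1) → (∀ z, g z = s * (pyth * starRingEnd ℂ z) + g 0) →
      ((∀ z, g z = z + g 0) ∨ (∀ z, g z = -z + g 0)) → False := by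
    intro s hs h1 h2
    have : (s * (pyth * starRingEnd ℂ 1)).im = 0 := by
      have e : s * (pyth * starRingEnd ℂ 1) = g 1 - g 0 := by rw [h1 1]; ring
      rw [e]
      rcases h2 with h2 | h2 <;> rw [h2 1] <;> simp
    rw [himb] at this
    rcases hs with rfl | rfl <;> norm_num at this
  by_cases h0 : IsMarked 0 ↔ IsMarked (φ 0)
  · have hdir := (marked_form (hφ 0)).1 h0
    have hall : ∀ j, IsMarked j ↔ IsMarked (φ j) := by
      intro j
      by_contra hcon
      obtain ⟨s, hs, h⟩ := (marked_form (hφ j)).2 hcon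
      exact notboth s hs h hdir
    rcases hdir with h | h
    · exact h z
    · exfalso
      have hj : ∀ j, C + φ j * (12 / 5 : ℝ) = -(C + j * (12 / 5)) + cross (1 + pyth) (g 0) := by
        intro j
        rw [← hheight, h, cross_add_right, cross_neg_right, marked_height]
      have r1 : φ 0 = φ 1 + 1 := by
        have e0 := hj 0
        have e1 := hj 1
        push_cast at e0 e1
        have : (φ 0 : ℝ) = φ 1 + 1 := by linarith
        exact_mod_cast this
      have r3 : φ 0 = φ 3 + 3 := by
        have e0 := hj 0
        have e1 := hj 3
        push_cast at e0 e1
        have : (φ 0 : ℝ) = φ 3 + 3 := by linarith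
        exact_mod_cast this
      have m0 := (hall 0).1 (Or.inl rfl)
      have m1 := (hall 1).1 (Or.inr (Or.inl rfl))
      have m3 := (hall 3).1 (Or.inr (Or.inr rfl))
      unfold IsMarked at m0 m1 m3
      omega
  · exfalso
    obtain ⟨s, hs, h⟩ := (marked_form (hφ 0)).2 h0
    have hall : ∀ j, ¬(IsMarked j ↔ IsMarked (φ j)) := by
      intro j hcon
      exact notboth s hs h ((marked_form (hφ j)).1 hcon)
    have hflip : ∀ z, cross (1 + pyth) (pyth * starRingEnd ℂ z) = -cross (1 + pyth) z := by
      intro z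
      have : 1 + pyth = pyth * starRingEnd ℂ (1 + pyth) := by
        rw [map_add, map_one]; linear_combination -pyth_mul_conj
      nth_rewrite 1 [this]
      rw [cross_mul_left, cross_conj, norm_pyth]; ring
    have hj : ∀ j, C + φ j * (12 / 5 : ℝ) =
        s * -(C + j * (12 / 5)) + cross (1 + pyth) (g 0) := by
      intro j
      rw [← hheight, h, cross_add_right, cross_ofReal_right, hflip, marked_height]
    -- Rows from 4 on are mirrored and would have to go to marked rows; four consecutive ones
    -- already give a contradiction.
    have hm : ∀ j : ℤ, 4 ≤ j → IsMarked (φ j) := by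
      intro j hj
      by_contra hcon
      exact hall j (iff_of_false (by unfold IsMarked; omega) hcon)
    have e4 := hj 4
    have e5 := hj 5
    have e6 := hj 6
    have e7 := hj 7
    have m4 := hm 4 (by norm_num)
    have m5 := hm 5 (by norm_num)
    have m6 := hm 6 (by norm_num)
    have m7 := hm 7 (by norm_num)
    unfold IsMarked at m4 m5 m6 m7
    push_cast at e4 e5 e6 e7
    rcases hs with rfl | rfl
    · have r1 : φ 4 = φ 5 + 1 := by
        have : (φ 4 : ℝ) = φ 5 + 1 := by linarith
        exact_mod_cast this
      have r2 : φ 5 = φ 6 + 1 := by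
        have : (φ 5 : ℝ) = φ 6 + 1 := by linarith
        exact_mod_cast this
      have r3 : φ 6 = φ 7 + 1 := by
        have : (φ 6 : ℝ) = φ 7 + 1 := by linarith
        exact_mod_cast this
      omega
    · have r1 : φ 5 = φ 4 + 1 := by
        have : (φ 5 : ℝ) = φ 4 + 1 := by linarith
        exact_mod_cast this
      have r2 : φ 6 = φ 5 + 1 := by
        have : (φ 6 : ℝ) = φ 5 + 1 := by linarith
        exact_mod_cast this
      have r3 : φ 7 = φ 6 + 1 := by
        have : (φ 7 : ℝ) = φ 6 + 1 := by linarith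
        exact_mod_cast this
      omega

lemma cyclic_one :
    ∃ (H : Set ℂ) (T : Set (Set ℂ)) (p : ℂ),
      IsGluedPair H ∧ IsConvexEquilateralHexagon H ∧ IsMonohedralTiling H T ∧
      IsCyclicAbout T 1 p ∧ EssentiallyIn T (cyclicAt 1 p) := by
  obtain ⟨h1, h2, h3⟩ := cross_pyth
  refine ⟨zono 0 1 pyth Complex.I, markedTiles, 0,
    isGluedPair_zono h1 h2 h3 (by simp) norm_pyth (by simp) (right_angle (by simp [dot])),
    isConvexEquilateralHexagon_zono h1 h2 h3 (by simp) norm_pyth (by simp),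
    isMonohedralTiling_marked, ?_, ?_⟩
  · ext g; constructor
    · rintro ⟨hg, h0⟩
      exact ⟨0, fun z => by rw [markedTiles_symmetry hg, h0, rot_zero]; ring⟩
    · rintro ⟨k, hk⟩
      have hg : ∀ z, g z = z := fun z => by rw [hk, rot_one]; ring
      refine ⟨?_, hg 0⟩
      have : (g : ℂ → ℂ) = id := funext hg
      exact mem_symmetries (fun t ht => by rwa [this, image_id])
        (fun t ht => ⟨t, ht, by rw [this, image_id]⟩)
  · intro g hg
    exact ⟨IsometryEquiv.refl ℂ, ⟨0, fun z => by rw [rot_zero, zero_add, one_mul, sub_zero]; rfl⟩, g 0,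
      fun z => markedTiles_symmetry hg z⟩

/-! ### Sectors -/

/-- The unit vector in direction `x`. -/
noncomputable def cis (x : ℝ) : ℂ := Complex.exp (x * Complex.I)

lemma cis_re (x : ℝ) : (cis x).re = Real.cos x := Complex.exp_ofReal_mul_I_re x
lemma cis_im (x : ℝ) : (cis x).im = Real.sin x := Complex.exp_ofReal_mul_I_im x
lemma norm_cis (x : ℝ) : ‖cis x‖ = 1 := Complex.norm_exp_ofReal_mul_I x

lemma cis_ne_zero (x : ℝ) : cis x ≠ 0 := Complex.exp_ne_zero _

lemma cis_zero : cis 0 = 1 := by simp [cis]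

lemma cis_add (x y : ℝ) : cis (x + y) = cis x * cis y := by
  rw [cis, cis, cis, ← Complex.exp_add]; congr 1; push_cast; ring

lemma conj_cis (x : ℝ) : starRingEnd ℂ (cis x) = cis (-x) := by
  apply Complex.ext <;> simp [cis_re, cis_im]

lemma cross_cis (x y : ℝ) : cross (cis x) (cis y) = Real.sin (y - x) := by
  rw [cross, cis_re, cis_im, cis_re, cis_im, Real.sin_sub]; ring

lemma dot_cis (x y : ℝ) : dot (cis x) (cis y) = Real.cos (y - x) := by
  rw [dot, cis_re, cis_im, cis_re, cis_im, Real.cos_sub]; ring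

lemma cis_add_cis (x y : ℝ) :
    cis x + cis y = (2 * Real.cos ((y - x) / 2) : ℝ) * cis ((x + y) / 2) := by
  have h1 : cis x = cis ((x + y) / 2) * cis (-((y - x) / 2)) := by
    rw [← cis_add]; congr 1; ring
  have h2 : cis y = cis ((x + y) / 2) * cis ((y - x) / 2) := by
    rw [← cis_add]; congr 1; ring
  have h3 : cis (-((y - x) / 2)) + cis ((y - x) / 2) = (2 * Real.cos ((y - x) / 2) : ℝ) := by
    apply Complex.ext
    · rw [Complex.add_re, cis_re, cis_re, Real.cos_neg, Complex.ofReal_re]; ring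
    · rw [Complex.add_im, cis_im, cis_im, Real.sin_neg, Complex.ofReal_im]; ring
  rw [← h3]; nth_rewrite 1 [h1, h2]; ring

lemma cis_eq_cis {x y : ℝ} {r s : ℝ} (hr : 0 < r) (hs : 0 < s) (h : r * cis x = s * cis y) :
    ∃ N : ℤ, x = y + N * (2 * Real.pi) := by
  have hrs : r = s := by
    have := congrArg norm h
    simpa [norm_cis, abs_of_pos hr, abs_of_pos hs] using this
  subst hrs
  have h1 : cis x = cis y := mul_left_cancel₀ (by exact_mod_cast hr.ne') h
  rw [cis, cis, Complex.exp_eq_exp_iff_exists_int] at h1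
  obtain ⟨N, hN⟩ := h1
  refine ⟨N, ?_⟩
  have h2 : ((x : ℂ)) = y + N * (2 * Real.pi) := by
    apply mul_right_cancel₀ Complex.I_ne_zero
    rw [hN]; ring
  exact_mod_cast h2

lemma exists_polar {z : ℂ} (hz : z ≠ 0) (x : ℝ) :
    ∃ ρ φ : ℝ, 0 < ρ ∧ -Real.pi < φ ∧ φ ≤ Real.pi ∧ z = ρ * cis (x + φ) := by
  refine ⟨‖z‖, (z * cis (-x)).arg, norm_pos_iff.2 hz, Complex.neg_pi_lt_arg _,
    Complex.arg_le_pi _, ?_⟩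
  have h1 := Complex.norm_mul_exp_arg_mul_I (z * cis (-x))
  rw [norm_mul, norm_cis, mul_one] at h1
  rw [add_comm, cis_add, ← mul_assoc, cis, h1, mul_assoc, ← cis_add, neg_add_cancel, cis_zero,
    mul_one]

/-- Polar coordinates in a sector. -/
lemma exists_polar_sector {x y : ℝ} (hxy : x < y) {z : ℂ} (hz : z ≠ 0)
    (h1 : 0 ≤ cross (cis x) z) (h2 : 0 ≤ cross z (cis y)) :
    ∃ ρ θ : ℝ, 0 < ρ ∧ z = ρ * cis θ ∧ x ≤ θ ∧ θ ≤ y ∧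
      (0 < cross (cis x) z → x < θ) ∧ (0 < cross z (cis y) → θ < y) := by
  obtain ⟨ρ, φ, hρ, hφ1, hφ2, rfl⟩ := exists_polar hz x
  rw [cross_ofReal_right, cross_cis] at h1
  rw [cross_ofReal_left, cross_cis] at h2
  have h3 : 0 ≤ Real.sin φ := by
    have := nonneg_of_mul_nonneg_right h1 hρ
    rwa [show x + φ - x = φ by ring] at this
  have h4 : 0 ≤ Real.sin (y - (x + φ)) := nonneg_of_mul_nonneg_right h2 hρ
  have h5 : 0 ≤ φ := by
    by_contra hneg
    exact absurd (Real.sin_neg_of_neg_of_neg_pi_lt (not_le.1 hneg) hφ1) (not_lt.2 h3)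
  have h6 : 0 ≤ y - (x + φ) := by
    by_contra hneg
    exact absurd (Real.sin_neg_of_neg_of_neg_pi_lt (not_le.1 hneg) (by linarith)) (not_lt.2 h4)
  refine ⟨ρ, x + φ, hρ, rfl, by linarith, by linarith, fun h => ?_, fun h => ?_⟩
  · rcases h5.eq_or_lt with h0 | h0
    · rw [← h0, cross_ofReal_right, cross_cis] at h; simp at h
    · linarith
  · rcases h6.eq_or_lt with h0 | h0
    · rw [cross_ofReal_left, cross_cis, ← h0] at h; simp at h
    · linarith

/-! ### Spokes -/

/-- The directions of the spokes of the spiral tiling: the angles between consecutive spokes are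
alternately `γ` and `2 π / n - γ`. -/
noncomputable def spokeAngle (n : ℕ) (γ : ℝ) (m : ℤ) : ℝ :=
  (m / 2 : ℤ) * (2 * Real.pi / n) + if Even m then 0 else γ

noncomputable def spoke (n : ℕ) (γ : ℝ) (m : ℤ) : ℂ := cis (spokeAngle n γ m)

structure IsSpokeAngle (n : ℕ) (γ : ℝ) : Prop where
  three_le : 3 ≤ n
  pos : 0 < γ
  lt : γ < 2 * Real.pi / n

section
variable {n : ℕ} {γ : ℝ}

lemma spokeAngle_add (m l : ℤ) :
    spokeAngle n γ (m + 2 * l) = spokeAngle n γ m + l * (2 * Real.pi / n) := by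
  unfold spokeAngle
  rw [show (m + 2 * l) / 2 = m / 2 + l by omega]
  have : Even (m + 2 * l) ↔ Even m := by simp [Int.even_add]
  simp only [this]; push_cast; ring

lemma spokeAngle_even (k : ℤ) : spokeAngle n γ (2 * k) = k * (2 * Real.pi / n) := by
  unfold spokeAngle
  rw [if_pos (by simp), show 2 * k / 2 = k by omega, add_zero]

lemma spokeAngle_odd (k : ℤ) : spokeAngle n γ (2 * k + 1) = k * (2 * Real.pi / n) + γ := by
  unfold spokeAngle
  rw [if_neg (by simp), show (2 * k + 1) / 2 = k by omega]

/-- Unlike the spokes, the bisectors of consecutive spokes are equally spaced, at half a sector.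
They bound the cones, because a sum of two unit vectors points along their bisector. -/
lemma spokeAngle_pred_add (m : ℤ) :
    spokeAngle n γ (m - 1) + spokeAngle n γ m =
      m * (2 * Real.pi / n) + (γ - 2 * Real.pi / n) := by
  obtain ⟨k, rfl | rfl⟩ := Int.even_or_odd' m
  · rw [show 2 * k - 1 = 2 * (k - 1) + 1 by ring, spokeAngle_odd, spokeAngle_even]
    push_cast; ring
  · rw [show 2 * k + 1 - 1 = 2 * k by ring, spokeAngle_odd, spokeAngle_even]
    push_cast; ring

lemma cross_spoke_add_two (m : ℤ) :
    cross (spoke n γ m) (spoke n γ (m + 2)) = Real.sin (2 * Real.pi / n) := by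
  rw [spoke, spoke, cross_cis, show m + 2 = m + 2 * 1 by ring, spokeAngle_add]
  push_cast; congr 1; ring

namespace IsSpokeAngle

lemma angle_pos (H : IsSpokeAngle n γ) : 0 < 2 * Real.pi / n := H.pos.trans H.lt

lemma three_mul_le (H : IsSpokeAngle n γ) : 3 * (2 * Real.pi / n) ≤ 2 * Real.pi := by
  have h3 : (3 : ℝ) ≤ n := by exact_mod_cast H.three_le
  rw [mul_div_assoc', div_le_iff₀ (by linarith)]
  nlinarith [Real.pi_pos]

lemma n_mul (H : IsSpokeAngle n γ) : (n : ℝ) * (2 * Real.pi / n) = 2 * Real.pi := by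
  have h3 : (3 : ℝ) ≤ n := by exact_mod_cast H.three_le
  field_simp

lemma angle_lt (H : IsSpokeAngle n γ) (m : ℤ) : spokeAngle n γ m < spokeAngle n γ (m + 1) := by
  obtain ⟨k, rfl | rfl⟩ := Int.even_or_odd' m
  · rw [spokeAngle_odd, spokeAngle_even]; linarith [H.pos]
  · rw [show 2 * k + 1 + 1 = 2 * (k + 1) by ring, spokeAngle_odd, spokeAngle_even]
    push_cast; linarith [H.lt]

lemma angle_strictMono (H : IsSpokeAngle n γ) : StrictMono (spokeAngle n γ) :=
  strictMono_int_of_lt_succ H.angle_lt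

lemma cross_succ (H : IsSpokeAngle n γ) (m : ℤ) :
    0 < cross (spoke n γ m) (spoke n γ (m + 1)) := by
  rw [spoke, spoke, cross_cis]
  have h1 := H.angle_lt m
  have h2 := H.angle_lt (m + 1)
  rw [show m + 1 + 1 = m + 2 * 1 by ring, spokeAngle_add] at h2
  push_cast at h2
  exact Real.sin_pos_of_pos_of_lt_pi (by linarith)
    (by linarith [H.three_mul_le, H.angle_pos, Real.pi_pos])

lemma sin_pos (H : IsSpokeAngle n γ) : 0 < Real.sin (2 * Real.pi / n) :=
  Real.sin_pos_of_pos_of_lt_pi H.angle_pos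
    (by linarith [H.three_mul_le, H.angle_pos, Real.pi_pos])

/-- The three generators of a tile are in anticlockwise order. -/
lemma crosses (H : IsSpokeAngle n γ) (m : ℤ) :
    0 < cross (spoke n γ (m - 1)) (spoke n γ m) ∧ 0 < cross (spoke n γ m) (spoke n γ (m + 1)) ∧
      0 < cross (spoke n γ (m - 1)) (spoke n γ (m + 1)) := by
  refine ⟨?_, H.cross_succ m, ?_⟩
  · have := H.cross_succ (m - 1)
    rwa [sub_add_cancel] at this
  · have := cross_spoke_add_two (n := n) (γ := γ) (m - 1)
    rw [show m - 1 + 2 = m + 1 by ring] at this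
    rw [this]; exact H.sin_pos

end IsSpokeAngle

lemma norm_spoke (m : ℤ) : ‖spoke n γ m‖ = 1 := norm_cis _

lemma rot_eq_cis (k : ℤ) : rot n k = cis (k * (2 * Real.pi / n)) := by
  rw [rot, cis]; congr 1; push_cast; ring

lemma spoke_add (m l : ℤ) : spoke n γ (m + 2 * l) = rot n l * spoke n γ m := by
  rw [spoke, spoke, spokeAngle_add, rot_eq_cis, ← cis_add, add_comm]

lemma rot_mul_self (hn : n ≠ 0) (N : ℤ) : rot n (n * N) = 1 := by
  rw [rot, show (2 * Real.pi * Complex.I * ((n * N : ℤ) : ℂ) / n : ℂ) =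
    N * (2 * Real.pi * Complex.I) by
      push_cast; field_simp [show (n : ℂ) ≠ 0 by exact_mod_cast hn],
    Complex.exp_int_mul_two_pi_mul_I]

/-! ### The tiles of the spiral tiling -/

/-- The lattice vector `i (e₀ + e₁) + j (e₁ + e₂)` of the `m`-th cone, shifted by `e₁` if `m` is
even, where `e₀, e₁, e₂` are the spokes `m - 1, m, m + 1`. -/
noncomputable def spiralBase (n : ℕ) (γ : ℝ) (m : ℤ) (i j : ℕ) : ℂ :=
  (if Even m then 1 else 0 : ℕ) * spoke n γ m + i * (spoke n γ (m - 1) + spoke n γ m) +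
    j * (spoke n γ (m + 1) + spoke n γ m)

/-- The tiles of odd cones with `i = j = 0` have their corner of angle `2π/n` at the origin and fill
its neighbourhood. The even cones start in the notches between them, whence the shift in
`spiralBase`. -/
noncomputable def spiralTile (n : ℕ) (γ : ℝ) (m : ℤ) (i j : ℕ) : Set ℂ :=
  zono (spiralBase n γ m i j) (spoke n γ (m - 1)) (spoke n γ m) (spoke n γ (m + 1))

/-- The long diagonal of the `m`-th tiles. -/
noncomputable def spiralDiag (n : ℕ) (γ : ℝ) (m : ℤ) : ℂ :=
  spoke n γ (m - 1) + spoke n γ m + spoke n γ (m + 1)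

def spiralTiles (n : ℕ) (γ : ℝ) : Set (Set ℂ) :=
  {t | ∃ (m : ℤ) (i j : ℕ), t = spiralTile n γ m i j}

lemma spiralBase_add (m l : ℤ) (i j : ℕ) :
    spiralBase n γ (m + 2 * l) i j = rot n l * spiralBase n γ m i j := by
  unfold spiralBase
  rw [show m + 2 * l - 1 = m - 1 + 2 * l by ring, show m + 2 * l + 1 = m + 1 + 2 * l by ring,
    spoke_add, spoke_add, spoke_add]
  have : Even (m + 2 * l) ↔ Even m := by simp [Int.even_add]
  simp only [this]; ring

lemma spiralDiag_add (m l : ℤ) : spiralDiag n γ (m + 2 * l) = rot n l * spiralDiag n γ m := by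
  unfold spiralDiag
  rw [show m + 2 * l - 1 = m - 1 + 2 * l by ring, show m + 2 * l + 1 = m + 1 + 2 * l by ring,
    spoke_add, spoke_add, spoke_add]
  ring

lemma image_rot_spiralTile (m l : ℤ) (i j : ℕ) :
    (fun z => rot n l * z) '' spiralTile n γ m i j = spiralTile n γ (m + 2 * l) i j := by
  rw [spiralTile, zono_image_rot (k := rot n l) (w := 0) (by simp), spiralTile, spiralBase_add,
    show m + 2 * l - 1 = m - 1 + 2 * l by ring, show m + 2 * l + 1 = m + 1 + 2 * l by ring,
    spoke_add, spoke_add, spoke_add]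

lemma spiralTile_period (hn : n ≠ 0) (m N : ℤ) (i j : ℕ) :
    spiralTile n γ (m + 2 * (n * N)) i j = spiralTile n γ m i j := by
  rw [← image_rot_spiralTile, rot_mul_self hn]; simp

namespace IsSpokeAngle

/-- Adjacent cones meet along a zigzag with edges in the directions of spokes `m` and `m + 1`.
Depending on how far out the two tiles lie, a line in one of these directions separates them.
Exactly one of the two cones is shifted, which is `ε + δ = 1`. -/
lemma disjoint_succ (H : IsSpokeAngle n γ) (m : ℤ) (i j i' j' : ℕ) :
    Disjoint (interior (spiralTile n γ m i j)) (interior (spiralTile n γ (m + 1) i' j')) := by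
  obtain ⟨h1, h2, h3⟩ := H.crosses m
  obtain ⟨-, h5, h6⟩ := H.crosses (m + 1)
  rw [add_sub_cancel_right] at h6
  unfold spiralTile spiralBase
  rw [add_sub_cancel_right]
  set p := spoke n γ (m - 1)
  set q := spoke n γ m
  set r := spoke n γ (m + 1)
  set s := spoke n γ (m + 1 + 1)
  have hεδ : (if Even m then 1 else 0 : ℕ) + (if Even (m + 1) then 1 else 0 : ℕ) = 1 := by
    by_cases h : Even m <;> simp [h]
  set ε : ℕ := if Even m then 1 else 0
  set δ : ℕ := if Even (m + 1) then 1 else 0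
  rcases le_or_gt (j + ε) i' with h | h
  · apply disjoint_zono (w := q) (ne_zero_of_cross_ne_zero h2.ne')
    simp only [cross_add_right, cross_natCast_right, cross_self_eq_zero, cross_swap q p]
    rw [max_eq_left (by linarith), max_eq_left le_rfl, max_eq_right h2.le, min_eq_left le_rfl,
      min_eq_left h2.le, min_eq_left h6.le]
    have e1 : ((j : ℝ) + 1) ≤ δ + i' := by
      have : j + 1 ≤ δ + i' := by omega
      exact_mod_cast this
    have e2 := mul_le_mul_of_nonneg_right e1 h2.le
    have e3 : 0 ≤ (i : ℝ) * cross p q := by positivity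
    have e4 : 0 ≤ (j' : ℝ) * (cross q s + cross q r) := by positivity
    linarith
  · have h' : i' + 1 ≤ ε + j := by omega
    refine (disjoint_zono (w := r) (ne_zero_of_cross_ne_zero h5.ne') ?_)
    simp only [cross_add_right, cross_natCast_right, cross_self_eq_zero, cross_swap r p,
      cross_swap r q]
    rw [max_eq_left (by linarith), max_eq_left (by linarith), max_eq_left le_rfl,
      min_eq_right (by linarith), min_eq_left le_rfl, min_eq_left h5.le]
    have e1 : ((i' : ℝ) + 1) ≤ ε + j := by exact_mod_cast h'
    have e2 := mul_le_mul_of_nonneg_right e1 h2.le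
    have e3 : 0 ≤ (i : ℝ) * (cross p r + cross q r) := by positivity
    have e4 : 0 ≤ (j' : ℝ) * cross r s := by positivity
    linarith

/-- A cone is part of a full lattice tiling by rows: the tile `(i, j)` has position `i + j` in row
`j`. -/
lemma eq_of_not_disjoint_same (H : IsSpokeAngle n γ) {m : ℤ} {i j i' j' : ℕ}
    (h : ¬Disjoint (interior (spiralTile n γ m i j)) (interior (spiralTile n γ m i' j'))) :
    i = i' ∧ j = j' := by
  obtain ⟨h1, h2, h3⟩ := H.crosses m
  unfold spiralTile spiralBase at h
  set p := spoke n γ (m - 1)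
  set q := spoke n γ m
  set r := spoke n γ (m + 1)
  set ε : ℕ := if Even m then 1 else 0
  have HR : IsRowData p q (fun _ => r) (fun j => ε * q + j * (r - p)) (cross (p + q) (r - p)) :=
    ⟨h1, fun _ => h2, fun _ => h3, fun j => by push_cast; ring, fun _ => rfl⟩
  have e : ∀ i j : ℕ, zono (ε * q + i * (p + q) + j * (r + q)) p q r =
      rowTile p q (fun _ => r) (fun j => ε * q + j * (r - p)) (i + j) j := by
    intro i j
    unfold rowTile; congr 1; push_cast; ring
  rw [e, e] at h
  have := HR.eq_of_not_disjoint h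
  omega

/-- Tiles protrude from their lattice cone, but not from the larger sector between spokes `m - 1`
and `m + 1`. Overlapping tiles thus belong, up to full turns, to equal or adjacent cones. -/
lemma interior_subset (H : IsSpokeAngle n γ) {m : ℤ} {i j : ℕ} {z : ℂ}
    (hz : z ∈ interior (spiralTile n γ m i j)) :
    ∃ ρ θ : ℝ, 0 < ρ ∧ z = ρ * cis θ ∧ spokeAngle n γ (m - 1) < θ ∧
      θ < spokeAngle n γ (m + 1) := by
  obtain ⟨h1, h2, h3⟩ := H.crosses m
  have hp : 0 < cross (spoke n γ (m - 1)) z := by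
    apply lt_cross_of_mem_interior (ne_zero_of_cross_ne_zero h3.ne') _ hz
    rintro _ ⟨s, t, r, hs, ht, hr, rfl⟩
    unfold spiralBase
    simp only [cross_add_right, cross_natCast_right, cross_ofReal_right, cross_self_eq_zero]
    have := hs.1; have := ht.1; have := hr.1
    positivity
  have hr : 0 < cross z (spoke n γ (m + 1)) := by
    have : cross (spoke n γ (m + 1)) z < 0 := by
      apply cross_lt_of_mem_interior (ne_zero_of_cross_ne_zero (q := spoke n γ m)
        (by rw [cross_swap]; linarith)) _ hz
      rintro _ ⟨s, t, r, hs, ht, hr, rfl⟩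
      unfold spiralBase
      rw [cross_swap]
      simp only [cross_add_left, cross_natCast_left, cross_ofReal_left, cross_self_eq_zero]
      have := hs.1; have := ht.1; have := hr.1
      rw [neg_nonpos]
      positivity
    rw [cross_swap]; linarith
  have e : spokeAngle n γ (m + 1) = spokeAngle n γ (m - 1) + 2 * Real.pi / n := by
    have := spokeAngle_add (n := n) (γ := γ) (m - 1) 1
    rw [show m - 1 + 2 * 1 = m + 1 by ring] at this
    rw [this]; push_cast; ring
  obtain ⟨ρ, θ, h4, h5, -, -, h6, h7⟩ := exists_polar_sector (z := z)
    (x := spokeAngle n γ (m - 1)) (y := spokeAngle n γ (m + 1))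
    (by rw [e]; linarith [H.angle_pos])
    (by rintro rfl; simp [cross_zero_right] at hp) hp.le hr.le
  exact ⟨ρ, θ, h4, h5, h6 hp, h7 hr⟩

lemma eq_of_not_disjoint (H : IsSpokeAngle n γ) {m m' : ℤ} {i j i' j' : ℕ}
    (h : ¬Disjoint (interior (spiralTile n γ m i j)) (interior (spiralTile n γ m' i' j'))) :
    (∃ N : ℤ, m' = m + 2 * (n * N)) ∧ i = i' ∧ j = j' := by
  obtain ⟨z, hz, hz'⟩ := Set.not_disjoint_iff.1 h
  obtain ⟨ρ, θ, hρ, e, h1, h2⟩ := H.interior_subset hz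
  obtain ⟨ρ', θ', hρ', e', h1', h2'⟩ := H.interior_subset hz'
  obtain ⟨N, hN⟩ := cis_eq_cis hρ hρ' (e.symm.trans e')
  have hn : n ≠ 0 := by have := H.three_le; omega
  have hs : ∀ l : ℤ, spokeAngle n γ (l + 2 * (n * N)) = spokeAngle n γ l + N * (2 * Real.pi) := by
    intro l
    rw [spokeAngle_add]; push_cast; linear_combination (N : ℝ) * H.n_mul
  obtain ⟨m'', hm''⟩ : ∃ m'', m'' = m' + 2 * (n * N) := ⟨_, rfl⟩
  have k1 : spokeAngle n γ (m'' - 1) < θ := by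
    rw [hm'', show m' + 2 * (n * N) - 1 = m' - 1 + 2 * (n * N) by ring, hs]; linarith
  have k2 : θ < spokeAngle n γ (m'' + 1) := by
    rw [hm'', show m' + 2 * (n * N) + 1 = m' + 1 + 2 * (n * N) by ring, hs]; linarith
  have k3 := H.angle_strictMono.lt_iff_lt.1 (h1.trans k2)
  have k4 := H.angle_strictMono.lt_iff_lt.1 (k1.trans h2)
  rw [← spiralTile_period hn m' N, ← hm''] at h
  rcases (by omega : m'' = m + 1 ∨ m = m'' + 1 ∨ m = m'') with h0 | h0 | h0
  · rw [h0] at h; exact absurd (H.disjoint_succ _ _ _ _ _) h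
  · rw [h0] at h; exact absurd (H.disjoint_succ _ _ _ _ _).symm h
  · rw [← h0] at h
    exact ⟨⟨-N, by linear_combination -hm'' - h0⟩, H.eq_of_not_disjoint_same h⟩

end IsSpokeAngle
end

/-! ### The cones cover the plane; congruence of all tiles and the prototile -/

section
variable {n : ℕ} {γ : ℝ}

lemma spoke_pred_add_spoke (m : ℤ) : spoke n γ (m - 1) + spoke n γ m =
    (2 * Real.cos ((spokeAngle n γ m - spokeAngle n γ (m - 1)) / 2) : ℝ) *
      cis ((m * (2 * Real.pi / n) + (γ - 2 * Real.pi / n)) / 2) := by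
  rw [spoke, spoke, cis_add_cis, spokeAngle_pred_add]

namespace IsSpokeAngle

lemma cos_pos (H : IsSpokeAngle n γ) (m : ℤ) :
    0 < 2 * Real.cos ((spokeAngle n γ m - spokeAngle n γ (m - 1)) / 2) := by
  have h1 := H.angle_lt (m - 1)
  have h2 := H.angle_lt m
  have h3 := spokeAngle_add (n := n) (γ := γ) (m - 1) 1
  rw [show m - 1 + 2 * 1 = m + 1 by ring] at h3
  rw [sub_add_cancel] at h1
  push_cast at h3
  have := Real.pi_pos
  exact mul_pos two_pos (Real.cos_pos_of_mem_Ioo ⟨by linarith, by linarith [H.three_mul_le]⟩)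

/-- The plane is the union of the cones spanned by the lattice vectors. -/
lemma exists_cone (H : IsSpokeAngle n γ) (z : ℂ) : ∃ (m : ℤ) (s t : ℝ), 0 ≤ s ∧ 0 ≤ t ∧
    z = s * (spoke n γ (m - 1) + spoke n γ m) + t * (spoke n γ (m + 1) + spoke n γ m) := by
  rcases eq_or_ne z 0 with rfl | hz
  · exact ⟨0, 0, 0, le_rfl, le_rfl, by simp⟩
  obtain ⟨ρ, φ, hρ, -, -, rfl⟩ := exists_polar hz 0
  rw [zero_add]
  have hβ := H.angle_pos
  have hβ2 := H.three_mul_le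
  have hπ := Real.pi_pos
  set β := 2 * Real.pi / n with hβdef
  -- Cone `m` lies between the directions `(m β + γ - β) / 2` and `((m + 1) β + γ - β) / 2`; the
  -- formula solves for `m`.
  set m := ⌊(φ - (γ - β) / 2) / (β / 2)⌋ with hm
  have b1 := Int.floor_le ((φ - (γ - β) / 2) / (β / 2))
  have b2 := Int.lt_floor_add_one ((φ - (γ - β) / 2) / (β / 2))
  rw [← hm, le_div_iff₀ (by linarith)] at b1
  rw [← hm, div_lt_iff₀ (by linarith)] at b2
  obtain ⟨h1, h2, h3⟩ := H.crosses m
  have k1 : 0 ≤ cross (spoke n γ (m - 1) + spoke n γ m) (ρ * cis φ) := by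
    rw [spoke_pred_add_spoke, cross_ofReal_left, cross_ofReal_right, cross_cis, ← hβdef]
    refine mul_nonneg (H.cos_pos m).le (mul_nonneg hρ.le
      (Real.sin_nonneg_of_nonneg_of_le_pi ?_ ?_)) <;> linarith
  have k2 : 0 ≤ cross (ρ * cis φ) (spoke n γ (m + 1) + spoke n γ m) := by
    have e := spoke_pred_add_spoke (n := n) (γ := γ) (m + 1)
    have c := H.cos_pos (m + 1)
    rw [add_sub_cancel_right] at e c
    rw [add_comm, e, cross_ofReal_left, cross_ofReal_right, cross_cis, ← hβdef]
    push_cast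
    refine mul_nonneg hρ.le (mul_nonneg c.le
      (Real.sin_nonneg_of_nonneg_of_le_pi ?_ ?_)) <;> linarith
  have k3 : 0 < cross (spoke n γ (m - 1) + spoke n γ m) (spoke n γ (m + 1) + spoke n γ m) := by
    simp only [cross_add_left, cross_add_right, cross_self_eq_zero]; linarith
  exact ⟨m, _, _, div_nonneg k2 k3.le, div_nonneg k1 k3.le, eq_cross_combination k3.ne' _⟩

/-- In a parallelogram of an odd cone the two triangles outside the tile lie at the far end and
belong to the next tiles of that cone. In an even cone the shift puts them at the near end; at the
border (`i = 0` or `j = 0`) they belong to tiles protruding from the neighbouring odd cone. -/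
lemma cover (H : IsSpokeAngle n γ) (z : ℂ) : ∃ (m : ℤ) (i j : ℕ), z ∈ spiralTile n γ m i j := by
  obtain ⟨m, s, t, hs, ht, hz⟩ := H.exists_cone z
  obtain ⟨h1, h2, h3⟩ := H.crosses m
  have hs2 : 0 ≤ s - ⌊s⌋₊ ∧ s - ⌊s⌋₊ ≤ 1 :=
    ⟨sub_nonneg.2 (Nat.floor_le hs), by linarith [Nat.lt_floor_add_one s]⟩
  have ht2 : 0 ≤ t - ⌊t⌋₊ ∧ t - ⌊t⌋₊ ≤ 1 :=
    ⟨sub_nonneg.2 (Nat.floor_le ht), by linarith [Nat.lt_floor_add_one t]⟩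
  set i := ⌊s⌋₊
  set j := ⌊t⌋₊
  by_cases hm : Even m
  · rcases parallelogram_cover' h1 h2 h3 hs2 ht2 with
      ⟨σ, τ, ρ, k1, k2, k3, he⟩ | ⟨σ, τ, k1, k2, k3, he⟩ | ⟨σ, τ, k1, k2, k3, he⟩
    · refine ⟨m, i, j, mk_mem_zono σ τ ρ k1 k2 k3 ?_⟩
      rw [spiralBase, if_pos hm, hz]
      push_cast at he ⊢
      linear_combination he
    · rcases Nat.eq_zero_or_eq_succ_pred j with hj | hj
      · refine ⟨m - 1, 0, i, mk_mem_zono 0 σ τ (by simp) ⟨k1, by linarith⟩ ⟨by linarith, k3⟩ ?_⟩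
        rw [spiralBase, if_neg (by simpa [Int.even_sub_one] using hm), sub_add_cancel, hz]
        rw [hj] at he
        push_cast at he ⊢
        linear_combination he
      · refine ⟨m, i, j.pred, mk_mem_zono σ τ 1 ⟨k1, by linarith⟩ ⟨by linarith, k3⟩ (by simp) ?_⟩
        rw [spiralBase, if_pos hm, hz]
        rw [hj] at he
        push_cast at he ⊢
        linear_combination he
    · rcases Nat.eq_zero_or_eq_succ_pred i with hi | hi
      · refine ⟨m + 1, j, 0, mk_mem_zono τ σ 0 ⟨by linarith, k3⟩ ⟨k1, by linarith⟩ (by simp) ?_⟩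
        rw [spiralBase, if_neg (by simpa [Int.even_add_one] using hm), add_sub_cancel_right, hz]
        rw [hi] at he
        push_cast at he ⊢
        linear_combination he
      · refine ⟨m, i.pred, j, mk_mem_zono 1 τ σ (by simp) ⟨by linarith, k3⟩ ⟨k1, by linarith⟩ ?_⟩
        rw [spiralBase, if_pos hm, hz]
        rw [hi] at he
        push_cast at he ⊢
        linear_combination he
  · rcases parallelogram_cover h1 h2 h3 hs2 ht2 with
      ⟨σ, τ, ρ, k1, k2, k3, he⟩ | ⟨σ, τ, k1, k2, k3, he⟩ | ⟨σ, τ, k1, k2, k3, he⟩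
    · refine ⟨m, i, j, mk_mem_zono σ τ ρ k1 k2 k3 ?_⟩
      rw [spiralBase, if_neg hm, hz]
      push_cast at he ⊢
      linear_combination he
    · refine ⟨m, i, j + 1, mk_mem_zono σ τ 0 ⟨by linarith, k3⟩ ⟨k1, by linarith⟩ (by simp) ?_⟩
      rw [spiralBase, if_neg hm, hz]
      push_cast at he ⊢
      linear_combination he
    · refine ⟨m, i + 1, j, mk_mem_zono 0 τ σ (by simp) ⟨k1, by linarith⟩ ⟨by linarith, k3⟩ ?_⟩
      rw [spiralBase, if_neg hm, hz]
      push_cast at he ⊢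
      linear_combination he

end IsSpokeAngle

lemma spoke_zero : spoke n γ 0 = 1 := by
  have := spokeAngle_even (n := n) (γ := γ) 0
  rw [spoke, show (0 : ℤ) = 2 * 0 by rfl, this]; simp [cis_zero]

lemma spoke_one : spoke n γ 1 = cis γ := by
  have := spokeAngle_odd (n := n) (γ := γ) 0
  rw [spoke, show (1 : ℤ) = 2 * 0 + 1 by rfl, this]; simp

lemma spoke_two : spoke n γ 2 = cis (2 * Real.pi / n) := by
  have := spokeAngle_even (n := n) (γ := γ) 1
  rw [spoke, show (2 : ℤ) = 2 * 1 by rfl, this]; simp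

lemma spoke_neg_one : spoke n γ (-1) = cis (γ - 2 * Real.pi / n) := by
  have := spokeAngle_odd (n := n) (γ := γ) (-1)
  rw [spoke, show (-1 : ℤ) = 2 * (-1) + 1 by rfl, this]
  congr 1; push_cast; ring

/-- All tiles are congruent, by isometries that map bases to bases and diagonals to diagonals. -/
lemma exists_isometry_spiralTile (m : ℤ) (i j : ℕ) : ∃ g : ℂ ≃ᵢ ℂ,
    spiralTile n γ m i j = g '' spiralTile n γ 1 0 0 ∧ g 0 = spiralBase n γ m i j ∧
      g (spiralDiag n γ 1) = spiralBase n γ m i j + spiralDiag n γ m := by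
  have e0 : spiralBase n γ 1 0 0 = 0 := by simp [spiralBase]
  have e1 : spiralTile n γ 1 0 0 = zono 0 (spoke n γ 0) (spoke n γ 1) (spoke n γ 2) := by
    rw [spiralTile, e0]; rfl
  have e2 : spiralDiag n γ 1 = spoke n γ 0 + spoke n γ 1 + spoke n γ 2 := rfl
  rw [e1, e2]
  obtain ⟨k, rfl | rfl⟩ := Int.even_or_odd' m
  · have f0 : spoke n γ (2 * k - 1) = rot n k * spoke n γ (-1) := by
      rw [← spoke_add]; congr 1; ring
    have f1 : spoke n γ (2 * k) = rot n k * spoke n γ 0 := by rw [← spoke_add]; congr 1; ring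
    have f2 : spoke n γ (2 * k + 1) = rot n k * spoke n γ 1 := by rw [← spoke_add]; congr 1; ring
    -- The reflection `z ↦ cis γ * conj z` exchanges spokes 0 and 1 and takes spoke 2 to spoke -1.
    -- It therefore carries the tile shape of odd cones to that of even cones.
    have c0 : cis γ * starRingEnd ℂ (spoke n γ 0) = spoke n γ 1 := by
      rw [spoke_zero, spoke_one]; simp
    have c1 : cis γ * starRingEnd ℂ (spoke n γ 1) = spoke n γ 0 := by
      rw [spoke_zero, spoke_one, conj_cis, ← cis_add, add_neg_cancel, cis_zero]
    have c2 : cis γ * starRingEnd ℂ (spoke n γ 2) = spoke n γ (-1) := by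
      rw [spoke_two, spoke_neg_one, conj_cis, ← cis_add, sub_eq_add_neg]
    refine ⟨reflIso (rot n k * cis γ) (by rw [norm_mul, rot_norm, norm_cis, one_mul])
      (spiralBase n γ (2 * k) i j), ?_, by simp, ?_⟩
    · rw [zono_image_refl (reflIso_apply _ _ _), mul_assoc, mul_assoc, mul_assoc, c0, c1, c2,
        spiralTile, f0, f1, f2, zono_rev]
      congr 1; simp
    · rw [reflIso_apply, map_add, map_add, spiralDiag, f0, f1, f2]
      linear_combination rot n k * (c0 + c1 + c2)
  · have f0 : spoke n γ (2 * k + 1 - 1) = rot n k * spoke n γ 0 := by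
      rw [← spoke_add]; congr 1; ring
    have f1 : spoke n γ (2 * k + 1) = rot n k * spoke n γ 1 := by rw [← spoke_add]; congr 1; ring
    have f2 : spoke n γ (2 * k + 1 + 1) = rot n k * spoke n γ 2 := by
      rw [← spoke_add]; congr 1; ring
    refine ⟨rotIso (rot n k) (rot_norm n k) (spiralBase n γ (2 * k + 1) i j), ?_, by simp, ?_⟩
    · rw [zono_image_rot (rotIso_apply _ _ _), spiralTile, f0, f1, f2]
      congr 1; simp
    · rw [rotIso_apply, spiralDiag, f0, f1, f2]; ring

lemma IsSpokeAngle.isMonohedralTiling (H : IsSpokeAngle n γ) :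
    IsMonohedralTiling (spiralTile n γ 1 0 0) (spiralTiles n γ) where
  congruent := by
    rintro t ⟨m, i, j, rfl⟩
    obtain ⟨g, hg, -⟩ := exists_isometry_spiralTile (n := n) (γ := γ) m i j
    exact ⟨g, hg⟩
  cover := by
    apply eq_univ_of_forall
    intro z
    obtain ⟨m, i, j, h⟩ := H.cover z
    exact ⟨_, ⟨m, i, j, rfl⟩, h⟩
  no_overlap := by
    rintro _ ⟨m, i, j, rfl⟩ _ ⟨m', i', j', rfl⟩ hne
    by_contra hd
    obtain ⟨⟨N, rfl⟩, rfl, rfl⟩ := H.eq_of_not_disjoint hd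
    exact hne (spiralTile_period (by have := H.three_le; omega) _ _ _ _).symm

/-- The prototile is a glued hexagon. -/
lemma IsSpokeAngle.prototile (H : IsSpokeAngle n γ) :
    IsGluedPair (spiralTile n γ 1 0 0) ∧ IsConvexEquilateralHexagon (spiralTile n γ 1 0 0) := by
  have e : spiralTile n γ 1 0 0 = zono 0 (spoke n γ 0) (spoke n γ 1) (spoke n γ 2) := by
    rw [spiralTile]; congr 1; simp [spiralBase]
  obtain ⟨h1, h2, h3⟩ := H.crosses 1
  rw [show (1 : ℤ) - 1 = 0 by rfl] at h1 h3
  rw [show (1 : ℤ) + 1 = 2 by rfl] at h2 h3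
  have hβ := H.angle_pos
  have hβ2 := H.three_mul_le
  have hπ := Real.pi_pos
  rw [e]
  refine ⟨isGluedPair_zono h1 h2 h3 (norm_spoke _) (norm_spoke _) (norm_spoke _) ⟨n, ?_⟩,
    isConvexEquilateralHexagon_zono h1 h2 h3 (norm_spoke _) (norm_spoke _) (norm_spoke _)⟩
  rw [← H.n_mul]
  congr 1
  rw [EuclideanGeometry.angle, vsub_eq_sub, vsub_eq_sub, sub_zero, sub_zero, spoke_two, spoke_zero,
    Complex.angle_one_right (cis_ne_zero _), cis, Complex.arg_exp_mul_I,
    (toIocMod_eq_self _).2 ⟨by linarith, by linarith⟩, abs_of_pos hβ]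

end

/-! ### The arms of the spiral -/

/-- The centres of the tiles. -/
noncomputable def spiralCenter (n : ℕ) (γ : ℝ) (m : ℤ) (i j : ℕ) : ℂ :=
  spiralBase n γ m i j + spiralDiag n γ m / 2

section
variable {n : ℕ} {γ : ℝ}

lemma norm_half_add_le {u v : ℂ} (hu : ‖u‖ = 1) (hv : ‖v‖ = 1) : ‖(u + v) / 2‖ ≤ 2 := by
  rw [norm_div, Complex.norm_ofNat]
  linarith [norm_add_le u v]

lemma norm_half_sub_le {u v : ℂ} (hu : ‖u‖ = 1) (hv : ‖v‖ = 1) : ‖(u - v) / 2‖ ≤ 2 := by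
  rw [norm_div, Complex.norm_ofNat]
  linarith [norm_sub_le u v]

namespace IsSpokeAngle

/-- One step along an antidiagonal `i + j = const` of a cone, across an edge parallel to the middle
spoke. -/
lemma passes_cone (H : IsSpokeAngle n γ) (m : ℤ) (i j : ℕ) :
    Passes 2 (spiralCenter n γ m (i + 1) j) (spiralTile n γ m (i + 1) j)
      (spiralCenter n γ m i (j + 1)) (spiralTile n γ m i (j + 1)) := by
  obtain ⟨h1, h2, h3⟩ := H.crosses m
  unfold spiralCenter spiralTile spiralBase spiralDiag
  have np := norm_spoke (n := n) (γ := γ) (m - 1)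
  have nr := norm_spoke (n := n) (γ := γ) (m + 1)
  set p := spoke n γ (m - 1)
  set q := spoke n γ m
  set r := spoke n γ (m + 1)
  set ε : ℕ := if Even m then 1 else 0
  have h := passes_translate (x := ε * q + (i + 1 : ℕ) * (p + q) + j * (r + q) + p) (p := -p)
    (q := r) (r := q) (by rw [cross_neg_left]; linarith) (D := 2) (by
      rw [show (ε * q + (i + 1 : ℕ) * (p + q) + j * (r + q) + p + (-p + r + q) / 2 : ℂ) =
        ε * q + (i + 1 : ℕ) * (p + q) + j * (r + q) + (p + q + r) / 2 by ring]
      simp only [cross_add_right, cross_add_left, cross_neg_right, cross_natCast_left,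
        cross_div_two_left, cross_self_eq_zero, cross_swap r p, cross_swap q p]
      have : 0 ≤ (ε : ℝ) * (cross p q + cross q r) := by positivity
      have : 0 ≤ ((i + 1 : ℕ) : ℝ) * (cross p r + cross p q + cross q r) := by positivity
      have : 0 ≤ (j : ℝ) * (cross p r + cross p q + cross q r) := by positivity
      linarith) (by rw [norm_neg, np, nr]; norm_num)
  have e : ∀ x, zono (x + p) (-p) r q = zono x p q r := fun x => by
    rw [zono_neg, ← zono_rotate, zono_rev]
  rw [e, show ∀ u : ℂ, u + p + (-p + r) = (u + (r - p)) + p from fun u => by ring, e] at h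
  convert h using 1
  · ring
  · push_cast; ring
  · congr 1; push_cast; ring

/-- The step outward: the sum `i + j` grows by one, so a ring is completed and the next one begins
in the same odd cone. -/
lemma passes_ring (H : IsSpokeAngle n γ) {m : ℤ} (hm : ¬Even m) (i : ℕ) :
    Passes 2 (spiralCenter n γ m i 0) (spiralTile n γ m i 0)
      (spiralCenter n γ m i 1) (spiralTile n γ m i 1) := by
  obtain ⟨h1, h2, h3⟩ := H.crosses m
  unfold spiralCenter spiralTile spiralBase spiralDiag
  rw [if_neg hm]
  have nq := norm_spoke (n := n) (γ := γ) m
  have nr := norm_spoke (n := n) (γ := γ) (m + 1)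
  set p := spoke n γ (m - 1)
  set q := spoke n γ m
  set r := spoke n γ (m + 1)
  have h := passes_translate (x := i * (p + q)) (p := q) (q := r) (r := p)
    (by rw [cross_swap]; linarith) (D := 2) (by
      simp only [cross_add_right, cross_add_left, cross_natCast_left,
        cross_div_two_left, cross_self_eq_zero, cross_swap r q]
      have : 0 ≤ (i : ℝ) * (cross p q + cross p r + cross q r) := by positivity
      linarith) (by rw [nq, nr]; norm_num)
  rw [zono_rotate _ p q r, zono_rotate _ p q r] at h
  convert h using 1
  · push_cast; ring
  · congr 1; push_cast; ring
  · push_cast; ring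
  · congr 1; push_cast; ring

/-- At a border of cones the two tiles are mirror images, not translates, so the general passage
lemma does not apply; the midpoint of their common edge is written down directly. -/
lemma passes_odd (H : IsSpokeAngle n γ) {m : ℤ} (hm : ¬Even m) (j : ℕ) :
    Passes 2 (spiralCenter n γ m 0 (j + 1)) (spiralTile n γ m 0 (j + 1))
      (spiralCenter n γ (m + 1) j 0) (spiralTile n γ (m + 1) j 0) := by
  obtain ⟨h1, h2, h3⟩ := H.crosses m
  obtain ⟨-, h5, h6⟩ := H.crosses (m + 1)
  unfold spiralCenter spiralTile spiralBase spiralDiag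
  rw [add_sub_cancel_right] at h6 ⊢
  rw [if_neg hm, if_pos (by simpa [Int.even_add_one] using hm)]
  have np := norm_spoke (n := n) (γ := γ) (m - 1)
  have nq := norm_spoke (n := n) (γ := γ) m
  have ns := norm_spoke (n := n) (γ := γ) (m + 1 + 1)
  set p := spoke n γ (m - 1)
  set q := spoke n γ m
  set r := spoke n γ (m + 1)
  set s := spoke n γ (m + 1 + 1)
  refine ⟨(j + 1 : ℕ) * (r + q) + r / 2, ?_, ?_, ?_, ?_, ?_, ?_, ?_⟩
  · exact mk_mem_zono 0 0 (1 / 2) (by simp) (by simp) (by norm_num) (by push_cast; ring)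
  · exact mk_mem_zono 1 (1 / 2) 0 (by simp) (by norm_num) (by simp) (by push_cast; ring)
  · apply mem_interior_of_parallelogram h2.ne' (ε := 1 / 2) (by norm_num)
    intro σ τ hσ hτ
    rw [abs_lt] at hσ hτ
    rcases le_total 0 σ with h | h
    · exact Or.inl (mk_mem_zono 0 σ (1 / 2 + τ) (by simp) ⟨h, by linarith⟩
        ⟨by linarith, by linarith⟩ (by push_cast; ring))
    · exact Or.inr (mk_mem_zono (1 + σ) (1 / 2 + τ) 0 ⟨by linarith, by linarith⟩
        ⟨by linarith, by linarith⟩ (by simp) (by push_cast; ring))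
  · simp only [cross_add_right, cross_add_left, cross_natCast_left, cross_natCast_right,
      cross_div_two_left, cross_div_two_right, cross_self_eq_zero, cross_swap r q]
    have : 0 < ((j + 1 : ℕ) : ℝ) * (cross p r + cross p q) := by positivity
    have : 0 < ((j + 1 : ℕ) : ℝ) * cross q r := by positivity
    nlinarith
  · simp only [cross_add_right, cross_add_left, cross_natCast_left, cross_natCast_right,
      cross_div_two_left, cross_div_two_right, cross_self_eq_zero, cross_swap r q]
    have : 0 < ((j + 1 : ℕ) : ℝ) * (cross q s + cross r s) := by positivity
    have : 0 < ((j + 1 : ℕ) : ℝ) * cross q r := by positivity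
    push_cast at *
    nlinarith
  · convert norm_half_sub_le (u := -p) (by rwa [norm_neg]) nq using 2
    push_cast; ring
  · convert norm_half_sub_le ns nq using 2
    push_cast; ring

lemma passes_even (H : IsSpokeAngle n γ) {m : ℤ} (hm : Even m) (j : ℕ) :
    Passes 2 (spiralCenter n γ m 0 j) (spiralTile n γ m 0 j)
      (spiralCenter n γ (m + 1) (j + 1) 0) (spiralTile n γ (m + 1) (j + 1) 0) := by
  obtain ⟨h1, h2, h3⟩ := H.crosses m
  obtain ⟨-, h5, h6⟩ := H.crosses (m + 1)
  unfold spiralCenter spiralTile spiralBase spiralDiag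
  rw [add_sub_cancel_right] at h6 ⊢
  rw [if_pos hm, if_neg (by simpa [Int.even_add_one] using hm)]
  have np := norm_spoke (n := n) (γ := γ) (m - 1)
  have nr := norm_spoke (n := n) (γ := γ) (m + 1)
  have ns := norm_spoke (n := n) (γ := γ) (m + 1 + 1)
  set p := spoke n γ (m - 1)
  set q := spoke n γ m
  set r := spoke n γ (m + 1)
  set s := spoke n γ (m + 1 + 1)
  refine ⟨(j + 1 : ℕ) * (r + q) + q / 2, ?_, ?_, ?_, ?_, ?_, ?_, ?_⟩
  · exact mk_mem_zono 0 (1 / 2) 1 (by simp) (by norm_num) (by simp) (by push_cast; ring)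
  · exact mk_mem_zono (1 / 2) 0 0 (by norm_num) (by simp) (by simp) (by push_cast; ring)
  · apply mem_interior_of_parallelogram h2.ne' (ε := 1 / 2) (by norm_num)
    intro σ τ hσ hτ
    rw [abs_lt] at hσ hτ
    rcases le_total τ 0 with h | h
    · exact Or.inl (mk_mem_zono 0 (1 / 2 + σ) (1 + τ) (by simp) ⟨by linarith, by linarith⟩
        ⟨by linarith, by linarith⟩ (by push_cast; ring))
    · exact Or.inr (mk_mem_zono (1 / 2 + σ) τ 0 ⟨by linarith, by linarith⟩
        ⟨h, by linarith⟩ (by simp) (by push_cast; ring))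
  · simp only [cross_add_right, cross_add_left, cross_natCast_left, cross_natCast_right,
      cross_div_two_left, cross_div_two_right, cross_self_eq_zero, cross_swap r q]
    have : 0 < ((j + 1 : ℕ) : ℝ) * (cross p r + cross p q) := by positivity
    have : 0 < ((j + 1 : ℕ) : ℝ) * cross q r := by positivity
    push_cast at *
    nlinarith
  · simp only [cross_add_right, cross_add_left, cross_natCast_left, cross_natCast_right,
      cross_div_two_left, cross_div_two_right, cross_self_eq_zero, cross_swap r q]
    have : 0 < ((j + 1 : ℕ) : ℝ) * (cross q s + cross r s) := by positivity
    have : 0 < ((j + 1 : ℕ) : ℝ) * cross q r := by positivity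
    push_cast at *
    nlinarith
  · convert norm_half_sub_le nr np using 2
    push_cast; ring
  · convert norm_half_add_le nr ns using 2
    push_cast; ring

/-- Crossing with the unit spokes `m + 1` and `m - 1` bounds the norm from below, and all
contributions other than the stated one are non-negative. -/
lemma le_norm_center (H : IsSpokeAngle n γ) (m : ℤ) (i j : ℕ) :
    (i : ℝ) * Real.sin (2 * Real.pi / n) ≤ ‖spiralCenter n γ m i j‖ ∧
      (j : ℝ) * Real.sin (2 * Real.pi / n) ≤ ‖spiralCenter n γ m i j‖ := by
  obtain ⟨h1, h2, h3⟩ := H.crosses m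
  have e := cross_spoke_add_two (n := n) (γ := γ) (m - 1)
  rw [show m - 1 + 2 = m + 1 by ring] at e
  rw [← e]
  have np := norm_spoke (n := n) (γ := γ) (m - 1)
  have nr := norm_spoke (n := n) (γ := γ) (m + 1)
  have k1 := (le_abs_self _).trans (abs_cross_le (spiralCenter n γ m i j) (spoke n γ (m + 1)))
  have k2 := (le_abs_self _).trans (abs_cross_le (spoke n γ (m - 1)) (spiralCenter n γ m i j))
  rw [nr, mul_one] at k1
  rw [np, one_mul] at k2
  refine ⟨le_trans ?_ k1, le_trans ?_ k2⟩ <;> unfold spiralCenter spiralBase spiralDiag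
  · set p := spoke n γ (m - 1)
    set q := spoke n γ m
    set r := spoke n γ (m + 1)
    simp only [cross_add_left, cross_natCast_left, cross_div_two_left, cross_self_eq_zero]
    rw [mul_add]
    have : 0 ≤ ((if Even m then 1 else 0 : ℕ) : ℝ) * cross q r := by positivity
    have : 0 ≤ (i : ℝ) * cross q r := by positivity
    have : 0 ≤ (j : ℝ) * (0 + cross q r) := by positivity
    linarith
  · set p := spoke n γ (m - 1)
    set q := spoke n γ m
    set r := spoke n γ (m + 1)
    simp only [cross_add_right, cross_natCast_right, cross_div_two_right, cross_self_eq_zero]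
    rw [mul_add (j : ℝ)]
    have : 0 ≤ ((if Even m then 1 else 0 : ℕ) : ℝ) * cross p q := by positivity
    have : 0 ≤ (j : ℝ) * cross p q := by positivity
    have : 0 ≤ (i : ℝ) * (0 + cross p q) := by positivity
    linarith

/-- The directions of the centres of the last tiles of the rings. -/
lemma center_polar (H : IsSpokeAngle n γ) (k : ℤ) (i : ℕ) : ∃ ρ θ : ℝ, 0 < ρ ∧
    spiralCenter n γ (2 * k + 1) i 0 = ρ * cis θ ∧
    k * (2 * Real.pi / n) + γ / 2 < θ ∧
    θ < k * (2 * Real.pi / n) + γ / 2 + 2 * Real.pi / n / 2 := by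
  obtain ⟨h1, h2, h3⟩ := H.crosses (2 * k + 1)
  have c1 := spoke_pred_add_spoke (n := n) (γ := γ) (2 * k + 1)
  have c2 := spoke_pred_add_spoke (n := n) (γ := γ) (2 * k + 1 + 1)
  have d1 := H.cos_pos (2 * k + 1)
  have d2 := H.cos_pos (2 * k + 1 + 1)
  rw [show 2 * k + 1 + 1 - 1 = 2 * k + 1 by ring] at c2 d2
  have hβ := H.angle_pos
  rw [show (((2 * k + 1 : ℤ) : ℝ) * (2 * Real.pi / n) + (γ - 2 * Real.pi / n)) / 2 =
    k * (2 * Real.pi / n) + γ / 2 by push_cast; ring] at c1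
  rw [show (((2 * k + 1 + 1 : ℤ) : ℝ) * (2 * Real.pi / n) + (γ - 2 * Real.pi / n)) / 2 =
    k * (2 * Real.pi / n) + γ / 2 + 2 * Real.pi / n / 2 by push_cast; ring] at c2
  set C := spiralCenter n γ (2 * k + 1) i 0 with hC
  have k1 : 0 < cross (spoke n γ (2 * k + 1 - 1) + spoke n γ (2 * k + 1)) C := by
    rw [hC, spiralCenter, spiralBase, spiralDiag, if_neg (by simp)]
    simp only [cross_add_right, cross_add_left, cross_natCast_right, cross_div_two_right,
      cross_self_eq_zero]
    push_cast; linarith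
  have k2 : 0 < cross C (spoke n γ (2 * k + 1) + spoke n γ (2 * k + 1 + 1)) := by
    rw [hC, spiralCenter, spiralBase, spiralDiag, if_neg (by simp)]
    simp only [cross_add_right, cross_add_left, cross_natCast_left, cross_div_two_left,
      cross_self_eq_zero, cross_swap (spoke n γ (2 * k + 1 + 1)) (spoke n γ (2 * k + 1))]
    have : 0 ≤ (i : ℝ) * (cross (spoke n γ (2 * k + 1 - 1)) (spoke n γ (2 * k + 1)) +
      cross (spoke n γ (2 * k + 1 - 1)) (spoke n γ (2 * k + 1 + 1)) +
      cross (spoke n γ (2 * k + 1)) (spoke n γ (2 * k + 1 + 1))) := by positivity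
    push_cast; linarith
  rw [c1, cross_ofReal_left] at k1
  rw [c2, cross_ofReal_right] at k2
  have k1' := pos_of_mul_pos_right k1 d1.le
  have k2' := pos_of_mul_pos_right k2 d2.le
  obtain ⟨ρ, θ, h4, h5, -, -, h6, h7⟩ := exists_polar_sector (z := C) (by linarith)
    (by rintro h; rw [h, cross_zero_right] at k1'; exact lt_irrefl _ k1') k1'.le k2'.le
  exact ⟨ρ, θ, h4, h5, h6 k1', h7 k2'⟩

/-- The indices of the `q`-th tile of the `M`-th ring of the first arm. -/
def armIndex (M q : ℕ) : ℤ × ℕ × ℕ :=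
  if q < M then (2 * (M - 1 : ℤ) + 1, M - 1 - q, q + 1)
  else if q < 2 * M then (2 * M, 2 * M - 1 - q, q - M) else (2 * M + 1, M, 0)

/-- Ring `M` has `i + j = M` in odd cones and `i + j = M - 1` in even ones. The first arm takes from
it the tiles with `j ≥ 1` of cone `2M - 1`, all of cone `2M`, and the tile `(M, 0)` of cone `2M +
1`. This is one sector's worth, so the `n` rotations partition the ring, and each ring continues one
sector further than the previous one. -/
lemma isSpiralTiling (H : IsSpokeAngle n γ) : IsSpiralTiling (spiralTiles n γ) n 0 := by
  have hn : n ≠ 0 := by have := H.three_le; omega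
  have himg : ∀ (k : ℤ) (M q : ℕ), (fun z => rot n k * z) '' spiralTile n γ (armIndex M q).1
      (armIndex M q).2.1 (armIndex M q).2.2 = spiralTile n γ ((armIndex M q).1 + 2 * k)
        (armIndex M q).2.1 (armIndex M q).2.2 := fun _ _ _ => image_rot_spiralTile _ _ _ _
  have hlast : ∀ M, armIndex M (2 * M) = (2 * (M : ℤ) + 1, M, 0) := fun M => by
    rw [armIndex, if_neg (by omega), if_neg (by omega)]
  refine isSpiralTiling_of (fun M => 2 * M)
    (fun M q => spiralTile n γ (armIndex M q).1 (armIndex M q).2.1 (armIndex M q).2.2)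
    (fun M q => spiralCenter n γ (armIndex M q).1 (armIndex M q).2.1 (armIndex M q).2.2)
    2 (2 * Real.pi / n / 2) (half_pos H.angle_pos) (fun _ _ => convex_zono _ _ _ _)
    (fun _ _ => center_mem_interior_zono (H.crosses _).2.2.ne' _) ?_ ?_ ?_ ?_ ?_ ?_ ?_
  · intro M q hq
    unfold armIndex
    rcases lt_or_ge (q + 1) M with h | h
    · rw [if_pos (by omega), if_pos h]
      have := H.passes_cone (2 * (M - 1 : ℤ) + 1) (M - 1 - (q + 1)) (q + 1)
      rwa [show M - 1 - (q + 1) + 1 = M - 1 - q by omega] at this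
    rw [if_neg (not_lt.2 h)]
    rcases lt_or_ge q M with h2 | h2
    · obtain rfl : M = q + 1 := by omega
      rw [if_pos h2, if_pos (by omega)]
      dsimp only
      have := H.passes_odd (m := 2 * ((q + 1 : ℕ) - 1 : ℤ) + 1) (by simp) q
      convert this using 1
      · congr 1; omega
      · congr 1; omega
      · congr 1 <;> omega
      · congr 1 <;> omega
    rw [if_neg (not_lt.2 h2), if_pos hq]
    rcases lt_or_ge (q + 1) (2 * M) with h3 | h3
    · rw [if_pos h3]
      have := H.passes_cone (2 * M) (2 * M - 1 - (q + 1)) (q - M)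
      rwa [show 2 * M - 1 - (q + 1) + 1 = 2 * M - 1 - q by omega,
        show q - M + 1 = q + 1 - M by omega] at this
    · rw [if_neg (not_lt.2 h3)]
      have := H.passes_even (m := 2 * M) (by simp) (q - M)
      rw [show q - M + 1 = M by omega] at this
      rwa [show 2 * M - 1 - q = 0 by omega]
  · intro M
    rw [hlast, armIndex, if_pos (by omega)]
    have := H.passes_ring (m := 2 * M + 1) (by simp) M
    convert this using 1
    · congr 1
      push_cast; ring
    · congr 1
      push_cast; ring
  · intro R
    obtain ⟨M₀, hM₀⟩ := exists_nat_ge (2 * R / Real.sin (2 * Real.pi / n) + 1)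
    refine ⟨M₀, fun M q hM hq => ?_⟩
    have hq' : q ≤ 2 * M := hq
    obtain ⟨k1, k2⟩ := H.le_norm_center (armIndex M q).1 (armIndex M q).2.1 (armIndex M q).2.2
    have hs := H.sin_pos
    have hsum : M ≤ (armIndex M q).2.1 + (armIndex M q).2.2 + 1 := by
      unfold armIndex; split_ifs <;> simp only <;> omega
    have h1 : (M : ℝ) ≤ (armIndex M q).2.1 + (armIndex M q).2.2 + 1 := by exact_mod_cast hsum
    have h2 : 2 * R / Real.sin (2 * Real.pi / n) ≤
        (armIndex M q).2.1 + (armIndex M q).2.2 := by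
      have : (M₀ : ℝ) ≤ M := by exact_mod_cast hM
      linarith
    rw [div_le_iff₀ hs] at h2
    linarith
  · intro M S ρ hS hS1 hρ h
    rw [hlast, hlast] at h
    obtain ⟨ρ1, θ1, p1, e1, a1, b1⟩ := H.center_polar M M
    obtain ⟨ρ2, θ2, p2, e2, a2, b2⟩ := H.center_polar (M + 1 : ℕ) (M + 1)
    simp only at h
    rw [e1, e2] at h
    have h2 : (ρ2 : ℂ) * cis θ2 = (ρ * ρ1 : ℝ) * cis (S + θ1) := by
      rw [h, cis_add, show cis S = Complex.exp (S * Complex.I) from rfl]; push_cast; ring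
    obtain ⟨N, hN⟩ := cis_eq_cis p2 (mul_pos hρ p1) h2
    push_cast at a1 b1 a2 b2
    have hβ := H.three_mul_le
    have hβ2 := H.angle_pos
    have hπ := Real.pi_pos
    -- By `center_polar` the last directions of consecutive rings differ by more than half and less
    -- than three halves of a sector. The former exceeds `S`, the latter is less than a full turn,
    -- so no integer `N` fits.
    have n1 : (0 : ℝ) < N := by
      by_contra hneg
      have := mul_nonpos_of_nonpos_of_nonneg (not_lt.1 hneg) (by linarith : 0 ≤ 2 * Real.pi)
      linarith
    have n2 : (N : ℝ) < 1 := by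
      by_contra hneg
      have := mul_le_mul_of_nonneg_right (not_lt.1 hneg) (by linarith : 0 ≤ 2 * Real.pi)
      linarith
    have n1' : 0 < N := by exact_mod_cast n1
    have n2' : N < 1 := by exact_mod_cast n2
    omega
  · intro a M q _
    exact ⟨_, _, _, image_rot_spiralTile _ _ _ _⟩
  · rintro t ⟨m, i, j, rfl⟩
    obtain ⟨M, q, l, hq, h1, h2, h3⟩ : ∃ (M q : ℕ) (l : ℤ), q ≤ 2 * M ∧
        m = (armIndex M q).1 + 2 * l ∧ i = (armIndex M q).2.1 ∧ j = (armIndex M q).2.2 := by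
      obtain ⟨k, rfl | rfl⟩ := Int.even_or_odd' m
      · refine ⟨i + j + 1, i + 1 + 2 * j, k - (i + j + 1 : ℕ), by omega, ?_⟩
        rw [armIndex, if_neg (by omega), if_pos (by omega)]
        simp only
        omega
      · rcases Nat.eq_zero_or_pos j with rfl | hj
        · refine ⟨i, 2 * i, k - i, le_rfl, ?_⟩
          rw [hlast]; exact ⟨by ring, rfl, rfl⟩
        · refine ⟨i + j, j - 1, k - (i + j - 1 : ℤ), by omega, ?_⟩
          rw [armIndex, if_pos (by omega)]
          simp only
          omega
    have hn0 : (n : ℤ) ≠ 0 := by exact_mod_cast hn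
    have hl := Int.emod_nonneg l hn0
    have hl2 := Int.emod_lt_of_pos l (by exact_mod_cast Nat.pos_of_ne_zero hn : (0 : ℤ) < n)
    refine ⟨⟨(l % n).toNat, (Int.toNat_lt hl).2 hl2⟩, M, q, hq, ?_⟩
    rw [himg, h1, h2, h3]
    simp only [Int.toNat_of_nonneg hl]
    conv_lhs => rw [show (armIndex M q).1 + 2 * l =
      (armIndex M q).1 + 2 * (l % n) + 2 * (n * (l / n)) by linarith [Int.emod_add_mul_ediv l n]]
    rw [spiralTile_period hn]
  · intro a b M q M' q' hq hq' hd
    have hq₁ : q ≤ 2 * M := hq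
    have hq₂ : q' ≤ 2 * M' := hq'
    rw [himg, himg] at hd
    obtain ⟨⟨N, h1⟩, h2, h3⟩ := H.eq_of_not_disjoint hd
    -- The product is named so that it is an atom for linear arithmetic.
    obtain ⟨P, hP⟩ : ∃ P : ℤ, P = n * N := ⟨_, rfl⟩
    rw [← hP] at h1
    have hab : ((b : ℕ) : ℤ) = (a : ℕ) + n * N ∧ M = M' ∧ q = q' := by
      rw [← hP]
      unfold armIndex at h1 h2 h3
      split_ifs at h1 h2 h3 <;> simp only at h1 h2 h3 <;> omega
    refine ⟨Fin.ext ?_, hab.2⟩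
    have ha := a.2
    have hb := b.2
    have := hab.1
    have h4 : ((b : ℕ) : ℤ) % n = ((a : ℕ) : ℤ) % n := by rw [this, Int.add_mul_emod_self_left]
    rw [Int.emod_eq_of_lt (by omega) (by omega), Int.emod_eq_of_lt (by omega) (by omega)] at h4
    omega

end IsSpokeAngle
end

/-! ### The symmetries of the spiral tilings -/

section
variable {n : ℕ} {γ : ℝ}

namespace IsSpokeAngle

/-- Only the tiles based at the origin contain the origin. -/
lemma zero_mem (H : IsSpokeAngle n γ) {m : ℤ} {i j : ℕ} (h : (0 : ℂ) ∈ spiralTile n γ m i j) :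
    ¬Even m ∧ i = 0 ∧ j = 0 := by
  obtain ⟨h1, h2, h3⟩ := H.crosses m
  obtain ⟨s, t, r, hs, ht, hr, he⟩ := h
  have e1 := congrArg (cross (spoke n γ (m - 1))) he
  have e2 := congrArg (fun z => cross z (spoke n γ (m + 1))) he
  simp only [spiralBase, cross_add_right, cross_add_left, cross_natCast_right, cross_natCast_left,
    cross_ofReal_left, cross_ofReal_right, cross_self_eq_zero, cross_zero_right,
    cross_zero_left] at e1 e2
  have hs := hs.1
  have ht := ht.1
  have hr := hr.1
  have p1 : 0 ≤ t * cross (spoke n γ (m - 1)) (spoke n γ m) := by positivity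
  have p2 : 0 ≤ r * cross (spoke n γ (m - 1)) (spoke n γ (m + 1)) := by positivity
  have p3 : 0 ≤ ((if Even m then 1 else 0 : ℕ) : ℝ) *
    cross (spoke n γ (m - 1)) (spoke n γ m) := by positivity
  have p4 : 0 ≤ (i : ℝ) * (0 + cross (spoke n γ (m - 1)) (spoke n γ m)) := by positivity
  have p5 : 0 ≤ (j : ℝ) * (cross (spoke n γ (m - 1)) (spoke n γ (m + 1)) +
    cross (spoke n γ (m - 1)) (spoke n γ m)) := by positivity
  refine ⟨fun hm => ?_, ?_, ?_⟩
  · rw [if_pos hm] at e1 p3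
    push_cast at e1
    linarith
  · have : (i : ℝ) * (0 + cross (spoke n γ (m - 1)) (spoke n γ m)) = 0 := by linarith
    rcases mul_eq_zero.1 this with h | h
    · exact_mod_cast h
    · linarith
  · have : (j : ℝ) * (cross (spoke n γ (m - 1)) (spoke n γ (m + 1)) +
      cross (spoke n γ (m - 1)) (spoke n γ m)) = 0 := by linarith
    rcases mul_eq_zero.1 this with h | h
    · exact_mod_cast h
    · linarith

/-- The ends of the long diagonals of the tiles of a cone lie in the cone. -/
lemma corner_polar (H : IsSpokeAngle n γ) {m : ℤ} {i j κ : ℕ} {x : ℂ} (hx : x ≠ 0)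
    (h : x = spiralBase n γ m i j + κ * spiralDiag n γ m) : ∃ ρ θ : ℝ, 0 < ρ ∧ x = ρ * cis θ ∧
      (m * (2 * Real.pi / n) + (γ - 2 * Real.pi / n)) / 2 ≤ θ ∧
      θ ≤ ((m + 1 : ℤ) * (2 * Real.pi / n) + (γ - 2 * Real.pi / n)) / 2 ∧
      (Even m → θ < ((m + 1 : ℤ) * (2 * Real.pi / n) + (γ - 2 * Real.pi / n)) / 2 ∧
        (m * (2 * Real.pi / n) + (γ - 2 * Real.pi / n)) / 2 < θ) := by
  obtain ⟨h1, h2, h3⟩ := H.crosses m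
  have c1 := spoke_pred_add_spoke (n := n) (γ := γ) m
  have c2 := spoke_pred_add_spoke (n := n) (γ := γ) (m + 1)
  have d1 := H.cos_pos m
  have d2 := H.cos_pos (m + 1)
  rw [add_sub_cancel_right] at c2 d2
  have hβ := H.angle_pos
  have k1 : cross (spoke n γ (m - 1) + spoke n γ m) x =
      (if Even m then 1 else 0 : ℕ) * cross (spoke n γ (m - 1)) (spoke n γ m) +
      j * (cross (spoke n γ (m - 1)) (spoke n γ m) + cross (spoke n γ (m - 1)) (spoke n γ (m + 1)) +
        cross (spoke n γ m) (spoke n γ (m + 1))) +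
      κ * (cross (spoke n γ (m - 1)) (spoke n γ (m + 1)) +
        cross (spoke n γ m) (spoke n γ (m + 1))) := by
    rw [h, spiralBase, spiralDiag]
    simp only [cross_add_right, cross_add_left, cross_natCast_right, cross_self_eq_zero]
    ring
  have k2 : cross x (spoke n γ m + spoke n γ (m + 1)) =
      (if Even m then 1 else 0 : ℕ) * cross (spoke n γ m) (spoke n γ (m + 1)) +
      i * (cross (spoke n γ (m - 1)) (spoke n γ m) + cross (spoke n γ (m - 1)) (spoke n γ (m + 1)) +
        cross (spoke n γ m) (spoke n γ (m + 1))) +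
      κ * (cross (spoke n γ (m - 1)) (spoke n γ (m + 1)) +
        cross (spoke n γ (m - 1)) (spoke n γ m)) := by
    rw [h, spiralBase, spiralDiag]
    simp only [cross_add_right, cross_add_left, cross_natCast_left, cross_self_eq_zero,
      cross_swap (spoke n γ (m + 1)) (spoke n γ m)]
    ring
  have k1n : 0 ≤ cross (spoke n γ (m - 1) + spoke n γ m) x := by rw [k1]; positivity
  have k2n : 0 ≤ cross x (spoke n γ m + spoke n γ (m + 1)) := by rw [k2]; positivity
  have k1p : Even m → 0 < cross (spoke n γ (m - 1) + spoke n γ m) x := by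
    intro hm; rw [k1, if_pos hm]; push_cast; positivity
  have k2p : Even m → 0 < cross x (spoke n γ m + spoke n γ (m + 1)) := by
    intro hm; rw [k2, if_pos hm]; push_cast; positivity
  rw [c1, cross_ofReal_left] at k1n k1p
  rw [c2, cross_ofReal_right] at k2n k2p
  obtain ⟨ρ, θ, h4, h5, h6, h7, h8, h9⟩ := exists_polar_sector (z := x)
    (by push_cast; linarith) hx (nonneg_of_mul_nonneg_right k1n d1)
    (nonneg_of_mul_nonneg_right k2n d2)
  exact ⟨ρ, θ, h4, h5, h6, h7, fun hm =>
    ⟨h9 (pos_of_mul_pos_right (k2p hm) d2.le), h8 (pos_of_mul_pos_right (k1p hm) d1.le)⟩⟩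

/-- A point other than the origin is the base, or the top, of at most one tile. -/
lemma eq_of_corner (H : IsSpokeAngle n γ) {m m' : ℤ} {i j i' j' κ : ℕ} {x : ℂ} (hx : x ≠ 0)
    (h : x = spiralBase n γ m i j + κ * spiralDiag n γ m)
    (h' : x = spiralBase n γ m' i' j' + κ * spiralDiag n γ m') :
    spiralTile n γ m i j = spiralTile n γ m' i' j' := by
  have hn : n ≠ 0 := by have := H.three_le; omega
  obtain ⟨ρ, θ, hρ, e, h1, h2, h3⟩ := H.corner_polar hx h
  obtain ⟨ρ', θ', hρ', e', h1', h2', h3'⟩ := H.corner_polar hx h'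
  obtain ⟨N, hN⟩ := cis_eq_cis hρ hρ' (e.symm.trans e')
  have hβ := H.angle_pos
  obtain ⟨l, hl⟩ : ∃ l, l = m' + 2 * (n * N) := ⟨_, rfl⟩
  have hl2 : (l : ℝ) * (2 * Real.pi / n) = m' * (2 * Real.pi / n) + 2 * (N * (2 * Real.pi)) := by
    rw [hl]; push_cast; linear_combination 2 * (N : ℝ) * H.n_mul
  have hev : Even l ↔ Even m' := by rw [hl]; simp [Int.even_add]
  push_cast at h1 h2 h3 h1' h2' h3'
  have a1 : l ≤ m + 1 := by
    have : (l : ℝ) * (2 * Real.pi / n) ≤ (m + 1) * (2 * Real.pi / n) := by linarith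
    exact_mod_cast le_of_mul_le_mul_right this hβ
  have a2 : m ≤ l + 1 := by
    have : (m : ℝ) * (2 * Real.pi / n) ≤ (l + 1) * (2 * Real.pi / n) := by linarith
    exact_mod_cast le_of_mul_le_mul_right this hβ
  -- Corners of odd cones lie in the closed cone, those of even cones strictly inside. Adjacent
  -- cones have opposite parity, so a common direction is impossible.
  have hlm : l = m := by
    rcases (by omega : l = m + 1 ∨ m = l + 1 ∨ l = m) with h0 | h0 | h0
    · exfalso
      have h0' : (l : ℝ) = m + 1 := by exact_mod_cast h0
      rw [h0'] at hl2
      by_cases hm : Even m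
      · have := (h3 hm).1; linarith
      · have : Even m' := by rw [← hev, h0]; simpa [Int.even_add_one] using hm
        have := (h3' this).2; linarith
    · exfalso
      have h0' : (m : ℝ) = l + 1 := by exact_mod_cast h0
      rw [h0'] at h1 h3
      by_cases hm : Even m
      · have := (h3 hm).2; linarith
      · have : Even m' := by
          rw [← hev]; rw [h0] at hm; simpa [Int.even_add_one] using hm
        have := (h3' this).1; linarith
    · exact h0
  have hbase : spiralBase n γ l i' j' = spiralBase n γ m' i' j' := by
    rw [hl, spiralBase_add, rot_mul_self hn, one_mul]
  have hdiag : spiralDiag n γ l = spiralDiag n γ m' := by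
    rw [hl, spiralDiag_add, rot_mul_self hn, one_mul]
  rw [← spiralTile_period hn m' N, ← hl, hlm]
  rw [← hbase, ← hdiag, hlm, h] at h'
  have h6 := add_right_cancel h'
  rw [spiralTile, spiralTile, h6]

/-- If the ends of the long diagonals can be recognised metrically then all symmetries fix the
origin. -/
lemma fixes_zero (H : IsSpokeAngle n γ) {P : Set ℂ → ℂ → Prop}
    (hinv : ∀ (g : ℂ ≃ᵢ ℂ) (t : Set ℂ) (x : ℂ), P t x → P (g '' t) (g x))
    (hP : ∀ x, P (spiralTile n γ 1 0 0) x ↔ x = 0 ∨ x = spiralDiag n γ 1)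
    {g : ℂ ≃ᵢ ℂ} (hg : g ∈ symmetries (spiralTiles n γ)) : g 0 = 0 := by
  by_contra hx
  -- For every tile at the origin, the image of the origin is the base (`κ = 0`) or the top (`κ =
  -- 1`) of the image tile. Three such tiles would need three distinct values of `κ`, by
  -- `eq_of_corner`.
  have key : ∀ k : ℕ, ∃ (m : ℤ) (i j κ : ℕ), κ < 2 ∧
      g '' spiralTile n γ (1 + 2 * k) 0 0 = spiralTile n γ m i j ∧
      g 0 = spiralBase n γ m i j + κ * spiralDiag n γ m := by
    intro k
    obtain ⟨m, i, j, ht⟩ := image_mem_of_mem_symmetries hg ⟨1 + 2 * (k : ℤ), 0, 0, rfl⟩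
    obtain ⟨f, hf1, hf2, -⟩ := exists_isometry_spiralTile (n := n) (γ := γ) (1 + 2 * (k : ℤ)) 0 0
    obtain ⟨f', hf1', hf2', hf3'⟩ := exists_isometry_spiralTile (n := n) (γ := γ) m i j
    have hb : spiralBase n γ (1 + 2 * (k : ℤ)) 0 0 = 0 := by
      rw [spiralBase, if_neg (by simp [Int.even_add])]; simp
    have h1 := hinv g _ _ (hinv f _ _ ((hP 0).2 (Or.inl rfl)))
    rw [← hf1, hf2, hb, ht, hf1'] at h1
    have h2 := hinv f'.symm _ _ h1
    rw [image_image] at h2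
    simp only [IsometryEquiv.symm_apply_apply, image_id'] at h2
    rcases (hP _).1 h2 with h3 | h3
    · refine ⟨m, i, j, 0, by norm_num, ht, ?_⟩
      have := congrArg f' h3
      rw [f'.apply_symm_apply] at this
      rw [Nat.cast_zero, zero_mul, add_zero, ← hf2', this]
    · refine ⟨m, i, j, 1, by norm_num, ht, ?_⟩
      have := congrArg f' h3
      rw [f'.apply_symm_apply] at this
      rw [Nat.cast_one, one_mul, ← hf3', this]
  choose m i j κ h1 h2 h3 using key
  have no : ∀ k l : ℕ, k < l → l < 3 → κ k ≠ κ l := by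
    intro k l hkl hl hκ
    have e := h3 l
    rw [← hκ] at e
    have e2 := H.eq_of_corner hx (h3 k) e
    rw [← h2, ← h2] at e2
    have e3 := g.injective.image_injective e2
    have e4 : ¬Disjoint (interior (spiralTile n γ (1 + 2 * k) 0 0))
        (interior (spiralTile n γ (1 + 2 * l) 0 0)) := by
      rw [← e3, disjoint_self]
      exact Set.Nonempty.ne_empty ⟨_, center_mem_interior_zono (H.crosses _).2.2.ne' _⟩
    obtain ⟨⟨N, hN⟩, -⟩ := H.eq_of_not_disjoint e4
    have hN' : (l : ℤ) - k = n * N := by omega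
    have h3n := H.three_le
    have : 0 < (n : ℤ) * N := by omega
    have hN0 : 0 < N := pos_of_mul_pos_right this (by omega)
    nlinarith
  have n1 := no 0 1 (by norm_num) (by norm_num)
  have n2 := no 0 2 (by norm_num) (by norm_num)
  have n3 := no 1 2 (by norm_num) (by norm_num)
  have := h1 0
  have := h1 1
  have := h1 2
  omega

/-- The symmetries that fix the origin. -/
lemma fixing_symmetry (H : IsSpokeAngle n γ) {g : ℂ ≃ᵢ ℂ} (hg : g ∈ symmetries (spiralTiles n γ))
    (h0 : g 0 = 0) : ∃ k : ℤ, (∀ z, g z = rot n k * z) ∨ ∃ κ : ℂ, ‖κ‖ = 1 ∧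
      (∀ z, g z = κ * starRingEnd ℂ z) ∧
      κ * starRingEnd ℂ (spiralDiag n γ 1) = rot n k * spiralDiag n γ 1 ∧
      g '' spiralTile n γ 1 0 0 = (fun z => rot n k * z) '' spiralTile n γ 1 0 0 := by
  have hb : spiralBase n γ 1 0 0 = 0 := by simp [spiralBase]
  obtain ⟨m, i, j, ht⟩ := image_mem_of_mem_symmetries hg ⟨1, 0, 0, rfl⟩
  have hz : (0 : ℂ) ∈ spiralTile n γ m i j := by
    rw [← ht, ← h0, spiralTile, hb]
    exact mem_image_of_mem g (base_mem_zono _ _ _ _)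
  -- The image tile contains the origin, so it is a rotated copy of the first tile. Comparing
  -- centres gives the action on the long diagonal, which determines a direct isometry.
  obtain ⟨hm, rfl, rfl⟩ := H.zero_mem hz
  obtain ⟨k, rfl⟩ : ∃ k, m = 1 + 2 * k := by
    obtain ⟨k, hk⟩ := Int.not_even_iff_odd.1 hm
    exact ⟨k, by omega⟩
  have hb' : spiralBase n γ (1 + 2 * k) 0 0 = 0 := by rw [spiralBase_add, hb, mul_zero]
  have hc := isometry_center ht
  rw [hb, hb', zero_add, zero_add] at hc
  change g (spiralDiag n γ 1 / 2) = spiralDiag n γ (1 + 2 * k) / 2 at hc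
  rw [spiralDiag_add] at hc
  have hd : spiralDiag n γ 1 ≠ 0 := by
    have h1 := H.crosses 1
    apply ne_zero_of_cross_ne_zero (q := spoke n γ (1 + 1))
    rw [spiralDiag, cross_add_left, cross_add_left, cross_self_eq_zero]
    linarith
  refine ⟨k, ?_⟩
  obtain ⟨κ, hκ, h | h⟩ := isometry_form g
  · left
    rw [h, h0] at hc
    have : κ = rot n k := by
      apply mul_right_cancel₀ hd; linear_combination 2 * hc
    intro z; rw [h, h0, this, add_zero]
  · right
    refine ⟨κ, hκ, fun z => by rw [h, h0, add_zero], ?_, by rw [ht, image_rot_spiralTile]⟩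
    rw [h, h0, map_div₀, map_ofNat] at hc
    linear_combination 2 * hc

end IsSpokeAngle

lemma rot_spiralTiles (k : ℤ) {t : Set ℂ} (ht : t ∈ spiralTiles n γ) :
    (fun z => rot n k * z) '' t ∈ spiralTiles n γ := by
  obtain ⟨m, i, j, rfl⟩ := ht
  exact ⟨_, _, _, image_rot_spiralTile _ _ _ _⟩

lemma cyclicAt_subset_spiral : cyclicAt n 0 ⊆ symmetries (spiralTiles n γ) := by
  rintro g ⟨k, hk⟩
  exact rotIso_mem_symmetries (n := n) (fun k t ht => rot_spiralTiles k ht) k (fun z => by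
    rw [hk]; ring)

/-- The spiral tiling is chiral if the spokes do not bisect each other. -/
lemma IsSpokeAngle.isCyclicAbout (H : IsSpokeAngle n γ)
    (hγ : Real.sin γ < Real.sin (2 * Real.pi / n - γ)) :
    IsCyclicAbout (spiralTiles n γ) n 0 := by
  ext g; constructor
  · rintro ⟨hg, h0⟩
    obtain ⟨k, h | ⟨κ, hκ, h1, h2, h3⟩⟩ := H.fixing_symmetry hg h0
    · exact ⟨k, fun z => by rw [h]; ring⟩
    exfalso
    have hrr : rot n (-k) * rot n k = 1 := by rw [← rot_add, neg_add_cancel, rot_zero]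
    have hβ := H.angle_pos
    have hβ3 := H.three_mul_le
    have hπ := Real.pi_pos
    obtain ⟨c1, c2, c3⟩ := H.crosses 1
    have e1 : cross (spoke n γ 0) (spoke n γ 1) = Real.sin γ := by
      rw [spoke_one, spoke_zero, ← cis_zero, cross_cis, sub_zero]
    have e2 : cross (spoke n γ 1) (spoke n γ 2) = Real.sin (2 * Real.pi / n - γ) := by
      rw [spoke_one, spoke_two, cross_cis]
    rw [show (1 : ℤ) - 1 = 0 by rfl] at c1 c3
    rw [show (1 : ℤ) + 1 = 2 by rfl] at c2 c3
    have hdiag : spiralDiag n γ 1 = spoke n γ 0 + spoke n γ 1 + spoke n γ 2 := rfl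
    refine not_reflection (a := spoke n γ 0) (b := spoke n γ 1) (c := spoke n γ 2)
      (κ := rot n (-k) * κ) (norm_spoke _) ?_ ?_ (by rw [norm_mul, rot_norm, hκ, one_mul]) ?_ ?_
    · intro h
      have h4 := norm_sq_combination 1 1 0 (spoke n γ 0) (spoke n γ 1) 0
      simp only [Complex.ofReal_one, Complex.ofReal_zero, one_mul, zero_mul, add_zero, h,
        norm_spoke] at h4
      have h5 : dot (spoke n γ 0) (spoke n γ 1) = Real.cos γ := by
        rw [spoke_one, spoke_zero, ← cis_zero, dot_cis, sub_zero]
      have h6 : 0 < Real.cos γ := by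
        -- If `γ ≥ π/2`, then `2π/n - γ ≤ π - γ ≤ π/2`, and monotonicity of the sine would
        -- contradict `hγ`.
        apply Real.cos_pos_of_mem_Ioo ⟨by linarith [H.pos], ?_⟩
        by_contra hge
        have : Real.sin (2 * Real.pi / n - γ) ≤ Real.sin γ := by
          rw [← Real.sin_pi_sub γ]
          exact Real.sin_le_sin_of_le_of_le_pi_div_two (by linarith [H.lt]) (by linarith)
            (by linarith)
        linarith
      norm_num [h5] at h4
      linarith
    · simp only [cross_add_left, cross_self_eq_zero]
      rw [cross_swap (spoke n γ 1) (spoke n γ 0), cross_swap (spoke n γ 2) (spoke n γ 0),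
        cross_swap (spoke n γ 2) (spoke n γ 1)]
      exact mul_pos_of_neg_of_neg (by linarith) (by linarith)
    · rw [← hdiag, mul_assoc, h2, ← mul_assoc, hrr, one_mul]
    · have hmem : g (spoke n γ 0 + spoke n γ 1) ∈ g '' spiralTile n γ 1 0 0 := by
        apply mem_image_of_mem
        exact mk_mem_zono 1 1 0 (by simp) (by simp) (by simp) (by simp [spiralBase])
      rw [h3, h1] at hmem
      obtain ⟨y, hy, he⟩ := hmem
      dsimp only at he
      rw [mul_assoc, ← he, ← mul_assoc, hrr, one_mul]
      have : spiralBase n γ 1 0 0 = 0 := by simp [spiralBase]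
      rwa [spiralTile, this] at hy
  · intro hg
    exact ⟨cyclicAt_subset_spiral hg, cyclicAt_fix hg⟩

end

/-! #### The symmetric case -/

section
variable {n : ℕ}

/-- With `γ` half a sector the spokes are equally spaced, so the reflection in spoke 0 permutes
them. -/
lemma conj_spoke (m : ℤ) : starRingEnd ℂ (spoke n (2 * Real.pi / n / 2) m) =
    spoke n (2 * Real.pi / n / 2) (-m) := by
  have : ∀ m : ℤ, spokeAngle n (2 * Real.pi / n / 2) m = m * (2 * Real.pi / n / 2) := by
    intro m
    obtain ⟨k, rfl | rfl⟩ := Int.even_or_odd' m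
    · rw [spokeAngle_even]; push_cast; ring
    · rw [spokeAngle_odd]; push_cast; ring
  rw [spoke, spoke, conj_cis, this, this]; push_cast; congr 1; ring

lemma conj_image_spiralTile {g : ℂ → ℂ} {k : ℤ} (hg : ∀ z, g z = rot n k * starRingEnd ℂ z)
    (m : ℤ) (i j : ℕ) : g '' spiralTile n (2 * Real.pi / n / 2) m i j =
      spiralTile n (2 * Real.pi / n / 2) (-m + 2 * k) j i := by
  rw [spiralTile, zono_image_refl (k := rot n k) (w := 0) (by simpa using hg), ← zono_rev,
    ← image_rot_spiralTile, spiralTile, zono_image_rot (k := rot n k) (w := 0) (by simp), hg]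
  simp only [spiralBase, map_add, map_mul, map_natCast, conj_spoke, even_neg]
  rw [show -(m - 1) = -m + 1 by ring, show -(m + 1) = -m - 1 by ring]
  congr 1; ring

lemma IsSpokeAngle.isDihedralAbout (H : IsSpokeAngle n (2 * Real.pi / n / 2)) :
    IsDihedralAbout (spiralTiles n (2 * Real.pi / n / 2)) n 0 1 := by
  ext g; constructor
  · rintro ⟨hg, h0⟩
    obtain ⟨k, h | ⟨κ, -, h1, h2, -⟩⟩ := H.fixing_symmetry hg h0
    · exact Or.inl ⟨k, fun z => by rw [h]; ring⟩
    · right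
      -- The long diagonal points along `cis (π / n)`, not along the axis direction 1; reflecting it
      -- contributes twice that angle, one extra rotation step.
      refine ⟨k + 1, fun z => ?_⟩
      have hd : spiralDiag n (2 * Real.pi / n / 2) 1 =
          (2 * Real.cos ((2 * Real.pi / n - 0) / 2) + 1 : ℝ) * cis (2 * Real.pi / n / 2) := by
        have e : spiralDiag n (2 * Real.pi / n / 2) 1 = cis 0 + cis (2 * Real.pi / n / 2) +
            cis (2 * Real.pi / n) := by
          rw [cis_zero, ← spoke_zero (n := n) (γ := 2 * Real.pi / n / 2),
            ← spoke_two (n := n) (γ := 2 * Real.pi / n / 2),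
            ← spoke_one (n := n) (γ := 2 * Real.pi / n / 2)]
          rfl
        rw [e, add_right_comm, cis_add_cis, zero_add]; push_cast; ring
      have hβ := H.angle_pos
      have hβ3 := H.three_mul_le
      have hπ := Real.pi_pos
      have hc : 0 < 2 * Real.cos ((2 * Real.pi / n - 0) / 2) + 1 := by
        have : 0 < Real.cos ((2 * Real.pi / n - 0) / 2) :=
          Real.cos_pos_of_mem_Ioo ⟨by linarith, by linarith⟩
        linarith
      rw [hd, map_mul, Complex.conj_ofReal, conj_cis] at h2
      have h3 : κ * cis (-(2 * Real.pi / n / 2)) = rot n k * cis (2 * Real.pi / n / 2) := by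
        apply mul_left_cancel₀ (show ((2 * Real.cos ((2 * Real.pi / n - 0) / 2) + 1 : ℝ) : ℂ) ≠ 0 by
          exact_mod_cast hc.ne')
        linear_combination h2
      have h4 : κ = rot n (k + 1) := by
        have h5 : κ = κ * cis (-(2 * Real.pi / n / 2)) * cis (2 * Real.pi / n / 2) := by
          rw [mul_assoc, ← cis_add, neg_add_cancel, cis_zero, mul_one]
        rw [h5, h3, mul_assoc, ← cis_add, rot_add, rot_eq_cis 1]
        congr 2; push_cast; ring
      rw [h1, h4]; simp
  · rintro (hg | ⟨k, hk⟩)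
    · exact ⟨cyclicAt_subset_spiral hg, cyclicAt_fix hg⟩
    · have hk' : ∀ z, g z = rot n k * starRingEnd ℂ z := fun z => by rw [hk]; simp
      refine ⟨involution_mem_symmetries ?_ ?_, by rw [hk']; simp⟩
      · rintro t ⟨m, i, j, rfl⟩
        exact ⟨_, _, _, conj_image_spiralTile hk' m i j⟩
      · intro z
        rw [hk', hk', map_mul, Complex.conj_conj, ← mul_assoc, Complex.mul_conj,
          Complex.normSq_eq_norm_sq, rot_norm]
        simp
end

/-! #### Recognising the long diagonals -/

/-- This makes the area spanned by a point and a diameter, hence the distance from the diameter,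
usable as an isometry-invariant predicate. -/
lemma abs_cross_isometry (g : ℂ ≃ᵢ ℂ) (p q x : ℂ) :
    |cross (g q - g p) (g x - g p)| = |cross (q - p) (x - p)| := by
  obtain ⟨k, hk, h | h⟩ := isometry_form g
  · rw [h q, h p, h x, show k * q + g 0 - (k * p + g 0) = k * (q - p) by ring,
      show k * x + g 0 - (k * p + g 0) = k * (x - p) by ring, cross_mul_left, hk]
    simp
  · rw [h q, h p, h x, show k * starRingEnd ℂ q + g 0 - (k * starRingEnd ℂ p + g 0) =
        k * starRingEnd ℂ (q - p) by rw [map_sub]; ring,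
      show k * starRingEnd ℂ x + g 0 - (k * starRingEnd ℂ p + g 0) =
        k * starRingEnd ℂ (x - p) by rw [map_sub]; ring, cross_mul_left, cross_conj, hk]
    simp

section
variable {n : ℕ} {γ : ℝ}

lemma spiralTile_one : spiralTile n γ 1 0 0 = zono 0 (spoke n γ 0) (spoke n γ 1) (spoke n γ 2) := by
  rw [spiralTile]; congr 1; simp [spiralBase]

lemma dot_spoke : dot (spoke n γ 0) (spoke n γ 1) = Real.cos γ ∧
    dot (spoke n γ 1) (spoke n γ 2) = Real.cos (2 * Real.pi / n - γ) ∧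
    dot (spoke n γ 0) (spoke n γ 2) = Real.cos (2 * Real.pi / n) := by
  rw [spoke_zero, spoke_one, spoke_two, ← cis_zero, dot_cis, dot_cis, dot_cis, sub_zero, sub_zero]
  exact ⟨rfl, rfl, rfl⟩

namespace IsSpokeAngle

/-- If the long diagonal of the tiles is their diameter then all symmetries fix the origin. -/
lemma fixes_zero_of_diameter (H : IsSpokeAngle n γ) (hn : 4 ≤ n) {g : ℂ ≃ᵢ ℂ}
    (hg : g ∈ symmetries (spiralTiles n γ)) : g 0 = 0 := by
  have hβ : 2 * Real.pi / n ≤ Real.pi / 2 := by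
    have : (4 : ℝ) ≤ n := by exact_mod_cast hn
    rw [div_le_iff₀ (by linarith)]
    nlinarith [Real.pi_pos]
  have hπ := Real.pi_pos
  have hp := H.pos
  have hl := H.lt
  obtain ⟨d1, d2, d3⟩ := dot_spoke (n := n) (γ := γ)
  have hA : IsAcute (spoke n γ 0) (spoke n γ 1) (spoke n γ 2) :=
    ⟨norm_spoke _, norm_spoke _, norm_spoke _,
      d1 ▸ Real.cos_pos_of_mem_Ioo ⟨by linarith, by linarith⟩,
      d2 ▸ Real.cos_pos_of_mem_Ioo ⟨by linarith, by linarith⟩,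
      d3 ▸ Real.cos_nonneg_of_mem_Icc ⟨by linarith, by linarith⟩⟩
  -- The ends of the long diagonal are recognised as the points of the tile having a partner at the
  -- distance of the diameter.
  refine H.fixes_zero (P := fun t x => x ∈ t ∧ ∃ y ∈ t, ‖spiralDiag n γ 1‖ ≤ dist x y) ?_ ?_ hg
  · rintro g t x ⟨hx, y, hy, hxy⟩
    exact ⟨mem_image_of_mem g hx, g y, mem_image_of_mem g hy, by rwa [g.isometry.dist_eq]⟩
  · intro x
    have hd : spiralDiag n γ 1 = spoke n γ 0 + spoke n γ 1 + spoke n γ 2 := rfl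
    rw [spiralTile_one, hd]
    have hb := base_mem_zono 0 (spoke n γ 0) (spoke n γ 1) (spoke n γ 2)
    have ht := top_mem_zono 0 (spoke n γ 0) (spoke n γ 1) (spoke n γ 2)
    rw [zero_add] at ht
    constructor
    · rintro ⟨hx, y, hy, hxy⟩
      rcases hA.diameter hx hy hxy with ⟨h, -⟩ | ⟨h, -⟩
      · exact Or.inl h
      · exact Or.inr (by rw [h, zero_add])
    · rintro (rfl | rfl)
      · exact ⟨hb, _, ht, by rw [dist_zero_left]⟩
      · exact ⟨ht, _, hb, by rw [dist_zero_right]⟩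

/-- If another diagonal of the tiles is their diameter and the ends of the long diagonals are the
points furthest from it then all symmetries fix the origin. -/
lemma fixes_zero_of_width (H : IsSpokeAngle n γ)
    (hA : IsAcute (spoke n γ 1) (spoke n γ 0) (-spoke n γ 2))
    (hc : cross (spoke n γ 0) (spoke n γ 1) < cross (spoke n γ 0) (spoke n γ 2)) {g : ℂ ≃ᵢ ℂ}
    (hg : g ∈ symmetries (spiralTiles n γ)) : g 0 = 0 := by
  obtain ⟨h1, h2, h3⟩ := H.crosses 1
  rw [show (1 : ℤ) - 1 = 0 by rfl] at h1 h3
  rw [show (1 : ℤ) + 1 = 2 by rfl] at h2 h3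
  have hd : spiralDiag n γ 1 = spoke n γ 0 + spoke n γ 1 + spoke n γ 2 := rfl
  set a := spoke n γ 0
  set b := spoke n γ 1
  set c := spoke n γ 2
  refine H.fixes_zero (P := fun t x => x ∈ t ∧ ∃ p ∈ t, ∃ q ∈ t, ‖b + a + -c‖ ≤ dist p q ∧
    cross a c + cross b c ≤ |cross (q - p) (x - p)|) ?_ ?_ hg
  · rintro g t x ⟨hx, p, hp, q, hq, hpq, h⟩
    exact ⟨mem_image_of_mem g hx, g p, mem_image_of_mem g hp, g q, mem_image_of_mem g hq,
      by rwa [g.isometry.dist_eq], by rwa [abs_cross_isometry]⟩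
  · intro x
    rw [spiralTile_one, hd]
    have hz : zono 0 a b c = zono (0 + c) b a (-c) := by
      rw [zono_rotate _ (-c) b a, zono_neg, zono_rev]
    have hcm : c ∈ zono 0 a b c := mk_mem_zono 0 0 1 (by simp) (by simp) (by simp) (by simp)
    have habm : a + b ∈ zono 0 a b c := mk_mem_zono 1 1 0 (by simp) (by simp) (by simp) (by simp)
    have hdist : dist c (a + b) = ‖b + a + -c‖ := by
      rw [dist_comm, dist_eq_norm]; congr 1; ring
    constructor
    · rintro ⟨⟨s, t, r, hs, ht, hr, rfl⟩, p, hp, q, hq, hpq, h⟩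
      have hcr : |cross (a + b - c) (0 + s * a + t * b + r * c - c)| =
          |cross (q - p) (0 + s * a + t * b + r * c - p)| := by
        rw [hz] at hp hq
        rcases hA.diameter hp hq hpq with ⟨rfl, rfl⟩ | ⟨rfl, rfl⟩
        · congr 2 <;> ring
        · rw [show 0 + c - (0 + c + (b + a + -c)) = -(a + b - c) by ring,
            show 0 + s * a + t * b + r * c - (0 + c + (b + a + -c)) =
              (0 + s * a + t * b + r * c - c) - (a + b - c) by ring,
            cross_neg_left, cross_sub_right (a + b - c) _ (a + b - c), cross_self_eq_zero,
            sub_zero, abs_neg]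
      rw [← hcr] at h
      simp only [cross_sub_left, cross_add_left, cross_sub_right, cross_add_right,
        cross_ofReal_right, cross_self_eq_zero, cross_zero_right, cross_swap b a, cross_swap c a,
        cross_swap c b] at h
      -- The signed area relative to the diagonal from `c` to `a + b` is strictly increasing in each
      -- of `s, t, r` and ranges symmetrically about 0. Its extremes are attained only at the two
      -- ends of the long diagonal.
      have e1 : 0 ≤ s * (cross a c - cross a b) := mul_nonneg hs.1 (by linarith)
      have e2 : 0 ≤ t * (cross a b + cross b c) := mul_nonneg ht.1 (by linarith)
      have e3 : 0 ≤ r * (cross a c + cross b c) := mul_nonneg hr.1 (by linarith)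
      have e4 : 0 ≤ (1 - s) * (cross a c - cross a b) :=
        mul_nonneg (by linarith [hs.2]) (by linarith)
      have e5 : 0 ≤ (1 - t) * (cross a b + cross b c) :=
        mul_nonneg (by linarith [ht.2]) (by linarith)
      have e6 : 0 ≤ (1 - r) * (cross a c + cross b c) :=
        mul_nonneg (by linarith [hr.2]) (by linarith)
      rcases le_abs.1 h with h | h
      · right
        have f1 : (1 - s) * (cross a c - cross a b) = 0 := by linarith
        have f2 : (1 - t) * (cross a b + cross b c) = 0 := by linarith
        have f3 : (1 - r) * (cross a c + cross b c) = 0 := by linarith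
        have g1 := (mul_eq_zero.1 f1).resolve_right (by linarith)
        have g2 := (mul_eq_zero.1 f2).resolve_right (by linarith)
        have g3 := (mul_eq_zero.1 f3).resolve_right (by linarith)
        rw [show s = 1 by linarith, show t = 1 by linarith, show r = 1 by linarith]
        push_cast; ring
      · left
        have f1 : s * (cross a c - cross a b) = 0 := by linarith
        have f2 : t * (cross a b + cross b c) = 0 := by linarith
        have f3 : r * (cross a c + cross b c) = 0 := by linarith
        rw [(mul_eq_zero.1 f1).resolve_right (by linarith),
          (mul_eq_zero.1 f2).resolve_right (by linarith),
          (mul_eq_zero.1 f3).resolve_right (by linarith)]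
        push_cast; ring
    · have e : ∀ y, y = 0 ∨ y = a + b + c →
          cross a c + cross b c ≤ |cross (a + b - c) (y - c)| := by
        rintro y (rfl | rfl)
        · rw [← abs_neg]
          refine le_trans (le_of_eq ?_) (le_abs_self _)
          simp only [cross_sub_left, cross_add_left, cross_sub_right, cross_self_eq_zero,
            cross_zero_right]
          ring
        · refine le_trans (le_of_eq ?_) (le_abs_self _)
          simp only [cross_sub_left, cross_add_left, cross_sub_right, cross_add_right,
            cross_self_eq_zero, cross_swap b a, cross_swap c a, cross_swap c b]
          ring
      intro hx
      refine ⟨?_, c, hcm, a + b, habm, hdist.ge, e x hx⟩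
      rcases hx with rfl | rfl
      · exact base_mem_zono _ _ _ _
      · simpa using top_mem_zono 0 a b c

end IsSpokeAngle

/-! ### Full symmetry groups and the assembly of the cases -/

lemma symmetries_eq_of_fixes {T : Set (Set ℂ)} {G : Set (ℂ ≃ᵢ ℂ)} {p : ℂ}
    (hG : {g ∈ symmetries T | g p = p} = G) (h : ∀ g ∈ symmetries T, g p = p) :
    symmetries T = G := by
  rw [← hG]
  exact Subset.antisymm (fun g hg => ⟨hg, h g hg⟩) (fun g hg => hg.1)

lemma essentiallyIn_of_subset {T : Set (Set ℂ)} {G : Set (ℂ ≃ᵢ ℂ)} (h : symmetries T ⊆ G) :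
    EssentiallyIn T G :=
  fun g hg => ⟨g, h hg, 0, fun z => by rw [add_zero]⟩

end

/-- The chiral spiral tilings with at least three arms. -/
lemma cyclic_of_three_le {n : ℕ} (hn : 3 ≤ n) :
    ∃ (H : Set ℂ) (T : Set (Set ℂ)) (p : ℂ),
      IsGluedPair H ∧ IsConvexEquilateralHexagon H ∧ IsMonohedralTiling H T ∧
      IsCyclicAbout T n p ∧ symmetries T = cyclicAt n p ∧ IsSpiralTiling T n p := by
  have hn3 : (3 : ℝ) ≤ n := by exact_mod_cast hn
  have hπ := Real.pi_pos
  have hβ : 0 < 2 * Real.pi / n := by positivity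
  -- A quarter of the sector makes the two angles unequal, hence the tiling chiral. It also suits `n
  -- = 3`, where the sector is obtuse and the long diagonal is not the diameter: spokes 1 and 2
  -- become perpendicular, which `fixes_zero_of_width` still admits.
  have H : IsSpokeAngle n (2 * Real.pi / n / 4) := ⟨hn, by linarith, by linarith⟩
  have hβ3 := H.three_mul_le
  have hC := H.isCyclicAbout (Real.sin_lt_sin_of_lt_of_le_pi_div_two (by linarith)
    (by linarith) (by linarith))
  refine ⟨_, _, 0, H.prototile.1, H.prototile.2, H.isMonohedralTiling, hC,
    symmetries_eq_of_fixes hC fun g hg => ?_, H.isSpiralTiling⟩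
  rcases hn.eq_or_lt with rfl | h4
  · obtain ⟨d1, d2, d3⟩ := dot_spoke (n := 3) (γ := 2 * Real.pi / (3 : ℕ) / 4)
    have hneg : ∀ z w : ℂ, dot z (-w) = -dot z w := fun z w => by simp [dot]; ring
    have hswap : ∀ z w : ℂ, dot z w = dot w z := fun z w => by simp [dot]; ring
    refine H.fixes_zero_of_width ⟨norm_spoke _, norm_spoke _, by rw [norm_neg, norm_spoke],
      ?_, ?_, ?_⟩ ?_ hg
    · rw [hswap, d1]
      exact Real.cos_pos_of_mem_Ioo ⟨by linarith, by linarith⟩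
    · rw [hneg, d3, neg_pos]
      apply Real.cos_neg_of_pi_div_two_lt_of_lt <;> push_cast <;> linarith
    · rw [hneg, d2, show 2 * Real.pi / (3 : ℕ) - 2 * Real.pi / (3 : ℕ) / 4 = Real.pi / 2 by
        push_cast; ring, Real.cos_pi_div_two, neg_zero]
    · rw [spoke_zero, spoke_one, spoke_two, ← cis_zero, cross_cis, cross_cis, sub_zero, sub_zero,
        ← Real.sin_pi_sub (2 * Real.pi / (3 : ℕ))]
      apply Real.sin_lt_sin_of_lt_of_le_pi_div_two <;> push_cast <;> linarith
  · exact H.fixes_zero_of_diameter h4 hg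

/-- The spiral tilings with at least three arms and reflection symmetry. -/
lemma dihedral_of_three_le {n : ℕ} (hn : 3 ≤ n) :
    ∃ (H : Set ℂ) (T : Set (Set ℂ)) (p u : ℂ), ‖u‖ = 1 ∧
      IsGluedPair H ∧ IsConvexEquilateralHexagon H ∧ IsMonohedralTiling H T ∧
      IsDihedralAbout T n p u ∧ (4 ≤ n → symmetries T = dihedralAt n p u) ∧
      IsSpiralTiling T n p := by
  have hn3 : (3 : ℝ) ≤ n := by exact_mod_cast hn
  have hπ := Real.pi_pos
  have hβ : 0 < 2 * Real.pi / n := by positivity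
  -- Equally spaced spokes. For `n = 3` they are at 60° and the tiles are regular hexagons, so the
  -- full symmetry group is left aside there.
  have H : IsSpokeAngle n (2 * Real.pi / n / 2) := ⟨hn, by linarith, by linarith⟩
  exact ⟨_, _, 0, 1, norm_one, H.prototile.1, H.prototile.2, H.isMonohedralTiling,
    H.isDihedralAbout, fun h4 => symmetries_eq_of_fixes H.isDihedralAbout fun g hg =>
      H.fixes_zero_of_diameter h4 hg, H.isSpiralTiling⟩

theorem mainTheorem3 (n : ℕ) (hn : 1 ≤ n) :
    (∃ (H : Set ℂ) (T : Set (Set ℂ)) (p : ℂ),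
      IsGluedPair H ∧ IsConvexEquilateralHexagon H ∧ IsMonohedralTiling H T ∧
      IsCyclicAbout T n p ∧
      EssentiallyIn T (cyclicAt n p) ∧
      (3 ≤ n → symmetries T = cyclicAt n p) ∧
      (2 ≤ n → IsSpiralTiling T n p)) ∧
    (∃ (H : Set ℂ) (T : Set (Set ℂ)) (p u : ℂ), ‖u‖ = 1 ∧
      IsGluedPair H ∧ IsConvexEquilateralHexagon H ∧ IsMonohedralTiling H T ∧
      IsDihedralAbout T n p u ∧
      (n ≠ 1 → n ≠ 3 → EssentiallyIn T (dihedralAt n p u)) ∧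
      (4 ≤ n → symmetries T = dihedralAt n p u) ∧
      (2 ≤ n → IsSpiralTiling T n p)) := by
  rcases (by omega : n = 1 ∨ n = 2 ∨ 3 ≤ n) with rfl | rfl | hn3
  · obtain ⟨H, T, p, h1, h2, h3, h4, h5⟩ := cyclic_one
    obtain ⟨H', T', p', u', k0, k1, k2, k3, k4⟩ := dihedral_one
    exact ⟨⟨H, T, p, h1, h2, h3, h4, h5, by omega, by omega⟩,
      ⟨H', T', p', u', k0, k1, k2, k3, k4, fun h => absurd rfl h, by omega, by omega⟩⟩
  · obtain ⟨H, T, p, h1, h2, h3, h4, h5, h6⟩ := cyclic_two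
    obtain ⟨H', T', p', u', k0, k1, k2, k3, k4, k5, k6⟩ := dihedral_two
    exact ⟨⟨H, T, p, h1, h2, h3, h4, h5, by omega, fun _ => h6⟩,
      ⟨H', T', p', u', k0, k1, k2, k3, k4, fun _ _ => k5, by omega, fun _ => k6⟩⟩
  · obtain ⟨H, T, p, h1, h2, h3, h4, h5, h6⟩ := cyclic_of_three_le hn3
    obtain ⟨H', T', p', u', k0, k1, k2, k3, k4, k5, k6⟩ := dihedral_of_three_le hn3
    exact ⟨⟨H, T, p, h1, h2, h3, h4, essentiallyIn_of_subset h5.le, fun _ => h5, fun _ => h6⟩,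
      ⟨H', T', p', u', k0, k1, k2, k3, k4,
        fun n1 n3 => essentiallyIn_of_subset (k5 (by omega)).le, k5, fun _ => k6⟩⟩
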